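/- Let $k$ be an algebraically closed field of characteristic $0$, let $\mathfrak g$ be a finite-dimensional simple Lie algebra over $k$, and let $\sigma$ be an automorphism of $\mathfrak g$ of order $2$, with eigenspace decomposition $\mathfrak g=\mathfrak g_0\oplus\mathfrak g_1$, where $\sigma=(-1)^i$ on $\mathfrak g_i$. The subalgebra $\mathfrak g_0$ is reductive; let $\mathfrak g_{0,\mathrm{ab}}$ be its center. Let the generator of $\Gamma=\{1,\sigma\}$ act on $k[t,t^{-1}]$ by $t\mapsto t^{-1}$, and let $\mathfrak M=(\mathfrak g\otimes k[t,t^{-1}])^{\Gamma}$ be the corresponding generalized Onsager algebra, i.e. the Lie algebra of $\Gamma$-equivariant regular maps $k^\times\to\mathfrak g$. For $x\in k^\times$ let $\mathfrak g^x$ be the subalgebra of $\mathfrak g$ fixed by the isotropy group of $x$, so that $\mathfrak g^x=\mathfrak g$ if $x\neq\pm1$ and $\mathfrak g^{\pm1}=\mathfrak g_0$. An evaluation representation at $x$ is the pullback to $\mathfrak M$ of a representation of $\mathfrak g^x$ along the evaluation map $\mathfrak M\to\mathfrak g^x$, $\alpha\mapsto\alpha(x)$. Let $V,V'$ be irreducible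 finite-dimensional evaluation representations of $\mathfrak M$ at the same point $x\in k^\times$, and let $\mathrm{Ext}^1_{\mathfrak M}(V,V')$ be the $k$-vector space of equivalence classes of extensions of $V$ by $V'$ as $\mathfrak M$-modules. The isomorphisms below are isomorphisms of $k$-vector spaces. (a) If $x\neq\pm1$, then $$\mathrm{Ext}^1_{\mathfrak M}(V,V')\cong\begin{cases}\mathrm{Hom}_{\mathfrak g}(\mathfrak g,V^*\otimes V') & \text{if } V\not\cong V',\\ \mathrm{Hom}_{\mathfrak g}(\mathfrak g,V^*\otimes V')\oplus k^{2\dim\mathfrak g_{0,\mathrm{ab}}} & \text{if } V\cong V'.\end{cases}$$ In particular, if $\mathfrak g_{0,\mathrm{ab}}\neq0$ and $V\cong V'$, then $\mathrm{Ext}^1_{\mathfrak M}(V,V')\cong\mathrm{Hom}_{\mathfrak g}(\mathfrak g,V^*\otimes V')\oplus k^2$. (b) If $x=\pm1$, then $$\mathrm{Ext}^1_{\mathfrak M}(V,V')\cong\begin{cases}\mathrm{Hom}_{\mathfrak g_0}(\mathfrak g_1,V^*\otimes V') & \text{if } V\not\cong V',\\ \mathrm{Hom}_{\mathfrak g_0}(\mathfrak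 g_1,V^*\otimes V')\oplus k^{2\dim\mathfrak g_{0,\mathrm{ab}}} & \text{if } V\cong V'.\end{cases}$$ (c) If $x=\pm1$, then $\mathfrak g_{0,\mathrm{ab}}$ acts on $V$ and on $V'$ by linear forms $\lambda$ and $\lambda'$ on $\mathfrak g_{0,\mathrm{ab}}$, respectively, and $$\mathrm{Ext}^1_{\mathfrak M}(V,V')\cong\begin{cases}\mathrm{Hom}_{\mathfrak g_0}(\mathfrak g_1,V^*\otimes V') & \text{if } \lambda\neq\lambda', \text{ or if } \lambda=\lambda' \text{ and } \mathfrak g_{0,\mathrm{ab}}=0,\\ 0 & \text{if } \lambda=\lambda',\ \mathfrak g_{0,\mathrm{ab}}\neq0,\ V\not\cong V',\\ k^2 & \text{if } \mathfrak g_{0,\mathrm{ab}}\neq0,\ V\cong V'.\end{cases}$$ -/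

import Mathlib

open scoped TensorProduct LaurentPolynomial

universe u

noncomputable section

namespace Onsager

section Ext

attribute [local instance 100] LieRing.ofAssociativeRing

variable {k : Type u} [Field k] {L : Type u} [LieRing L] [LieAlgebra k L]
variable {V V' : Type u} [AddCommGroup V] [Module k V] [AddCommGroup V'] [Module k V']

/-- A representation `ρ` of the Lie algebra `L` on `V`, as an object of the category of
representations of `L`, i.e. of the category of (left) modules over the universal enveloping
algebra `U(L)`. -/
def repModule (ρ : L →ₗ⁅k⁆ Module.End k V) : ModuleCat.{u} (UniversalEnvelopingAlgebra k L) :=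
  letI : Module (UniversalEnvelopingAlgebra k L) V :=
    Module.compHom V (UniversalEnvelopingAlgebra.lift k ρ).toRingHom
  ModuleCat.of (UniversalEnvelopingAlgebra k L) V

/-- The `k`-vector space `Ext¹_L(V, V')` of (classes of) extensions `0 → V' → E → V → 0` of
representations of the Lie algebra `L`. -/
abbrev Ext1 (ρ : L →ₗ⁅k⁆ Module.End k V) (ρ' : L →ₗ⁅k⁆ Module.End k V') : Type u :=
  CategoryTheory.Abelian.Ext.{u} (repModule ρ) (repModule ρ') 1

/-- Isomorphism of representations of `L`. -/
def RepIso (ρ : L →ₗ⁅k⁆ Module.End k V) (ρ' : L →ₗ⁅k⁆ Module.End k V') : Prop :=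
  ∃ e : V ≃ₗ[k] V', ∀ (l : L) (v : V), e (ρ l v) = ρ' l (e v)

end Ext

section Algebra

variable {k : Type u} [Field k] {g : Type u} [LieRing g] [LieAlgebra k g]

/-- The fixed point subalgebra `g₀` of an automorphism `σ` of `g`. -/
def fixedSubalgebra (σ : g ≃ₗ⁅k⁆ g) : LieSubalgebra k g where
  carrier := {u | σ u = u}
  add_mem' {a b} ha hb := by
    simp only [Set.mem_ofPred_eq] at *
    rw [map_add, ha, hb]
  zero_mem' := map_zero σ
  smul_mem' c a ha := by
    simp only [Set.mem_ofPred_eq] at *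
    rw [map_smul, ha]
  lie_mem' {a b} ha hb := by
    change σ ⁅a, b⁆ = ⁅a, b⁆
    rw [LieEquiv.map_lie, show σ a = a from ha, show σ b = b from hb]

/-- The `(-1)`-eigenspace `g₁` of `σ`, as a `g₀`-submodule of `g`. -/
def oddPart (σ : g ≃ₗ⁅k⁆ g) : LieSubmodule k (fixedSubalgebra σ) g where
  carrier := {u | σ u = -u}
  add_mem' {a b} ha hb := by
    simp only [Set.mem_ofPred_eq] at *
    rw [map_add, ha, hb, neg_add]
  zero_mem' := by simp
  smul_mem' c a ha := by
    simp only [Set.mem_ofPred_eq] at *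
    rw [map_smul, ha, smul_neg]
  lie_mem {a b} hb := by
    change σ ⁅(a : g), b⁆ = -⁅(a : g), b⁆
    rw [LieEquiv.map_lie, show σ (a : g) = a from a.2, show σ b = -b from hb, lie_neg]

/-- `g_{0,ab}`, identified with the center of `g₀`. -/
abbrev abPart (σ : g ≃ₗ⁅k⁆ g) : LieIdeal k (fixedSubalgebra σ) :=
  LieAlgebra.center k (fixedSubalgebra σ)

/-- The action of the nontrivial element of the group of order two on `k[t, t⁻¹] ⊗ g`:
`f(t) ⊗ u ↦ f(t⁻¹) ⊗ σ u`. -/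
def diagAction (σ : g ≃ₗ⁅k⁆ g) : k[T;T⁻¹] ⊗[k] g →ₗ⁅k⁆ k[T;T⁻¹] ⊗[k] g :=
  LieAlgebra.ExtendScalars.map
    (LaurentPolynomial.invert : k[T;T⁻¹] ≃ₐ[k] k[T;T⁻¹]).toAlgHom σ.toLieHom

/-- The generalized Onsager algebra `M(kˣ, g)^Γ`: the elements of `k[t, t⁻¹] ⊗ g` that are fixed
by the diagonal action of `Γ = {1, σ}`, that is, the equivariant regular maps `kˣ → g`. -/
def onsagerAlgebra (σ : g ≃ₗ⁅k⁆ g) : LieSubalgebra k (k[T;T⁻¹] ⊗[k] g) where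
  carrier := {α | diagAction σ α = α}
  add_mem' {a b} ha hb := by
    simp only [Set.mem_ofPred_eq] at *
    rw [map_add, ha, hb]
  zero_mem' := map_zero (diagAction σ)
  smul_mem' c a ha := by
    simp only [Set.mem_ofPred_eq] at *
    rw [map_smul, ha]
  lie_mem' {a b} ha hb := by
    change diagAction σ ⁅a, b⁆ = ⁅a, b⁆
    rw [LieHom.map_lie, show diagAction σ a = a from ha, show diagAction σ b = b from hb]

/-- Evaluation of Laurent polynomials at `x ∈ kˣ`. -/
def laurentEval (x : kˣ) : k[T;T⁻¹] →ₐ[k] k :=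
  { LaurentPolynomial.eval₂ (RingHom.id k) x with
    commutes' := fun r => LaurentPolynomial.eval₂_C (RingHom.id k) x r }

/-- Evaluation `M(kˣ, g) = k[t, t⁻¹] ⊗ g → g`, `f ⊗ u ↦ f(x) u`, at `x ∈ kˣ`. -/
def evalMap (x : kˣ) : k[T;T⁻¹] ⊗[k] g →ₗ⁅k⁆ g :=
  { (TensorProduct.lid k g).toLinearMap ∘ₗ
      TensorProduct.map (laurentEval x).toLinearMap LinearMap.id with
    map_lie' := by
      intro a b
      change TensorProduct.lid k g (TensorProduct.map (laurentEval x).toLinearMap LinearMap.id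
          (LieRing.toBracket.bracket a b)) =
        ⁅TensorProduct.lid k g (TensorProduct.map (laurentEval x).toLinearMap LinearMap.id a),
          TensorProduct.lid k g (TensorProduct.map (laurentEval x).toLinearMap LinearMap.id b)⁆
      induction a with
      | zero =>
        rw [show LieRing.toBracket.bracket (0 : k[T;T⁻¹] ⊗[k] g) b = 0 from zero_lie b]
        simp
      | add a₁ a₂ h₁ h₂ => simp only [LieRing.add_lie, map_add, h₁, h₂]
      | tmul p y =>
        induction b with
        | zero =>
          rw [show LieRing.toBracket.bracket (p ⊗ₜ[k] y) (0 : k[T;T⁻¹] ⊗[k] g) = 0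
            from lie_zero (p ⊗ₜ[k] y)]
          simp
        | add b₁ b₂ h₁ h₂ => simp only [LieRing.lie_add, map_add, h₁, h₂]
        | tmul q z =>
          change TensorProduct.lid k g (TensorProduct.map (laurentEval x).toLinearMap LinearMap.id
            ((p * q) ⊗ₜ ⁅y, z⁆)) = _
          simp [smul_smul, mul_comm] }

@[simp]
theorem evalMap_tmul (x : kˣ) (f : k[T;T⁻¹]) (y : g) :
    evalMap x (f ⊗ₜ[k] y) = laurentEval x f • y := rfl

/-- The evaluation map `ev_x` of the generalized Onsager algebra, with values in `g`. -/
def ev (σ : g ≃ₗ⁅k⁆ g) (x : kˣ) : onsagerAlgebra σ →ₗ⁅k⁆ g :=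
  (evalMap x).comp (onsagerAlgebra σ).incl

theorem laurentEval_invert (x : kˣ) (hx : x = 1 ∨ x = -1) (f : k[T;T⁻¹]) :
    laurentEval x (LaurentPolynomial.invert f) = laurentEval x f := by
  have hinv : x⁻¹ = x := by rcases hx with rfl | rfl <;> simp
  induction f using LaurentPolynomial.induction_on' with
  | add p q hp hq => rw [map_add, map_add, map_add, hp, hq]
  | C_mul_T n a =>
    have hT : ∀ m : ℤ, laurentEval x (LaurentPolynomial.T m) = ((x ^ m : kˣ) : k) :=
      fun m => LaurentPolynomial.eval₂_T (RingHom.id k) x m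
    rw [map_mul, LaurentPolynomial.invert_C, LaurentPolynomial.invert_T, map_mul, map_mul, hT, hT,
      zpow_neg, ← inv_zpow, hinv]

/-- At `x = ±1` (the fixed points of `t ↦ t⁻¹`), equivariant maps take values in `g₀`. -/
theorem ev_mem_fixedSubalgebra (σ : g ≃ₗ⁅k⁆ g) (x : kˣ) (hx : x = 1 ∨ x = -1)
    (α : onsagerAlgebra σ) : ev σ x α ∈ fixedSubalgebra σ := by
  have key : ∀ a : k[T;T⁻¹] ⊗[k] g, evalMap x (diagAction σ a) = σ (evalMap x a) := by
    intro a
    induction a with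
    | zero => simp
    | add a b ha hb => simp only [map_add, ha, hb]
    | tmul f y =>
      change laurentEval x (LaurentPolynomial.invert f) • σ y = σ (laurentEval x f • y)
      rw [laurentEval_invert x hx, map_smul]
  change σ (evalMap x α.1) = evalMap x α.1
  rw [← key, show diagAction σ α.1 = α.1 from α.2]

/-- The evaluation map `ev_x` of the generalized Onsager algebra at a point `x = ±1`, with values
in the isotropy subalgebra `g^x = g₀`. -/
def evFixed (σ : g ≃ₗ⁅k⁆ g) (x : kˣ) (hx : x = 1 ∨ x = -1) :
    onsagerAlgebra σ →ₗ⁅k⁆ fixedSubalgebra σ where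
  toFun α := ⟨ev σ x α, ev_mem_fixedSubalgebra σ x hx α⟩
  map_add' a b := Subtype.ext (map_add (ev σ x) a b)
  map_smul' c a := Subtype.ext (map_smul (ev σ x) c a)
  map_lie' {a b} := Subtype.ext (LieHom.map_lie (ev σ x) a b)

end Algebra

section Representations

attribute [local instance 100] LieRing.ofAssociativeRing

variable {k : Type u} [Field k] {g : Type u} [LieRing g] [LieAlgebra k g]

/-- The evaluation representation of the generalized Onsager algebra at a point `x ≠ ±1` (where
the isotropy group is trivial and `g^x = g`) attached to the representation `V` of `g`. -/
def evalRep (σ : g ≃ₗ⁅k⁆ g) (x : kˣ) (V : Type u) [AddCommGroup V] [Module k V]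
    [LieRingModule g V] [LieModule k g V] : onsagerAlgebra σ →ₗ⁅k⁆ Module.End k V :=
  (LieModule.toEnd k g V).comp (ev σ x)

/-- The evaluation representation of the generalized Onsager algebra at a point `x = ±1` (where
`g^x = g₀`) attached to the representation `V` of `g₀`. -/
def evalRepFixed (σ : g ≃ₗ⁅k⁆ g) (x : kˣ) (hx : x = 1 ∨ x = -1) (V : Type u) [AddCommGroup V]
    [Module k V] [LieRingModule (fixedSubalgebra σ) V] [LieModule k (fixedSubalgebra σ) V] :
    onsagerAlgebra σ →ₗ⁅k⁆ Module.End k V :=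
  (LieModule.toEnd k (fixedSubalgebra σ) V).comp (evFixed σ x hx)

/-- `g_{0,ab}` acts on the representation `V` of `g₀` by the linear form `χ`. -/
def ActsBy (σ : g ≃ₗ⁅k⁆ g) (V : Type u) [AddCommGroup V] [Module k V]
    [LieRingModule (fixedSubalgebra σ) V] (χ : Module.Dual k (abPart σ)) : Prop :=
  ∀ (z : abPart σ) (v : V), ⁅(z : fixedSubalgebra σ), v⁆ = χ z • v

end Representations

end Onsager

end

/-! For representations pulled back along an evaluation `M → gˣ`, `Ext¹(V, V')` is the cohomology
`H¹(M, W)` with `W = Hom(V, V')`: the `U(M)`-module `U(M) ⊗ V` is free, homomorphisms out of the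
kernel of `U(M) ⊗ V → V` are the 1-cocycles, and those that extend to `U(M) ⊗ V` are the inner ones
(`nonempty_ext1_equiv`). It remains to compute `H¹(M, W)`.

Put `s = t + t⁻¹` and `θ = t - t⁻¹`, so that `θ² = s² - 4`. Then `M = k[s] ⊗ g₀ ⊕ θ k[s] ⊗ g₁`.
There are two sources of cocycles: the derivative at `x`, followed by a module homomorphism to `W`;
and the value at `1` or `-1`, projected to the center of `g₀` and followed by a linear map to the
invariants of `W`. These represent every class exactly once (`nonempty_generic_equiv`,
`nonempty_fixed_equiv`).

To see this at `x ≠ ±1`, let `a = x + x⁻¹`. As `g₁ = [g₀, g₁]` and `g₀ = [g₁, g₁]`, a cocycle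
vanishes on `θ(s - a)² k[s] ⊗ g₁` and on `(s - a)²(s² - 4) k[s] ⊗ g₀`. On `(s - a)² k[s] ⊗ g₀` it
sees only the center of `g₀`, whose complement is semisimple and hence perfect. After subtracting
the cocycles above, what is left factors through the evaluation and is inner by Whitehead's first
lemma (`exists_inner_of_hasTrivialRadical`). At `x = ±1` lower powers of `s - a` suffice, because
evaluation kills the odd part and the derivative takes values in `g₁`; the remaining cocycle on `g₀`
is inner up to a map on the center.

By Schur's lemma the invariants of `W` have dimension one if `V ≅ V'` and zero otherwise. The
explicit values rest on `eq_zero_of_lie_center_eq_zero`: a nonzero central element of `g₀` acts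
injectively on `g₁`. So two central elements, having a common eigenvector in `g₁`, are proportional,
and the center is at most a line. If it is nonzero and acts trivially on `W`, there is no nonzero
homomorphism from `g₁` to `W`. -/

noncomputable section

namespace Onsager

/-! ### First extension groups from a projective presentation. -/

section ExtOfProjective

open CategoryTheory Abelian

/-- If `0 → X₁ → X₂ → X₃ → 0` is a short exact sequence with `X₂` projective, then `Ext¹(X₃, Y)` is
the cokernel of the restriction map `Hom(X₂, Y) → Hom(X₁, Y)`. -/
theorem nonempty_ext_one_equiv_of_projective {k : Type*} [CommRing k] {C : Type*} [Category C]
    [Abelian C] [Linear k C] [HasExt.{u} C] {S : ShortComplex C} (hS : S.ShortExact)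
    [Projective S.X₂] (Y : C) :
    Nonempty (((S.X₁ ⟶ Y) ⧸ LinearMap.range (Linear.leftComp k Y S.f)) ≃ₗ[k]
      Ext.{u} S.X₃ Y 1) := by
  let Θ : (S.X₁ ⟶ Y) →ₗ[k] Ext.{u} S.X₃ Y 1 :=
    (Ext.precompOfLinear hS.extClass k Y (add_zero 1)) ∘ₗ
      (Ext.linearEquiv₀ (R := k) (X := S.X₁) (Y := Y)).symm.toLinearMap
  have hΘ : ∀ f, Θ f = hS.extClass.comp (Ext.mk₀ f) (add_zero 1) := fun f => by
    simp [Θ]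
  -- Exactness of the long `Ext` sequence at `Hom(X₁, Y)`.
  have hker : LinearMap.range (Linear.leftComp k Y S.f) = LinearMap.ker Θ := by
    ext f
    rw [LinearMap.mem_ker, hΘ]
    constructor
    · rintro ⟨g, rfl⟩
      change hS.extClass.comp (Ext.mk₀ (S.f ≫ g)) (add_zero 1) = 0
      rw [← Ext.mk₀_comp_mk₀]
      exact hS.extClass_comp_assoc _
    · intro h
      obtain ⟨x, hx⟩ := Ext.contravariant_sequence_exact₁ hS Y (Ext.mk₀ f) (add_zero 1) h
      obtain ⟨g, rfl⟩ := Ext.homEquiv₀.symm.surjective x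
      refine ⟨g, ?_⟩
      change S.f ≫ g = f
      apply Ext.homEquiv₀.symm.injective
      change Ext.mk₀ (S.f ≫ g) = Ext.mk₀ f
      rw [← Ext.mk₀_comp_mk₀]
      exact hx
  -- The next term of the sequence is `Ext¹(X₂, Y)`, which vanishes by projectivity.
  have hsurj : Function.Surjective Θ := by
    intro x
    obtain ⟨y, hy⟩ := Ext.contravariant_sequence_exact₃ hS Y x
      (Ext.eq_zero_of_projective _) (add_zero 1)
    obtain ⟨f, rfl⟩ := Ext.homEquiv₀.symm.surjective y
    exact ⟨f, (hΘ f).trans hy⟩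
  exact ⟨(Submodule.quotEquivOfEq _ _ hker).trans (Θ.quotKerEquivOfSurjective hsurj)⟩

end ExtOfProjective

/-! ### Cocycles and first cohomology. -/

section Cocycles

variable {k L h W : Type*} [Field k] [LieRing L] [LieAlgebra k L] [LieRing h] [LieAlgebra k h]
  [AddCommGroup W] [Module k W] [LieRingModule h W] [LieModule k h W]

/-- The `1`-cocycles of `L` with values in the pullback of the `h`-module `W` along `π : L → h`. -/
def cocycles (π : L →ₗ⁅k⁆ h) (W : Type*) [AddCommGroup W] [Module k W] [LieRingModule h W]
    [LieModule k h W] : Submodule k (L →ₗ[k] W) where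
  carrier := {d | ∀ a b, d ⁅a, b⁆ = ⁅π a, d b⁆ - ⁅π b, d a⁆}
  add_mem' {c d} hc hd a b := by
    simp only [LinearMap.add_apply, hc a b, hd a b, lie_add]
    abel
  zero_mem' a b := by simp
  smul_mem' r d hd a b := by
    simp only [LinearMap.smul_apply, hd a b, lie_smul, smul_sub]

theorem mem_cocycles {π : L →ₗ⁅k⁆ h} {d : L →ₗ[k] W} :
    d ∈ cocycles π W ↔ ∀ a b, d ⁅a, b⁆ = ⁅π a, d b⁆ - ⁅π b, d a⁆ := Iff.rfl

/-- The map sending `w` to the inner cocycle `a ↦ π a • w`. -/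
def innerCocycle (π : L →ₗ⁅k⁆ h) (W : Type*) [AddCommGroup W] [Module k W] [LieRingModule h W]
    [LieModule k h W] : W →ₗ[k] cocycles π W where
  toFun w :=
    ⟨{ toFun a := ⁅π a, w⁆
       map_add' a b := by rw [map_add, add_lie]
       map_smul' r a := by rw [map_smul, smul_lie]; rfl }, fun a b => by simp⟩
  map_add' v w := by ext a; simp
  map_smul' r w := by ext a; simp

/-- The first cohomology of `L` with values in the pullback of `W` along `π`. -/
def FirstCohomology (π : L →ₗ⁅k⁆ h) (W : Type*) [AddCommGroup W] [Module k W] [LieRingModule h W]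
    [LieModule k h W] : Type _ :=
  cocycles π W ⧸ LinearMap.range (innerCocycle π W)

instance (π : L →ₗ⁅k⁆ h) : AddCommGroup (FirstCohomology π W) :=
  inferInstanceAs (AddCommGroup (cocycles π W ⧸ LinearMap.range (innerCocycle π W)))

instance (π : L →ₗ⁅k⁆ h) : Module k (FirstCohomology π W) :=
  inferInstanceAs (Module k (cocycles π W ⧸ LinearMap.range (innerCocycle π W)))

/-- An equivalence with the space of cocycles that matches the inner cocycles with a given subspace
induces an equivalence with first cohomology. -/
def FirstCohomology.equivOfEquiv {π : L →ₗ⁅k⁆ h} {X : Type*} [AddCommGroup X] [Module k X]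
    (N : Submodule k X) (e : X ≃ₗ[k] cocycles π W)
    (he : ∀ x, x ∈ N ↔ ∃ w, ∀ a, (e x : L →ₗ[k] W) a = ⁅π a, w⁆) :
    (X ⧸ N) ≃ₗ[k] FirstCohomology π W :=
  Submodule.Quotient.equiv N (LinearMap.range (innerCocycle π W)) e (by
    ext d
    obtain ⟨x, rfl⟩ := e.surjective d
    rw [Submodule.mem_map_equiv, LinearEquiv.symm_apply_apply, he, LinearMap.mem_range]
    exact exists_congr fun w => ⟨fun h => Subtype.ext (LinearMap.ext fun a => (h a).symm),
      fun h a => by rw [← h]; rfl⟩)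

end Cocycles

/-! ### `Ext¹` over the enveloping algebra as first cohomology. -/

section ExtOne

attribute [local instance 100] LieRing.ofAssociativeRing

variable {k : Type u} [Field k] {L : Type u} [LieRing L] [LieAlgebra k L]
variable {V V' : Type u} [AddCommGroup V] [Module k V] [AddCommGroup V'] [Module k V']

local notation "𝓤" => UniversalEnvelopingAlgebra k L
local notation "ιU" => UniversalEnvelopingAlgebra.ι k (L := L)
local notation "liftU" => UniversalEnvelopingAlgebra.lift k (L := L)

/-- The elements satisfying `p` form a subalgebra containing the generators. The universal property
maps `U(L)` into it, and the composite with the inclusion fixes the generators, so it is the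
identity. -/
theorem universalEnvelopingAlgebra_induction {p : 𝓤 → Prop} (halg : ∀ r, p (algebraMap k 𝓤 r))
    (hι : ∀ l, p (ιU l)) (hadd : ∀ a b, p a → p b → p (a + b))
    (hmul : ∀ a b, p a → p b → p (a * b)) (x : 𝓤) : p x := by
  let s : Subalgebra k 𝓤 :=
    { carrier := {x | p x}
      mul_mem' := fun {a b} ha hb => hmul a b ha hb
      add_mem' := fun {a b} ha hb => hadd a b ha hb
      algebraMap_mem' := halg }
  let f : L →ₗ⁅k⁆ s :=
    { toFun l := ⟨ιU l, hι l⟩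
      map_add' a b := Subtype.ext (map_add _ _ _)
      map_smul' r a := Subtype.ext (map_smul _ _ _)
      map_lie' {a b} := Subtype.ext (LieHom.map_lie _ _ _) }
  have : s.val.comp (liftU f) = AlgHom.id k 𝓤 := by
    ext l
    change ((liftU f (ιU l) : s) : 𝓤) = ιU l
    rw [UniversalEnvelopingAlgebra.lift_ι_apply]
    rfl
  rw [← AlgHom.id_apply (R := k) x, ← this]
  exact (liftU f x).2

/-- The identification of the underlying groups of `V` and of the `U(L)`-module attached to a
representation of `L` on `V`. -/
def toRepModule (ρ : L →ₗ⁅k⁆ Module.End k V) : V ≃+ repModule ρ := AddEquiv.refl V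

theorem smul_toRepModule (ρ : L →ₗ⁅k⁆ Module.End k V) (a : 𝓤) (v : V) :
    a • toRepModule ρ v = toRepModule ρ (liftU ρ a v) := rfl

/-- The action map `U(L) ⊗ V → V` of a representation `V` of `L`. -/
def actionMap (ρ : L →ₗ⁅k⁆ Module.End k V) : 𝓤 ⊗[k] V →ₗ[𝓤] repModule ρ where
  toFun m := toRepModule ρ (TensorProduct.lift (liftU ρ).toLinearMap m)
  map_add' x y := by simp
  map_smul' a m := by
    rw [RingHom.id_apply, smul_toRepModule]
    congr 1
    induction m with
    | zero => simp
    | add x y hx hy => simp only [smul_add, map_add, hx, hy]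
    | tmul b v =>
      change (liftU ρ (a * b) : Module.End k V) v = _
      rw [map_mul]
      rfl

@[simp]
theorem actionMap_tmul (ρ : L →ₗ⁅k⁆ Module.End k V) (a : 𝓤) (v : V) :
    actionMap ρ (a ⊗ₜ v) = toRepModule ρ (liftU ρ a v) := rfl

/-- The short exact sequence `0 → N → U(L) ⊗ V → V → 0`. -/
def actionComplex (ρ : L →ₗ⁅k⁆ Module.End k V) :
    CategoryTheory.ShortComplex (ModuleCat.{u} 𝓤) :=
  CategoryTheory.ShortComplex.mk (X₁ := ModuleCat.of 𝓤 (LinearMap.ker (actionMap ρ)))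
    (X₂ := ModuleCat.of 𝓤 (𝓤 ⊗[k] V)) (X₃ := repModule ρ)
    (ModuleCat.ofHom (LinearMap.ker (actionMap ρ)).subtype)
    (ModuleCat.ofHom (Y := repModule ρ) (actionMap ρ)) (by
      ext x
      exact x.2)

theorem actionComplex_shortExact (ρ : L →ₗ⁅k⁆ Module.End k V) :
    (actionComplex ρ).ShortExact where
  exact := by
    rw [CategoryTheory.ShortComplex.moduleCat_exact_iff]
    intro x hx
    have hx' : x ∈ LinearMap.ker (actionMap ρ) := hx
    exact ⟨⟨x, hx'⟩, rfl⟩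
  mono_f := (ModuleCat.mono_iff_injective _).mpr Subtype.val_injective
  epi_g := (ModuleCat.epi_iff_surjective _).mpr fun v => by
    obtain ⟨v, rfl⟩ := (toRepModule ρ).surjective v
    refine ⟨(1 : 𝓤) ⊗ₜ[k] v, (actionMap_tmul ρ 1 v).trans ?_⟩
    rw [map_one]
    rfl

/-- Extending scalars from `k` to `U(L)` turns a vector space into a free module. -/
instance (ρ : L →ₗ⁅k⁆ Module.End k V) : CategoryTheory.Projective (actionComplex ρ).X₂ :=
  (IsProjective.iff_projective (ModuleCat.of 𝓤 (𝓤 ⊗[k] V))).mp inferInstance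

/-- The elements `l ⊗ v - 1 ⊗ l v`, which generate the kernel of `U(L) ⊗ V → V`. -/
def actionSyzygy (ρ : L →ₗ⁅k⁆ Module.End k V) (l : L) (v : V) : LinearMap.ker (actionMap ρ) :=
  ⟨ιU l ⊗ₜ v - 1 ⊗ₜ ρ l v, by
    rw [LinearMap.mem_ker, map_sub, actionMap_tmul, actionMap_tmul, map_one,
      UniversalEnvelopingAlgebra.lift_ι_apply, Module.End.one_apply, sub_self]⟩

/-- For a product, `ab ⊗ v - 1 ⊗ abv = a (b ⊗ v - 1 ⊗ bv) + (a ⊗ bv - 1 ⊗ abv)`. -/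
theorem sub_one_tmul_mem_span (ρ : L →ₗ⁅k⁆ Module.End k V) (x : 𝓤) (v : V) :
    x ⊗ₜ[k] v - 1 ⊗ₜ (liftU ρ x v) ∈
      Submodule.span 𝓤 (Set.range fun p : L × V => (actionSyzygy ρ p.1 p.2 : 𝓤 ⊗[k] V)) := by
  induction x using universalEnvelopingAlgebra_induction generalizing v with
  | halg r =>
    rw [AlgHom.commutes, Algebra.algebraMap_eq_smul_one, TensorProduct.smul_tmul]
    simp
  | hι l =>
    rw [UniversalEnvelopingAlgebra.lift_ι_apply]
    exact Submodule.subset_span ⟨(l, v), rfl⟩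
  | hadd a b ha hb =>
    have := add_mem (ha v) (hb v)
    rw [map_add, LinearMap.add_apply, TensorProduct.tmul_add, TensorProduct.add_tmul]
    convert this using 1
    abel
  | hmul a b ha hb =>
    have := add_mem (Submodule.smul_mem _ a (hb v)) (ha (liftU ρ b v))
    rw [map_mul, Module.End.mul_apply]
    convert this using 1
    rw [smul_sub, TensorProduct.smul_tmul', TensorProduct.smul_tmul', smul_eq_mul, smul_eq_mul,
      mul_one]
    abel

theorem sub_one_tmul_actionMap_mem_span (ρ : L →ₗ⁅k⁆ Module.End k V) (m : 𝓤 ⊗[k] V) :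
    m - 1 ⊗ₜ (toRepModule ρ).symm (actionMap ρ m) ∈
      Submodule.span 𝓤 (Set.range fun p : L × V => (actionSyzygy ρ p.1 p.2 : 𝓤 ⊗[k] V)) := by
  induction m with
  | zero => simp
  | add x y hx hy =>
    have := add_mem hx hy
    rw [map_add, map_add, TensorProduct.tmul_add]
    convert this using 1
    abel
  | tmul x v => exact sub_one_tmul_mem_span ρ x v

/-- An element `m` of the kernel is equal to `m` minus `1 ⊗` its image, which lies in the span. -/
theorem span_actionSyzygy (ρ : L →ₗ⁅k⁆ Module.End k V) :
    Submodule.span 𝓤 (Set.range fun p : L × V => actionSyzygy ρ p.1 p.2) = ⊤ := by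
  have hinj := (LinearMap.ker (actionMap ρ)).injective_subtype
  apply Submodule.map_injective_of_injective hinj
  rw [Submodule.map_span, Submodule.map_top, Submodule.range_subtype, ← Set.range_comp]
  refine le_antisymm (Submodule.span_le.mpr ?_) fun m hm => ?_
  · rintro _ ⟨p, rfl⟩
    exact (actionSyzygy ρ p.1 p.2).2
  · have := sub_one_tmul_actionMap_mem_span ρ m
    rw [LinearMap.mem_ker.mp hm, map_zero, TensorProduct.tmul_zero, sub_zero] at this
    exact this

theorem smul_eq_algebraMap_smul_tmul (r : k) (m : 𝓤 ⊗[k] V) : algebraMap k 𝓤 r • m = r • m :=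
  algebraMap_smul 𝓤 r m

theorem actionSyzygy_add_left (ρ : L →ₗ⁅k⁆ Module.End k V) (a b : L) (v : V) :
    actionSyzygy ρ (a + b) v = actionSyzygy ρ a v + actionSyzygy ρ b v := by
  apply Subtype.ext
  simp only [actionSyzygy, map_add, LinearMap.add_apply, TensorProduct.tmul_add,
    TensorProduct.add_tmul, Submodule.coe_add]
  abel

theorem actionSyzygy_add_right (ρ : L →ₗ⁅k⁆ Module.End k V) (a : L) (v w : V) :
    actionSyzygy ρ a (v + w) = actionSyzygy ρ a v + actionSyzygy ρ a w := by
  apply Subtype.ext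
  simp only [actionSyzygy, map_add, TensorProduct.tmul_add, Submodule.coe_add]
  abel

/-- The scalar is written as an element of `U(L)`, since the maps to be applied to it are
`U(L)`-linear. -/
theorem actionSyzygy_smul_left (ρ : L →ₗ⁅k⁆ Module.End k V) (r : k) (a : L) (v : V) :
    actionSyzygy ρ (r • a) v = algebraMap k 𝓤 r • actionSyzygy ρ a v := by
  apply Subtype.ext
  rw [Submodule.coe_smul]
  rw [smul_eq_algebraMap_smul_tmul]
  simp only [actionSyzygy, map_smul, LinearMap.smul_apply, TensorProduct.tmul_smul, smul_sub,
    ← TensorProduct.smul_tmul']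

theorem actionSyzygy_smul_right (ρ : L →ₗ⁅k⁆ Module.End k V) (r : k) (a : L) (v : V) :
    actionSyzygy ρ a (r • v) = algebraMap k 𝓤 r • actionSyzygy ρ a v := by
  apply Subtype.ext
  rw [Submodule.coe_smul]
  rw [smul_eq_algebraMap_smul_tmul]
  simp only [actionSyzygy, map_smul, TensorProduct.tmul_smul, smul_sub]

/-- A `U(L)`-linear map applied to this identity gives the cocycle condition for the action of `L`
on linear maps. -/
theorem actionSyzygy_lie (ρ : L →ₗ⁅k⁆ Module.End k V) (a b : L) (v : V) :
    actionSyzygy ρ ⁅a, b⁆ v = (ιU a • actionSyzygy ρ b v + actionSyzygy ρ a (ρ b v)) -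
      (ιU b • actionSyzygy ρ a v + actionSyzygy ρ b (ρ a v)) := by
  apply Subtype.ext
  simp only [Submodule.coe_sub, Submodule.coe_add, Submodule.coe_smul, actionSyzygy, smul_sub,
    TensorProduct.smul_tmul', smul_eq_mul, mul_one, LieHom.map_lie, Ring.lie_def,
    TensorProduct.sub_tmul, LinearMap.sub_apply, Module.End.mul_apply, TensorProduct.tmul_sub]
  abel

theorem algebraMap_smul_toRepModule (ρ : L →ₗ⁅k⁆ Module.End k V) (r : k) (v : V) :
    algebraMap k 𝓤 r • toRepModule ρ v = toRepModule ρ (r • v) := by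
  rw [smul_toRepModule, AlgHom.commutes, Module.algebraMap_end_apply]

theorem toRepModule_symm_algebraMap_smul (ρ : L →ₗ⁅k⁆ Module.End k V) (r : k) (x : repModule ρ) :
    (toRepModule ρ).symm (algebraMap k 𝓤 r • x) = r • (toRepModule ρ).symm x := by
  obtain ⟨v, rfl⟩ := (toRepModule ρ).surjective x
  rw [algebraMap_smul_toRepModule, AddEquiv.symm_apply_apply, AddEquiv.symm_apply_apply]

theorem toRepModule_symm_ι_smul (ρ : L →ₗ⁅k⁆ Module.End k V) (l : L) (x : repModule ρ) :
    (toRepModule ρ).symm (ιU l • x) = ρ l ((toRepModule ρ).symm x) := by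
  obtain ⟨v, rfl⟩ := (toRepModule ρ).surjective x
  rw [smul_toRepModule, AddEquiv.symm_apply_apply, AddEquiv.symm_apply_apply,
    UniversalEnvelopingAlgebra.lift_ι_apply]

section Pullback

variable {h : Type*} [LieRing h] [LieAlgebra k h] [LieRingModule h V] [LieModule k h V]
  [LieRingModule h V'] [LieModule k h V']

/-- The pullback along `π : L → h` of the representation of `h` on `V`. -/
abbrev pullbackRep (π : L →ₗ⁅k⁆ h) (V : Type u) [AddCommGroup V] [Module k V] [LieRingModule h V]
    [LieModule k h V] : L →ₗ⁅k⁆ Module.End k V := (LieModule.toEnd k h V).comp π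

/-- The cocycle defined by a homomorphism on the kernel of `U(L) ⊗ V → V`. -/
def syzygyCocycle (π : L →ₗ⁅k⁆ h) 
    (f : LinearMap.ker (actionMap (pullbackRep π V)) →ₗ[𝓤] repModule (pullbackRep π V')) :
    cocycles π (V →ₗ[k] V') :=
  ⟨LinearMap.mk₂ k (fun l v => (toRepModule (pullbackRep π V')).symm
      (f (actionSyzygy (pullbackRep π V) l v)))
      (fun a b v => by rw [actionSyzygy_add_left, map_add, map_add])
      (fun r a v => by
        rw [actionSyzygy_smul_left, map_smul, toRepModule_symm_algebraMap_smul])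
      (fun a v w => by rw [actionSyzygy_add_right, map_add, map_add])
      (fun r a v => by
        rw [actionSyzygy_smul_right, map_smul, toRepModule_symm_algebraMap_smul]), by
    intro a b
    ext v
    simp only [LinearMap.mk₂_apply, actionSyzygy_lie, map_add, map_sub, map_smul,
      toRepModule_symm_ι_smul, LinearMap.sub_apply, LieHom.lie_apply]
    simp only [LieHom.comp_apply, LieModule.toEnd_apply_apply]
    abel⟩

@[simp]
theorem syzygyCocycle_apply (π : L →ₗ⁅k⁆ h) 
    (f : LinearMap.ker (actionMap (pullbackRep π V)) →ₗ[𝓤] repModule (pullbackRep π V')) (l : L)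
    (v : V) : (syzygyCocycle π f : L →ₗ[k] V →ₗ[k] V') l v =
      (toRepModule (pullbackRep π V')).symm (f (actionSyzygy (pullbackRep π V) l v)) := rfl

theorem syzygyCocycle_injective (π : L →ₗ⁅k⁆ h) :
    Function.Injective (syzygyCocycle (V := V) (V' := V') π) := by
  intro f f' hf
  refine LinearMap.ext_on_range (span_actionSyzygy (pullbackRep π V)) fun p => ?_
  apply (toRepModule (pullbackRep π V')).symm.injective
  rw [← syzygyCocycle_apply, hf, syzygyCocycle_apply]

/-- The representation on `V × V'` that is the extension of `V` by `V'` defined by a cocycle. -/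
def extensionRep (π : L →ₗ⁅k⁆ h) (d : cocycles π (V →ₗ[k] V')) :
    L →ₗ⁅k⁆ Module.End k (V × V') where
  toFun l := ((LieModule.toEnd k h V (π l)).comp (LinearMap.fst k V V')).prod
    (((d : L →ₗ[k] V →ₗ[k] V') l).comp (LinearMap.fst k V V') +
      (LieModule.toEnd k h V' (π l)).comp (LinearMap.snd k V V'))
  map_add' a b := by ext <;> simp
  map_smul' r a := by ext <;> simp
  map_lie' {a b} := by
    have := d.2 a b
    ext v
    · simp [Ring.lie_def]
    · simp [Ring.lie_def, this]
      abel
    · simp [Ring.lie_def]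
    · simp [Ring.lie_def]

theorem lift_extensionRep_fst (π : L →ₗ⁅k⁆ h) (d : cocycles π (V →ₗ[k] V')) (a : 𝓤) (x : V × V') :
    (liftU (extensionRep π d) a x).1 = liftU (pullbackRep π V) a x.1 := by
  induction a using universalEnvelopingAlgebra_induction generalizing x with
  | halg r => simp [AlgHom.commutes]
  | hι l =>
    rw [UniversalEnvelopingAlgebra.lift_ι_apply, UniversalEnvelopingAlgebra.lift_ι_apply]
    rfl
  | hadd a b ha hb => simp [ha, hb]
  | hmul a b ha hb => simp [ha, hb]

theorem lift_extensionRep_inr (π : L →ₗ⁅k⁆ h) (d : cocycles π (V →ₗ[k] V')) (a : 𝓤) (w : V') :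
    liftU (extensionRep π d) a (0, w) = (0, liftU (pullbackRep π V') a w) := by
  induction a using universalEnvelopingAlgebra_induction generalizing w with
  | halg r => simp [AlgHom.commutes]
  | hι l =>
    rw [UniversalEnvelopingAlgebra.lift_ι_apply, UniversalEnvelopingAlgebra.lift_ι_apply]
    ext <;> simp [extensionRep]
  | hadd a b ha hb => simp [ha, hb]
  | hmul a b ha hb => simp [ha, hb]

/-- A cocycle `d` makes `V × V'` an extension. The `U(L)`-linear map `a ⊗ v ↦ a (v, 0)` has the
action map as first component, so it sends the kernel to `V'`; on `l ⊗ v - 1 ⊗ l v` its value is `d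
l v`. -/
theorem syzygyCocycle_surjective (π : L →ₗ⁅k⁆ h) :
    Function.Surjective (syzygyCocycle (V := V) (V' := V') π) := by
  intro d
  let E : 𝓤 ⊗[k] V →ₗ[k] V × V' :=
    TensorProduct.lift ((LinearMap.lcomp k (V × V') (LinearMap.inl k V V')) ∘ₗ
      (liftU (extensionRep π d)).toLinearMap)
  have hE : ∀ (a : 𝓤) (v : V), E (a ⊗ₜ v) = liftU (extensionRep π d) a (v, 0) := fun a v => rfl
  have hsmul : ∀ (a : 𝓤) (m : 𝓤 ⊗[k] V), E (a • m) = liftU (extensionRep π d) a (E m) := by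
    intro a m
    induction m with
    | zero => simp
    | add x y hx hy => simp only [smul_add, map_add, hx, hy]
    | tmul b v => rw [TensorProduct.smul_tmul', hE, hE, smul_eq_mul, map_mul]; rfl
  have hfst : ∀ m : 𝓤 ⊗[k] V,
      (E m).1 = (toRepModule _).symm (actionMap (pullbackRep π V) m) := by
    intro m
    induction m with
    | zero => simp
    | add x y hx hy => simp only [map_add, Prod.fst_add, hx, hy]
    | tmul b v =>
      rw [hE, lift_extensionRep_fst]
      rfl
  have hker : ∀ m : LinearMap.ker (actionMap (pullbackRep π V)), E m = (0, (E m).2) := fun m => by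
    apply Prod.ext
    · rw [hfst, LinearMap.mem_ker.mp m.2, map_zero]
    · rfl
  refine ⟨{ toFun := fun m => toRepModule (pullbackRep π V') (E m).2
            map_add' := fun x y => by simp
            map_smul' := fun a m => ?_ }, ?_⟩
  · rw [RingHom.id_apply, Submodule.coe_smul, hsmul, hker, lift_extensionRep_inr, smul_toRepModule]
  · ext l v
    rw [syzygyCocycle_apply]
    change (E (ιU l ⊗ₜ v - 1 ⊗ₜ ⁅π l, v⁆)).2 = _
    rw [map_sub, hE, hE, map_one, UniversalEnvelopingAlgebra.lift_ι_apply]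
    simp [extensionRep]

/-- `Ext¹` of representations of `L` that are pulled back along `π : L → h` is the first cohomology
of `L` with values in the space of linear maps. -/
theorem nonempty_ext1_equiv (π : L →ₗ⁅k⁆ h) :
    Nonempty (Ext1 (pullbackRep π V) (pullbackRep π V') ≃ₗ[k]
      FirstCohomology π (V →ₗ[k] V')) := by
  obtain ⟨e⟩ := nonempty_ext_one_equiv_of_projective (k := k)
    (actionComplex_shortExact (pullbackRep π V)) (repModule (pullbackRep π V'))
  let c : ((actionComplex (pullbackRep π V)).X₁ ⟶ repModule (pullbackRep π V')) →ₗ[k]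
      cocycles π (V →ₗ[k] V') :=
    { toFun f := syzygyCocycle π f.hom
      map_add' f f' := by
        apply Subtype.ext
        ext l v
        rfl
      map_smul' r f := by
        apply Subtype.ext
        ext l v
        exact toRepModule_symm_algebraMap_smul (pullbackRep π V') r _ }
  let ce := LinearEquiv.ofBijective c
    ⟨fun f f' hf => ModuleCat.hom_ext (syzygyCocycle_injective π hf), fun d => by
      obtain ⟨f, hf⟩ := syzygyCocycle_surjective π d
      exact ⟨ModuleCat.ofHom (Y := repModule (pullbackRep π V')) f, hf⟩⟩
  refine ⟨e.symm.trans (FirstCohomology.equivOfEquiv _ ce fun f => ⟨?_, ?_⟩)⟩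
  -- A map on the free module is determined by `w v = G (1 ⊗ v)`, and its value on `l ⊗ v - 1 ⊗ l v`
  -- is `l (w v) - w (l v)`, which is the action of `l` on `w`.
  · rintro ⟨F, rfl⟩
    obtain ⟨G, hG⟩ : ∃ G : 𝓤 ⊗[k] V →ₗ[𝓤] repModule (pullbackRep π V'), G = F.hom := ⟨F.hom, rfl⟩
    have hsmul : ∀ (a : 𝓤) (v : V), G (a ⊗ₜ[k] v) = a • G ((1 : 𝓤) ⊗ₜ[k] v) := fun a v => by
      rw [← map_smul, TensorProduct.smul_tmul', smul_eq_mul, mul_one]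
    refine ⟨{ toFun := fun v => (toRepModule (pullbackRep π V')).symm (G ((1 : 𝓤) ⊗ₜ[k] v))
              map_add' := fun v w => ?_
              map_smul' := fun r v => ?_ }, fun l => ?_⟩
    · rw [TensorProduct.tmul_add, map_add, map_add]
    · rw [TensorProduct.tmul_smul, ← smul_eq_algebraMap_smul_tmul, map_smul,
        toRepModule_symm_algebraMap_smul]
      rfl
    · ext v
      have hc : (ce (CategoryTheory.Linear.leftComp k _ (actionComplex (pullbackRep π V)).f F) :
          L →ₗ[k] V →ₗ[k] V') l v = (toRepModule (pullbackRep π V')).symm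
            (G ((ιU l ⊗ₜ[k] v : 𝓤 ⊗[k] V) - (1 : 𝓤) ⊗ₜ[k] ⁅π l, v⁆)) := by
        rw [hG]
        rfl
      rw [hc, map_sub, hsmul, map_sub, toRepModule_symm_ι_smul]
      rfl
  -- Conversely, `w` extends to the `U(L)`-linear map `a ⊗ v ↦ a (w v)`.
  · rintro ⟨w, hw⟩
    let F : 𝓤 ⊗[k] V →ₗ[𝓤] repModule (pullbackRep π V') :=
      actionMap (pullbackRep π V') ∘ₗ TensorProduct.AlgebraTensorModule.map LinearMap.id w
    refine ⟨ModuleCat.ofHom (Y := repModule (pullbackRep π V')) F, ?_⟩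
    apply ce.injective
    apply Subtype.ext
    ext l v
    rw [hw]
    change (toRepModule (pullbackRep π V')).symm (F (ιU l ⊗ₜ[k] v - (1 : 𝓤) ⊗ₜ[k] ⁅π l, v⁆)) = _
    rw [map_sub]
    change liftU (pullbackRep π V') (ιU l) (w v) - liftU (pullbackRep π V') 1 (w ⁅π l, v⁆) = _
    rw [UniversalEnvelopingAlgebra.lift_ι_apply, map_one]
    rfl

end Pullback

end ExtOne

/-! ### Whitehead's first lemma, by Casimir operators and Cartan's criterion. -/

section Whitehead

open LieModule

variable {k : Type*} [Field k] {L : Type*} [LieRing L] [LieAlgebra k L]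
variable {W : Type*} [AddCommGroup W] [Module k W] [LieRingModule L W] [LieModule k L W]

/-- **Schur's lemma** for Lie modules. -/
theorem exists_eq_smul_of_forall_lie_apply [IsAlgClosed k] [FiniteDimensional k W]
    [LieModule.IsIrreducible k L W] (f : W →ₗ[k] W) (hf : ∀ (x : L) w, f ⁅x, w⁆ = ⁅x, f w⁆) :
    ∃ c : k, ∀ w, f w = c • w := by
  have := LieModule.nontrivial_of_isIrreducible k L W
  obtain ⟨c, hc⟩ := Module.End.exists_eigenvalue f
  refine ⟨c, fun w => ?_⟩
  let N : LieSubmodule k L W :=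
    { Module.End.eigenspace f c with
      lie_mem := fun {x m} hm => by
        have hm' : f m = c • m := Module.End.mem_eigenspace_iff.mp hm
        refine Module.End.mem_eigenspace_iff.mpr ?_
        rw [hf, hm', lie_smul] }
  have hN : N ≠ ⊥ := by
    obtain ⟨v, hv⟩ := hc.exists_hasEigenvector
    intro h
    have hvN : v ∈ N := hv.1
    rw [h, LieSubmodule.mem_bot] at hvN
    exact hv.2 hvN
  have hw : w ∈ N := by
    rw [(IsSimpleOrder.eq_bot_or_eq_top N).resolve_left hN]
    trivial
  exact Module.End.mem_eigenspace_iff.mp hw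

section Casimir

variable [FiniteDimensional k L] (J : LieIdeal k L)
  (B : LinearMap.BilinForm k J)

/-- The invariance of the Casimir tensor of an invariant form on an ideal. -/
theorem sum_dualBasis_lie_eq_zero {ι : Type*} [Fintype ι] [DecidableEq ι] (hB : B.Nondegenerate)
    (hinv : ∀ (u : L) (x y : J), B ⁅u, x⁆ y = - B x ⁅u, y⁆)
    (e : Module.Basis ι k J) (F : J →ₗ[k] J →ₗ[k] W) (u : L) :
    ∑ i, (F ⁅u, e i⁆ (B.dualBasis hB e i) + F (e i) ⁅u, B.dualBasis hB e i⁆) = 0 := by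
  set e' := B.dualBasis hB e
  have h₁ : ∀ x : J, x = ∑ j, B (e' j) x • e j := fun x => by
    have : ∀ j, B (e' j) x = e.repr x j := fun j => by
      conv_lhs => rw [← e.sum_repr x]
      simp only [map_sum, map_smul, e', LinearMap.BilinForm.apply_dualBasis_left, smul_eq_mul,
        mul_ite, mul_one, mul_zero, Finset.sum_ite_eq', Finset.mem_univ, if_true]
    simp only [this, e.sum_repr]
  have h₂ : ∀ x : J, x = ∑ j, B x (e j) • e' j := fun x => by
    have : ∀ j, B x (e j) = e'.repr x j := fun j => by
      conv_lhs => rw [← e'.sum_repr x]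
      simp only [map_sum, map_smul, LinearMap.sum_apply, LinearMap.smul_apply, e',
        LinearMap.BilinForm.apply_dualBasis_left, smul_eq_mul,
        mul_ite, mul_one, mul_zero, Finset.sum_ite_eq, Finset.mem_univ, if_true]
    simp only [this, e'.sum_repr]
  rw [Finset.sum_add_distrib]
  have s₁ : ∑ i, F ⁅u, e i⁆ (e' i) = ∑ i, ∑ j, B (e' j) ⁅u, e i⁆ • F (e j) (e' i) := by
    refine Finset.sum_congr rfl fun i _ => ?_
    conv_lhs => rw [h₁ ⁅u, e i⁆]
    simp
  have s₂ : ∑ i, F (e i) ⁅u, e' i⁆ = ∑ i, ∑ j, B ⁅u, e' i⁆ (e j) • F (e i) (e' j) := by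
    refine Finset.sum_congr rfl fun i _ => ?_
    conv_lhs => rw [h₂ ⁅u, e' i⁆]
    simp
  -- After exchanging the sums, the coefficients of `F (e i) (e' j)` are `B (e' i) ⁅u, e j⁆` and `B
  -- ⁅u, e' i⁆ (e j)`, which are opposite by invariance.
  rw [s₁, s₂, Finset.sum_comm, ← Finset.sum_add_distrib]
  refine Finset.sum_eq_zero fun i _ => ?_
  rw [← Finset.sum_add_distrib]
  refine Finset.sum_eq_zero fun j _ => ?_
  rw [hinv, neg_smul, add_neg_cancel]

/-- The Casimir operator `C` of `J` commutes with `L`, so it is a scalar `c`; its trace is `dim J ≠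
0`, so `c ≠ 0`. Invariance of the Casimir tensor, applied to `x ⊗ y ↦ x · d y`, gives `C (d u) = u ·
∑ e i · d (e' i)`, and one divides by `c`. -/
theorem exists_inner_of_traceForm_restrict_nondegenerate [IsAlgClosed k] [CharZero k]
    [FiniteDimensional k W] [LieModule.IsIrreducible k L W] (hJ : J ≠ ⊥)
    (hnd : ∀ x ∈ J, (∀ y ∈ J, traceForm k L W x y = 0) → x = 0)
    (d : L →ₗ[k] W) (hd : ∀ a b, d ⁅a, b⁆ = ⁅a, d b⁆ - ⁅b, d a⁆) :
    ∃ w, ∀ a, d a = ⁅a, w⁆ := by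
  let B : LinearMap.BilinForm k J := (traceForm k L W).restrict J.toSubmodule
  have hBapp : ∀ x y : J, B x y = traceForm k L W x y := fun _ _ => rfl
  have hsymm : B.IsSymm := ⟨fun x y => traceForm_comm k L W x y⟩
  have hB : B.Nondegenerate := by
    refine hsymm.isRefl.nondegenerate_iff_separatingLeft.mpr ?_
    intro x hx
    exact Subtype.ext (hnd x x.2 fun y hy => hx ⟨y, hy⟩)
  have hinv : ∀ (u : L) (x y : J), B ⁅u, x⁆ y = - B x ⁅u, y⁆ := fun u x y =>
    traceForm_apply_lie_apply' k L W u x y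
  classical
  let e := Module.finBasis k J
  let e' := B.dualBasis hB e
  let C : W →ₗ[k] W := ∑ i, (toEnd k L W (e i)).comp (toEnd k L W (e' i))
  have hC : ∀ w, C w = ∑ i, ⁅(e i : L), ⁅(e' i : L), w⁆⁆ := fun w => by simp [C]
  have hcomm : ∀ (u : L) w, C ⁅u, w⁆ = ⁅u, C w⁆ := by
    intro u w
    let F : J →ₗ[k] J →ₗ[k] W := LinearMap.mk₂ k (fun x y => ⁅(x : L), ⁅(y : L), w⁆⁆)
      (by intros; simp) (by intros; simp) (by intros; simp) (by intros; simp)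
    have := sum_dualBasis_lie_eq_zero J B hB hinv e F u
    rw [hC, hC, lie_sum, eq_comm, ← sub_eq_zero, ← Finset.sum_sub_distrib, ← this]
    refine Finset.sum_congr rfl fun i _ => ?_
    change _ = ⁅⁅u, (e i : L)⁆, ⁅(e' i : L), w⁆⁆ + ⁅(e i : L), ⁅⁅u, (e' i : L)⁆, w⁆⁆
    rw [lie_lie, lie_lie u, lie_sub]
    abel
  obtain ⟨c, hc⟩ := exists_eq_smul_of_forall_lie_apply C hcomm
  have hc0 : c ≠ 0 := by
    rintro rfl
    have h0 : C = 0 := by ext w; simp [hc]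
    have htr : LinearMap.trace k W C = Module.finrank k J := by
      simp only [C, map_sum]
      have : ∀ i, LinearMap.trace k W ((toEnd k L W (e i)).comp (toEnd k L W (e' i))) = 1 := by
        intro i
        rw [← traceForm_apply_apply, ← hBapp]
        rw [LinearMap.BilinForm.IsSymm.eq hsymm]
        simp [e', LinearMap.BilinForm.apply_dualBasis_left]
      simp [this]
    rw [h0, map_zero, eq_comm, Nat.cast_eq_zero] at htr
    apply hJ
    have hsub : Subsingleton J := Module.finrank_zero_iff.mp htr
    rw [LieSubmodule.eq_bot_iff]
    intro x hx
    exact congrArg Subtype.val (Subsingleton.elim (⟨x, hx⟩ : J) 0)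
  refine ⟨c⁻¹ • ∑ i, ⁅(e i : L), d (e' i)⁆, fun u => ?_⟩
  let F : J →ₗ[k] J →ₗ[k] W := LinearMap.mk₂ k (fun x y => ⁅(x : L), d (y : L)⁆)
    (by intros; simp) (by intros; simp) (by intros; simp) (by intros; simp)
  have := sum_dualBasis_lie_eq_zero J B hB hinv e F u
  rw [lie_smul, eq_inv_smul_iff₀ hc0, ← hc, hC, lie_sum, eq_comm, ← sub_eq_zero,
    ← Finset.sum_sub_distrib, ← this]
  refine Finset.sum_congr rfl fun i _ => ?_
  change _ = ⁅⁅u, (e i : L)⁆, d (e' i : L)⁆ + ⁅(e i : L), d ⁅u, (e' i : L)⁆⁆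
  rw [hd, lie_lie, lie_sub]
  abel

end Casimir

attribute [local instance 100] LieRing.ofAssociativeRing

/-- The commutator with a nilpotent operator is nilpotent on `End W`, and `L` embeds there by
faithfulness. -/
theorem isNilpotent_ad_of_isNilpotent_toEnd [LieModule.IsFaithful k L W] {x : L}
    (hx : IsNilpotent (toEnd k L W x)) : IsNilpotent (LieAlgebra.ad k L x) := by
  obtain ⟨n, hn⟩ := LieAlgebra.ad_nilpotent_of_nilpotent (R := k) hx
  have hpow : ∀ (m : ℕ) (y : L), toEnd k L W ((LieAlgebra.ad k L x ^ m) y) =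
      (LieAlgebra.ad k (Module.End k W) (toEnd k L W x) ^ m) (toEnd k L W y) := by
    intro m y
    induction m with
    | zero => rfl
    | succ m ih =>
      rw [pow_succ', pow_succ', Module.End.mul_apply, Module.End.mul_apply, ← ih,
        LieAlgebra.ad_apply, LieAlgebra.ad_apply, LieHom.map_lie]
  refine ⟨n, LinearMap.ext fun y => ?_⟩
  rw [LinearMap.zero_apply, ← toEnd_eq_zero_iff (R := k) (L := L) (M := W), hpow, hn,
    LinearMap.zero_apply]

/-- **Cartan's criterion**: a Lie algebra with a faithful representation whose trace form vanishes
is solvable. -/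
theorem isSolvable_of_traceForm_eq_zero [CharZero k] [FiniteDimensional k L]
    [FiniteDimensional k W] [LieModule.IsFaithful k L W] (h : traceForm k L W = 0) :
    LieAlgebra.IsSolvable L := by
  -- The derived algebra acts by nilpotent operators. By faithfulness it is then ad-nilpotent, hence
  -- nilpotent by Engel's theorem, and `L` is solvable.
  have hnil := isNilpotent_derivedSeries_of_traceForm_eq_zero h
  set D := LieAlgebra.derivedSeries k L 1
  have hfaith : LieModule.IsFaithful k D W := by
    rw [isFaithful_iff']
    intro x hx
    apply Subtype.ext
    exact (isFaithful_iff' k L W).mp inferInstance x hx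
  have hD : LieRing.IsNilpotent D := by
    rw [LieAlgebra.isNilpotent_iff_forall (R := k)]
    intro x
    exact isNilpotent_ad_of_isNilpotent_toEnd (W := W)
      ((LieModule.isNilpotent_iff_forall' (R := k)).mp hnil x)
  obtain ⟨m, hm⟩ := LieAlgebra.IsSolvable.solvable k D
  rw [LieIdeal.derivedSeries_eq_bot_iff] at hm
  refine LieAlgebra.IsSolvable.mk (R := k) (k := m + 1) ?_
  rw [LieAlgebra.derivedSeries_def, LieAlgebra.derivedSeriesOfIdeal_add]
  exact hm

theorem eq_bot_of_traceForm_eq_zero_of_faithful [CharZero k] [FiniteDimensional k L]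
    [FiniteDimensional k W] [LieAlgebra.HasTrivialRadical k L] (R : LieIdeal k L)
    (htr : ∀ x ∈ R, ∀ y ∈ R, traceForm k L W x y = 0)
    (hfaith : ∀ x ∈ R, (∀ w : W, ⁅x, w⁆ = 0) → x = 0) : R = ⊥ := by
  have : LieModule.IsFaithful k R W := by
    rw [isFaithful_iff']
    intro x hx
    exact Subtype.ext (hfaith x x.2 hx)
  have : LieAlgebra.IsSolvable R := by
    apply isSolvable_of_traceForm_eq_zero (k := k) (W := W)
    ext x y
    exact htr x x.2 y y.2
  exact LieAlgebra.HasTrivialRadical.eq_bot_of_isSolvable R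

/-- By invariance and nondegeneracy of the Killing form, an element orthogonal to `[L, L]` is
central, hence zero. -/
theorem span_lie_eq_top_of_hasTrivialRadical [CharZero k] [FiniteDimensional k L]
    [LieAlgebra.HasTrivialRadical k L] :
    Submodule.span k {z : L | ∃ x y : L, ⁅x, y⁆ = z} = ⊤ := by
  let I : LieIdeal k L := LieAlgebra.derivedSeries k L 1
  have hI : I.killingCompl = ⊥ := by
    rw [LieSubmodule.eq_bot_iff]
    intro x hx
    have hc : ∀ y : L, ⁅x, y⁆ = 0 := by
      intro y
      refine (LieAlgebra.IsKilling.killingForm_nondegenerate k L).1 _ fun z => ?_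
      rw [traceForm_apply_lie_apply, traceForm_comm]
      refine (LieIdeal.mem_killingCompl k L I).mp hx _ ?_
      exact LieSubmodule.lie_mem_lie (I := (⊤ : LieIdeal k L)) (N := (⊤ : LieIdeal k L)) trivial
        trivial
    have : x ∈ LieAlgebra.center k L := fun y => by rw [← lie_skew, hc, neg_zero]
    rwa [LieAlgebra.center_eq_bot, LieSubmodule.mem_bot] at this
  have htop : I = ⊤ := by
    have := (LieIdeal.isCompl_killingCompl I).sup_eq_top
    rwa [hI, sup_bot_eq] at this
  have := LieAlgebra.coe_derivedSeries_one_eq k L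
  change (I.toSubmodule : Submodule k L) = _ at this
  rw [htop, LieSubmodule.top_toSubmodule] at this
  rw [this]

/-- Whitehead's first lemma for an irreducible module. -/
theorem exists_inner_of_isIrreducible [IsAlgClosed k] [CharZero k] [FiniteDimensional k L]
    [FiniteDimensional k W] [LieAlgebra.HasTrivialRadical k L] [LieModule.IsIrreducible k L W]
    (d : L →ₗ[k] W) (hd : ∀ a b, d ⁅a, b⁆ = ⁅a, d b⁆ - ⁅b, d a⁆) :
    ∃ w, ∀ a, d a = ⁅a, w⁆ := by
  -- `L` is the sum of the kernel of the action and its Killing complement `J`, and `J` acts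
  -- faithfully.
  let I := LieModule.ker k L W
  let J := I.killingCompl
  have hIJ : IsCompl I J := LieIdeal.isCompl_killingCompl I
  have hI : ∀ x ∈ J, (∀ w : W, ⁅x, w⁆ = 0) → x = 0 := by
    intro x hxJ hx
    have : x ∈ I ⊓ J := ⟨(LieModule.mem_ker k L W x).mpr hx, hxJ⟩
    rwa [hIJ.inf_eq_bot, LieSubmodule.mem_bot] at this
  by_cases hJ : J = ⊥
  -- The action is trivial here, so `d` kills brackets, and `L` is perfect.
  · have htop : I = ⊤ := by simpa [hJ] using hIJ.sup_eq_top
    have htriv : ∀ (x : L) (w : W), ⁅x, w⁆ = 0 := fun x =>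
      (LieModule.mem_ker k L W x).mp (show x ∈ I by rw [htop]; trivial)
    refine ⟨0, fun a => ?_⟩
    rw [lie_zero]
    have ha : a ∈ Submodule.span k {z : L | ∃ x y : L, ⁅x, y⁆ = z} := by
      rw [span_lie_eq_top_of_hasTrivialRadical]
      trivial
    induction ha using Submodule.span_induction with
    | mem z hz =>
      obtain ⟨x, y, rfl⟩ := hz
      rw [hd, htriv, htriv, sub_zero]
    | zero => exact map_zero d
    | add x y _ _ hx hy => rw [map_add, hx, hy, add_zero]
    | smul r x _ hx => rw [map_smul, hx, smul_zero]
  · refine exists_inner_of_traceForm_restrict_nondegenerate J hJ ?_ d hd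
    -- The radical of the trace form on `J` is an ideal with a faithful action and zero trace form,
    -- so it vanishes by Cartan's criterion.
    let R : LieIdeal k L :=
      { carrier := {x | x ∈ J ∧ ∀ y ∈ J, traceForm k L W x y = 0}
        add_mem' := fun {a b} ha hb => ⟨add_mem ha.1 hb.1, fun y hy => by
          rw [map_add, LinearMap.add_apply, ha.2 y hy, hb.2 y hy, add_zero]⟩
        zero_mem' := ⟨zero_mem _, fun y _ => by rw [map_zero, LinearMap.zero_apply]⟩
        smul_mem' := fun c x hx => ⟨J.smul_mem c hx.1, fun y hy => by
          rw [map_smul, LinearMap.smul_apply, hx.2 y hy, smul_zero]⟩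
        lie_mem := fun {u x} hx => ⟨J.lie_mem hx.1, fun y hy => by
          rw [traceForm_apply_lie_apply', hx.2 _ (J.lie_mem hy), neg_zero]⟩ }
    have hR : R = ⊥ := eq_bot_of_traceForm_eq_zero_of_faithful (W := W) R
      (fun x hx y hy => hx.2 y hy.1) (fun x hx => hI x hx.1)
    intro x hx hxy
    have : x ∈ R := ⟨hx, hxy⟩
    rwa [hR, LieSubmodule.mem_bot] at this

/-- **Whitehead's first lemma**. -/
theorem exists_inner_of_hasTrivialRadical [IsAlgClosed k] [CharZero k] [FiniteDimensional k L]
    [LieAlgebra.HasTrivialRadical k L] {W : Type u} [AddCommGroup W] [Module k W]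
    [LieRingModule L W] [LieModule k L W] [FiniteDimensional k W]
    (d : L →ₗ[k] W) (hd : ∀ a b, d ⁅a, b⁆ = ⁅a, d b⁆ - ⁅b, d a⁆) :
    ∃ w, ∀ a, d a = ⁅a, w⁆ := by
  induction hn : Module.finrank k W using Nat.strong_induction_on generalizing W with
  | _ n ih =>
    -- This condition also holds for `W = 0`, which is split off below.
    by_cases hirr : ∀ N : LieSubmodule k L W, N ≠ ⊥ → N = ⊤
    · rcases subsingleton_or_nontrivial W with hW | hW
      · exact ⟨0, fun a => Subsingleton.elim _ _⟩
      · have := LieModule.IsIrreducible.mk hirr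
        exact exists_inner_of_isIrreducible d hd
    · push Not at hirr
      obtain ⟨N, hbot, htop⟩ := hirr
      have hNtop : N.toSubmodule ≠ ⊤ := fun h => htop (LieSubmodule.toSubmodule_injective h)
      have hNbot : N.toSubmodule ≠ ⊥ := fun h => hbot ((LieSubmodule.toSubmodule_eq_bot N).mp h)
      have hN : Module.finrank k N < n := hn ▸ Submodule.finrank_lt hNtop
      have hQ : Module.finrank k (W ⧸ N) < n := by
        have h1 := Submodule.finrank_quotient_add_finrank N.toSubmodule
        have h2 : 0 < Module.finrank k N.toSubmodule :=
          Module.finrank_pos_iff.mpr ((Submodule.nontrivial_iff_ne_bot).mpr hNbot)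
        change Module.finrank k (W ⧸ N.toSubmodule) < n
        omega
      -- Make `d` inner modulo `N`; the difference takes values in `N`, where the induction
      -- hypothesis applies once more.
      obtain ⟨q, hq⟩ := ih _ hQ (W := W ⧸ N)
        ((LieSubmodule.Quotient.mk' N : W →ₗ[k] W ⧸ N) ∘ₗ d) (fun a b => by
          change LieSubmodule.Quotient.mk' N (d ⁅a, b⁆) =
            ⁅a, LieSubmodule.Quotient.mk' N (d b)⁆ - ⁅b, LieSubmodule.Quotient.mk' N (d a)⁆
          rw [hd, map_sub, LieModuleHom.map_lie, LieModuleHom.map_lie]) rfl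
      obtain ⟨w, rfl⟩ := LieSubmodule.Quotient.surjective_mk' N q
      have hmem : ∀ a, d a - ⁅a, w⁆ ∈ N := fun a => by
        have := hq a
        change LieSubmodule.Quotient.mk' N (d a) = ⁅a, LieSubmodule.Quotient.mk' N w⁆ at this
        rw [← LieModuleHom.map_lie, ← sub_eq_zero, ← map_sub] at this
        exact (LieSubmodule.Quotient.mk_eq_zero' (N := N)).mp this
      obtain ⟨v, hv⟩ := ih _ hN (W := N)
        { toFun := fun a => ⟨d a - ⁅a, w⁆, hmem a⟩
          map_add' := fun a b =>
            Subtype.ext (by simp only [map_add, add_lie, LieSubmodule.coe_add]; abel)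
          map_smul' := fun r a => Subtype.ext (by simp [smul_sub]) }
        (fun a b => Subtype.ext (by
          change d ⁅a, b⁆ - ⁅⁅a, b⁆, w⁆ = ⁅a, d b - ⁅b, w⁆⁆ - ⁅b, d a - ⁅a, w⁆⁆
          rw [hd, lie_lie, lie_sub, lie_sub]
          abel)) rfl
      refine ⟨w + v, fun a => ?_⟩
      have := congrArg Subtype.val (hv a)
      change d a - ⁅a, w⁆ = ⁅a, (v : W)⁆ at this
      rw [lie_add, ← this]
      abel

end Whitehead

/-! ### Jacobson's lemma and the trace form on abelian ideals. -/

section Jacobson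

variable {k : Type*} [Field k] {A : Type*} [Ring A] [Algebra k A]

-- The commutator with `y` is a derivation, and `[x, y]` can be moved to the right because it
-- commutes with `x`.
open Polynomial in
theorem aeval_commutator_of_commute {x y : A} (h : Commute x (x * y - y * x)) (p : k[X]) :
    aeval x p * y - y * aeval x p = aeval x (derivative p) * (x * y - y * x) := by
  induction p using Polynomial.induction_on' with
  | add p q hp hq =>
    simp only [map_add, add_mul, mul_add]
    rw [← hp, ← hq]
    abel
  | monomial n a =>
    induction n with
    | zero => simp [Algebra.commutes]
    | succ n ih =>
      have e₁ : aeval x (monomial (n + 1) a) = x * aeval x (monomial n a) := by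
        simp only [aeval_monomial, pow_succ']
        rw [← mul_assoc, ← mul_assoc, Algebra.commutes]
      have e₂ : aeval x (derivative (monomial (n + 1) a)) =
          x * aeval x (derivative (monomial n a)) + aeval x (monomial n a) := by
        rw [← X_mul_monomial, derivative_mul, derivative_X, one_mul, map_add, map_mul, aeval_X,
          add_comm]
      have hc : Commute (aeval x (monomial n a)) (x * y - y * x) := by
        rw [aeval_monomial]
        exact (Algebra.commute_algebraMap_left a _).mul_left (h.pow_left n)
      rw [e₁, e₂, add_mul, mul_assoc x (aeval x (derivative _)), ← ih, hc.eq]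
      noncomm_ring

/-- **Jacobson's lemma**: a commutator `[x, y]` that commutes with the algebraic element `x` is
nilpotent. -/
theorem isNilpotent_commutator_of_commute [CharZero k] {x y : A} (hx : IsAlgebraic k x)
    (h : Commute x (x * y - y * x)) : IsNilpotent (x * y - y * x) := by
  obtain ⟨p, hp0, hp⟩ := hx
  set f := x * y - y * x with hf
  -- Descent on the degree: placing `[p(x), y]` between two factors `f ^ m` turns `p(x) f ^ m = 0`
  -- into `p'(x) f ^ (2 * m + 1) = 0`. In characteristic zero this ends at a nonzero constant, and a
  -- power of `f` is zero.
  have key : ∀ (n : ℕ) (p : Polynomial k), p.natDegree = n → p ≠ 0 → ∀ m : ℕ,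
      Polynomial.aeval x p * f ^ m = 0 → IsNilpotent f := by
    intro n
    induction n with
    | zero =>
      intro p hpn hp0 m hm
      rw [Polynomial.eq_C_of_natDegree_eq_zero hpn] at hm hp0
      rw [Polynomial.aeval_C, ← Algebra.smul_def] at hm
      exact ⟨m, (smul_eq_zero_iff_right (fun h0 => hp0 (by rw [h0, map_zero]))).mp hm⟩
    | succ n ih =>
      intro p hpn hp0 m hm
      have hd : p.derivative.natDegree = n := by
        rw [Polynomial.natDegree_derivative, hpn, Nat.add_sub_cancel]
      have hd0 : p.derivative ≠ 0 := fun h0 => by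
        have := Polynomial.derivative_eq_zero.mp h0
        omega
      have hcp : ∀ q : Polynomial k, Commute (Polynomial.aeval x q) (f ^ m) := fun q => by
        refine Commute.pow_right ?_ m
        induction q using Polynomial.induction_on' with
        | add p q hp hq => rw [map_add]; exact hp.add_left hq
        | monomial n a =>
          rw [Polynomial.aeval_monomial]
          exact (Algebra.commute_algebraMap_left a _).mul_left (h.pow_left n)
      refine ih _ hd hd0 (2 * m + 1) ?_
      have h1 : f ^ m * (Polynomial.aeval x p * y - y * Polynomial.aeval x p) * f ^ m = 0 := by
        rw [mul_sub, ← mul_assoc, ← (hcp p).eq, hm, zero_mul, zero_sub, neg_mul, mul_assoc,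
          mul_assoc, hm, mul_zero, mul_zero, neg_zero]
      rw [aeval_commutator_of_commute h, ← mul_assoc, ← (hcp _).eq] at h1
      rw [← h1, ← hf]
      rw [mul_assoc, mul_assoc]
      congr 1
      rw [← mul_assoc, ← pow_succ, ← pow_add]
      congr 1
      ring
  exact key _ p rfl hp0 0 (by rw [hp, zero_mul])

end Jacobson

section TraceForm

open LieModule

attribute [local instance 100] LieRing.ofAssociativeRing

variable {k : Type*} [Field k] [CharZero k] {L : Type*} [LieRing L] [LieAlgebra k L]
  {M : Type*} [AddCommGroup M] [Module k M] [LieRingModule L M]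
  [LieModule k L M] [FiniteDimensional k M]

/-- If `I` is an abelian ideal of `L`, then `[L, I]` is in the kernel of the trace form of every
finite-dimensional representation of `L`. -/
theorem traceForm_lie_eq_zero_of_abelian (I : LieIdeal k L)
    (hI : ∀ x ∈ I, ∀ y ∈ I, ⁅x, y⁆ = 0) {x y z : L} (hx : x ∈ I) :
    traceForm k L M ⁅y, x⁆ z = 0 := by
  -- A bracket `[u, v]` with `v ∈ I` commutes with `v`, so it acts nilpotently by Jacobson's lemma.
  -- Elements of `I` commute, so all of `K` acts nilpotently.
  let K : LieIdeal k L := ⁅(⊤ : LieIdeal k L), I⁆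
  have hKI : K ≤ I := LieSubmodule.lie_le_right I ⊤
  have hnil : ∀ a ∈ K, IsNilpotent (toEnd k L M a) := by
    intro a ha
    have ha' : a ∈ K.toSubmodule := ha
    rw [LieSubmodule.lieIdeal_oper_eq_linear_span'] at ha'
    suffices a ∈ I ∧ IsNilpotent (toEnd k L M a) from this.2
    clear ha
    induction ha' using Submodule.span_induction with
    | mem c hc =>
      obtain ⟨u, -, v, hv, rfl⟩ := hc
      refine ⟨I.lie_mem hv, ?_⟩
      rw [← lie_skew, map_neg, isNilpotent_neg_iff, LieHom.map_lie, Ring.lie_def]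
      refine isNilpotent_commutator_of_commute (k := k)
        (Algebra.IsAlgebraic.isAlgebraic (toEnd k L M v)) ?_
      rw [← Ring.lie_def, ← LieHom.map_lie, commute_iff_lie_eq, ← LieHom.map_lie,
        hI v hv _ (lie_mem_left k L I v u hv), map_zero]
    | zero => exact ⟨zero_mem I, by rw [map_zero]; exact IsNilpotent.zero⟩
    | add a b _ _ ha hb =>
      refine ⟨add_mem ha.1 hb.1, ?_⟩
      rw [map_add]
      refine Commute.isNilpotent_add ?_ ha.2 hb.2
      rw [commute_iff_lie_eq, ← LieHom.map_lie, hI a ha.1 b hb.1, map_zero]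
    | smul c a _ ha =>
      refine ⟨I.smul_mem c ha.1, ?_⟩
      rw [map_smul]
      exact ha.2.smul c
  have hKnil : LieModule.IsNilpotent K M :=
    (LieModule.isNilpotent_iff_forall' (R := k)).mpr fun a => hnil a a.2
  obtain ⟨n, hn⟩ := (LieModule.isNilpotent_iff k K M).mp hKnil
  have hmem : ⁅y, x⁆ ∈ K := LieSubmodule.lie_mem_lie trivial hx
  rw [traceForm_apply_apply]
  refine (LinearMap.isNilpotent_trace_of_isNilpotent ⟨n, LinearMap.ext fun m => ?_⟩).eq_zero
  -- The lower central series of `M` under the ideal `K` is stable under `z`, while `[y, x] ∈ K`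
  -- goes one step down. The product is therefore nilpotent and has trace zero.
  have hstep : ∀ j : ℕ, ((toEnd k L M ⁅y, x⁆ ∘ₗ toEnd k L M z) ^ j) m ∈ K.lcs M j := by
    intro j
    induction j with
    | zero => simp
    | succ j ih =>
      rw [pow_succ', Module.End.mul_apply, LieIdeal.lcs_succ]
      exact LieSubmodule.lie_mem_lie hmem (LieSubmodule.lie_mem _ ih)
  have := hstep n
  rw [← LieSubmodule.mem_toSubmodule, LieIdeal.coe_lcs_eq, hn] at this
  simpa using this

end TraceForm

/-! ### The even and odd parts of a Lie algebra with involution. -/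

section Involution

open LieModule

variable {k : Type u} [Field k] {g : Type u} [LieRing g] [LieAlgebra k g] {σ : g ≃ₗ⁅k⁆ g}

theorem mem_fixedSubalgebra {x : g} : x ∈ fixedSubalgebra σ ↔ σ x = x := Iff.rfl

theorem mem_oddPart {x : g} : x ∈ oddPart σ ↔ σ x = -x := Iff.rfl

theorem lie_mem_fixedSubalgebra_of_odd {v w : g} (hv : v ∈ oddPart σ) (hw : w ∈ oddPart σ) :
    ⁅v, w⁆ ∈ fixedSubalgebra σ := by
  rw [mem_fixedSubalgebra, LieEquiv.map_lie, mem_oddPart.mp hv, mem_oddPart.mp hw, neg_lie,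
    lie_neg, neg_neg]

theorem lie_mem_oddPart {u v : g} (hu : u ∈ fixedSubalgebra σ) (hv : v ∈ oddPart σ) :
    ⁅u, v⁆ ∈ oddPart σ :=
  (oddPart σ).lie_mem (x := ⟨u, hu⟩) hv

theorem lie_center_eq_zero (z : abPart σ) {u : g} (hu : u ∈ fixedSubalgebra σ) :
    ⁅((z : fixedSubalgebra σ) : g), u⁆ = 0 := by
  have := (LieModule.mem_maxTrivSubmodule k (fixedSubalgebra σ) (fixedSubalgebra σ) _).mp z.2
    ⟨u, hu⟩
  have := congrArg Subtype.val this
  rw [← lie_skew]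
  change -⁅u, ((z : fixedSubalgebra σ) : g)⁆ = 0
  rw [show ⁅u, ((z : fixedSubalgebra σ) : g)⁆ = 0 from this, neg_zero]

theorem eq_zero_of_killingForm_eq_zero [LieAlgebra.IsKilling k g] {x : g}
    (h : ∀ y, killingForm k g x y = 0) : x = 0 :=
  (LieAlgebra.IsKilling.killingForm_nondegenerate k g).1 x h

variable [CharZero k]

theorem eq_zero_of_mem_fixedSubalgebra_of_mem_oddPart {x : g} (h0 : x ∈ fixedSubalgebra σ)
    (h1 : x ∈ oddPart σ) : x = 0 := by
  have h : x = -x := (mem_fixedSubalgebra.mp h0).symm.trans (mem_oddPart.mp h1)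
  have : (2 : k) • x = 0 := by
    rw [two_smul]
    nth_rewrite 1 [h]
    exact neg_add_cancel x
  exact (smul_eq_zero.mp this).resolve_left two_ne_zero

theorem exists_even_add_odd (hσ : ∀ u : g, σ (σ u) = u) (x : g) :
    ∃ a ∈ fixedSubalgebra σ, ∃ b ∈ oddPart σ, x = a + b := by
  refine ⟨(2⁻¹ : k) • (x + σ x), ?_, (2⁻¹ : k) • (x - σ x), ?_, ?_⟩
  · rw [mem_fixedSubalgebra, map_smul, map_add, hσ, add_comm]
  · rw [mem_oddPart, map_smul, map_sub, hσ, ← smul_neg, neg_sub]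
  · rw [← smul_add, show x + σ x + (x - σ x) = (2 : k) • x by rw [two_smul]; abel, smul_smul,
      inv_mul_cancel₀ two_ne_zero, one_smul]

/-- An automorphism preserves the Killing form. -/
theorem killingForm_even_odd {u v : g} (hu : u ∈ fixedSubalgebra σ) (hv : v ∈ oddPart σ) :
    killingForm k g u v = 0 := by
  have h := LieAlgebra.killingForm_of_equiv_apply σ u v
  rw [mem_fixedSubalgebra.mp hu, mem_oddPart.mp hv, map_neg] at h
  have : (2 : k) * killingForm k g u v = 0 := by linear_combination -h
  exact (mul_eq_zero.mp this).resolve_left two_ne_zero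

theorem oddPart_ne_bot (hσ : ∀ u : g, σ (σ u) = u) (hσ₁ : ∃ u : g, σ u ≠ u) :
    (oddPart σ).toSubmodule ≠ ⊥ := by
  obtain ⟨u, hu⟩ := hσ₁
  obtain ⟨a, ha, b, hb, rfl⟩ := exists_even_add_odd hσ u
  intro h
  have hb0 : b ∈ (oddPart σ).toSubmodule := hb
  rw [h, Submodule.mem_bot] at hb0
  rw [hb0, add_zero] at hu
  exact hu ha

variable [FiniteDimensional k g]

section Killing

variable [LieAlgebra.IsKilling k g]

theorem eq_zero_of_killingForm_even (hσ : ∀ u : g, σ (σ u) = u) {x : g}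
    (hx : x ∈ fixedSubalgebra σ) (h : ∀ y ∈ fixedSubalgebra σ, killingForm k g x y = 0) :
    x = 0 := by
  refine eq_zero_of_killingForm_eq_zero (k := k) fun y => ?_
  obtain ⟨a, ha, b, hb, rfl⟩ := exists_even_add_odd hσ y
  rw [map_add, h a ha, killingForm_even_odd hx hb, add_zero]

/-- `g` is perfect, and the odd part of `[a + b, c + d]` is `[a, d] - [c, b]` for `a`, `c` even and
`b`, `d` odd. -/
theorem span_lie_even_odd (hσ : ∀ u : g, σ (σ u) = u) {v : g} (hv : v ∈ oddPart σ) :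
    v ∈ Submodule.span k {z : g | ∃ a ∈ fixedSubalgebra σ, ∃ b ∈ oddPart σ, ⁅a, b⁆ = z} := by
  let S := Submodule.span k {z : g | ∃ a ∈ fixedSubalgebra σ, ∃ b ∈ oddPart σ, ⁅a, b⁆ = z}
  have h : v ∈ Submodule.span k {z : g | ∃ x y : g, ⁅x, y⁆ = z} := by
    rw [span_lie_eq_top_of_hasTrivialRadical]
    trivial
  have key : v - σ v ∈ S := by
    clear hv
    induction h using Submodule.span_induction with
    | mem z hz =>
      obtain ⟨x, y, rfl⟩ := hz
      obtain ⟨a, ha, b, hb, rfl⟩ := exists_even_add_odd hσ x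
      obtain ⟨c, hc, d, hd, rfl⟩ := exists_even_add_odd hσ y
      have h1 : ⁅a, d⁆ ∈ S := Submodule.subset_span ⟨a, ha, d, hd, rfl⟩
      have h2 : ⁅c, b⁆ ∈ S := Submodule.subset_span ⟨c, hc, b, hb, rfl⟩
      have : ⁅a + b, c + d⁆ - σ ⁅a + b, c + d⁆ = (2 : k) • (⁅a, d⁆ - ⁅c, b⁆) := by
        rw [LieEquiv.map_lie, map_add, map_add, mem_fixedSubalgebra.mp ha, mem_oddPart.mp hb,
          mem_fixedSubalgebra.mp hc, mem_oddPart.mp hd, two_smul, ← lie_skew c b]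
        simp only [add_lie, lie_add, neg_lie, lie_neg]
        abel
      rw [this]
      exact S.smul_mem _ (sub_mem h1 h2)
    | zero => simp
    | add x y _ _ hx hy =>
      rw [map_add, add_sub_add_comm]
      exact add_mem hx hy
    | smul r x _ hx =>
      rw [map_smul, ← smul_sub]
      exact S.smul_mem r hx
  rw [mem_oddPart.mp hv, sub_neg_eq_add, ← two_smul k] at key
  exact (S.smul_mem_iff (two_ne_zero (α := k))).mp key

end Killing

variable [LieAlgebra.IsSimple k g]

/-- An orthogonal splitting of the odd part of a simple Lie algebra into commuting subspaces that
are stable under the even part is trivial. -/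
theorem eq_bot_or_of_oddPart_le_sup (hσ : ∀ u : g, σ (σ u) = u) (P Q : Submodule k g)
    (hP : P ≤ (oddPart σ).toSubmodule) (hsup : (oddPart σ).toSubmodule ≤ P ⊔ Q)
    (hPstab : ∀ u ∈ fixedSubalgebra σ, ∀ p ∈ P, ⁅u, p⁆ ∈ P) (hPQ : ∀ p ∈ P, ∀ q ∈ Q, ⁅p, q⁆ = 0) :
    P = ⊥ ∨ ((oddPart σ).toSubmodule ≤ P ∧ ∀ u ∈ fixedSubalgebra σ,
      u ∈ Submodule.span k {z : g | ∃ p ∈ P, ∃ q ∈ P, ⁅p, q⁆ = z}) := by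
  let S := Submodule.span k {z : g | ∃ p ∈ P, ∃ q ∈ P, ⁅p, q⁆ = z}
  have hS0 : ∀ s ∈ S, s ∈ fixedSubalgebra σ := by
    intro s hs
    induction hs using Submodule.span_induction with
    | mem z hz =>
      obtain ⟨p, hp, q, hq, rfl⟩ := hz
      exact lie_mem_fixedSubalgebra_of_odd (hP hp) (hP hq)
    | zero => exact zero_mem _
    | add a b _ _ ha hb => exact add_mem ha hb
    | smul c a _ ha => exact (fixedSubalgebra σ).smul_mem c ha
  -- `P + [P, P]` is an ideal of `g`: the even part preserves both summands, and `Q` kills `P`,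
  -- hence also `[P, P]` by the Jacobi identity.
  have hstab : ∀ x : g, ∀ y ∈ P ⊔ S, ⁅x, y⁆ ∈ P ⊔ S := by
    intro x y hy
    obtain ⟨p, hp, s, hs, rfl⟩ := Submodule.mem_sup.mp hy
    obtain ⟨a, ha, b, hb, rfl⟩ := exists_even_add_odd hσ x
    obtain ⟨c, hc, d, hd, rfl⟩ := Submodule.mem_sup.mp (hsup hb)
    have h1 : ⁅a, p⁆ ∈ P := hPstab a ha p hp
    have h2 : ⁅c, p⁆ ∈ S := Submodule.subset_span ⟨c, hc, p, hp, rfl⟩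
    have h3 : ⁅d, p⁆ = 0 := by rw [← lie_skew, hPQ p hp d hd, neg_zero]
    have h4 : ⁅a, s⁆ ∈ S := by
      clear hy
      induction hs using Submodule.span_induction with
      | mem z hz =>
        obtain ⟨p', hp', q', hq', rfl⟩ := hz
        rw [leibniz_lie]
        exact add_mem (Submodule.subset_span ⟨_, hPstab a ha p' hp', q', hq', rfl⟩)
          (Submodule.subset_span ⟨p', hp', _, hPstab a ha q' hq', rfl⟩)
      | zero => rw [lie_zero]; exact zero_mem _
      | add x y _ _ hx hy =>
        rw [lie_add]
        exact add_mem hx hy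
      | smul r x _ hx =>
        rw [lie_smul]
        exact S.smul_mem r hx
    have h5 : ⁅c, s⁆ ∈ P := by
      rw [← lie_skew]
      exact neg_mem (hPstab s (hS0 s hs) c hc)
    have h6 : ⁅d, s⁆ = 0 := by
      clear hy h4 h5
      induction hs using Submodule.span_induction with
      | mem z hz =>
        obtain ⟨p', hp', q', hq', rfl⟩ := hz
        rw [leibniz_lie, ← lie_skew d p', ← lie_skew d q', hPQ p' hp' d hd, hPQ q' hq' d hd]
        simp
      | zero => rw [lie_zero]
      | add x y _ _ hx hy => rw [lie_add, hx, hy, add_zero]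
      | smul r x _ hx => rw [lie_smul, hx, smul_zero]
    have : ⁅a + (c + d), p + s⁆ = (⁅a, p⁆ + ⁅c, s⁆) + (⁅c, p⁆ + ⁅a, s⁆) := by
      simp only [add_lie, lie_add, h3, h6]
      abel
    rw [this]
    exact add_mem (Submodule.mem_sup_left (add_mem h1 h5))
      (Submodule.mem_sup_right (add_mem h2 h4))
  let I : LieIdeal k g := { (P ⊔ S) with lie_mem := fun {x y} hy => hstab x y hy }
  rcases LieAlgebra.IsSimple.eq_bot_or_eq_top (R := k) I with hI | hI
  · left
    rw [eq_bot_iff]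
    intro p hp
    have : p ∈ I := Submodule.mem_sup_left hp
    rwa [hI, LieSubmodule.mem_bot] at this
  · right
    have hmem : ∀ x : g, ∃ p ∈ P, ∃ s ∈ S, p + s = x := fun x => by
      have : x ∈ I := by rw [hI]; trivial
      exact Submodule.mem_sup.mp this
    constructor
    · intro v hv
      obtain ⟨p, hp, s, hs, rfl⟩ := hmem v
      have hs' : s ∈ oddPart σ := by
        have := sub_mem (show p + s ∈ oddPart σ from hv) (show p ∈ oddPart σ from hP hp)
        rwa [add_sub_cancel_left] at this
      rw [eq_zero_of_mem_fixedSubalgebra_of_mem_oddPart (k := k) (hS0 s hs) hs', add_zero]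
      exact hp
    · intro u hu
      obtain ⟨p, hp, s, hs, rfl⟩ := hmem u
      have hp' : p ∈ fixedSubalgebra σ := by
        have := sub_mem hu (hS0 s hs)
        rwa [add_sub_cancel_right] at this
      rw [eq_zero_of_mem_fixedSubalgebra_of_mem_oddPart (k := k) hp' (hP hp), zero_add]
      exact hs

/-- This is the preceding dichotomy for `P = g₁` and `Q = 0`; here `g₁ ≠ 0` because `σ` is not the
identity. -/
theorem span_lie_odd_odd (hσ : ∀ u : g, σ (σ u) = u) (hσ₁ : ∃ u : g, σ u ≠ u) {u : g}
    (hu : u ∈ fixedSubalgebra σ) :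
    u ∈ Submodule.span k {z : g | ∃ a ∈ oddPart σ, ∃ b ∈ oddPart σ, ⁅a, b⁆ = z} :=
  ((eq_bot_or_of_oddPart_le_sup hσ (oddPart σ).toSubmodule ⊥ le_rfl le_sup_left
    (fun _ hu _ hp => lie_mem_oddPart hu hp)
    (fun p _ q hq => by rw [(Submodule.mem_bot k).mp hq, lie_zero])).resolve_left
      (oddPart_ne_bot hσ hσ₁)).2 u hu

/-- A nonzero central element of the even part acts injectively on the odd part. -/
theorem eq_zero_of_lie_center_eq_zero (hσ : ∀ u : g, σ (σ u) = u)
    (z : abPart σ) (hz : z ≠ 0) {v : g} (hv : v ∈ oddPart σ)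
    (h : ⁅((z : fixedSubalgebra σ) : g), v⁆ = 0) : v = 0 := by
  set ζ : g := ((z : fixedSubalgebra σ) : g) with hζ
  have hζ0 : ζ ∈ fixedSubalgebra σ := (z : fixedSubalgebra σ).2
  let A : Module.End k g := LieAlgebra.ad k g ζ
  have hAu : ∀ u ∈ fixedSubalgebra σ, A u = 0 := fun u hu => lie_center_eq_zero z hu
  have hAodd : ∀ x, A x ∈ oddPart σ := fun x => by
    obtain ⟨a, ha, b, hb, rfl⟩ := exists_even_add_odd hσ x
    rw [map_add, hAu a ha, zero_add]
    exact lie_mem_oddPart hζ0 hb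
  have hAcomm : ∀ u ∈ fixedSubalgebra σ, ∀ x, A ⁅u, x⁆ = ⁅u, A x⁆ := fun u hu x => by
    change ⁅ζ, ⁅u, x⁆⁆ = ⁅u, ⁅ζ, x⁆⁆
    rw [leibniz_lie, lie_center_eq_zero z hu, zero_lie, zero_add]
  have hApcomm : ∀ (n : ℕ), ∀ u ∈ fixedSubalgebra σ, ∀ x, (A ^ n) ⁅u, x⁆ = ⁅u, (A ^ n) x⁆ := by
    intro n u hu
    induction n with
    | zero => intro x; rfl
    | succ n ih => intro x; rw [pow_succ, Module.End.mul_apply, hAcomm u hu, ih]; rfl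
  -- `ad ζ` is skew for the Killing form, so the kernel of a power is orthogonal to its range.
  have hAskew : ∀ (n : ℕ) (x y : g), (A ^ n) x = 0 → killingForm k g x ((A ^ n) y) = 0 := by
    intro n
    induction n with
    | zero => intro x y hx; rw [pow_zero, Module.End.one_apply] at hx; simp [hx]
    | succ n ih =>
      intro x y hx
      rw [pow_succ', Module.End.mul_apply]
      have : killingForm k g x (A ((A ^ n) y)) = - killingForm k g (A x) ((A ^ n) y) := by
        change _ = - killingForm k g ⁅ζ, x⁆ _
        rw [traceForm_apply_lie_apply', neg_neg]
        rfl
      rw [this, ih (A x) y (by rw [pow_succ, Module.End.mul_apply] at hx; exact hx), neg_zero]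
  have hpow : ∀ n : ℕ, ∀ x, (A ^ (n + 1)) x ∈ oddPart σ := fun n x => by
    rw [pow_succ', Module.End.mul_apply]
    exact hAodd _
  -- Fitting decomposition for `ad ζ`. The exponent `n + 1` is positive, so the range of `B` is odd.
  obtain ⟨n, hn⟩ : ∃ n : ℕ,
      IsCompl (LinearMap.ker (A ^ (n + 1))) (LinearMap.range (A ^ (n + 1))) := by
    obtain ⟨n, hn⟩ := Filter.eventually_atTop.mp (LinearMap.eventually_isCompl_ker_pow_range_pow A)
    exact ⟨n, hn (n + 1) (Nat.le_succ n)⟩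
  set B := A ^ (n + 1)
  -- Take the odd part of the Fitting kernel as `P` and the Fitting range as `Q`. They commute: for
  -- `q = B y`, the bracket `[p, q]` is even and its Killing product with an even `w` is, up to
  -- sign, that of `p` with `B [w, y]`, which is zero.
  have hP := eq_bot_or_of_oddPart_le_sup hσ (LinearMap.ker B ⊓ (oddPart σ).toSubmodule)
    (LinearMap.range B) inf_le_right (fun w hw => by
      obtain ⟨a, ha, b, hb, rfl⟩ := Submodule.mem_sup.mp
        (show w ∈ LinearMap.ker B ⊔ LinearMap.range B by rw [hn.sup_eq_top]; trivial)
      have hb' : b ∈ oddPart σ := by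
        obtain ⟨y, rfl⟩ := hb
        exact hpow n y
      refine add_mem (Submodule.mem_sup_left ⟨ha, ?_⟩) (Submodule.mem_sup_right hb)
      have := sub_mem (show a + b ∈ oddPart σ from hw) hb'
      rwa [add_sub_cancel_right] at this)
    (fun u hu p hp => ⟨by
      change (A ^ (n + 1)) ⁅u, p⁆ = 0
      rw [hApcomm (n + 1) u hu, show (A ^ (n + 1)) p = 0 from hp.1, lie_zero],
      lie_mem_oddPart hu hp.2⟩)
    (fun p hp q hq => by
      obtain ⟨y, rfl⟩ := hq
      refine eq_zero_of_killingForm_even hσ (lie_mem_fixedSubalgebra_of_odd hp.2 (hpow n y))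
        fun w hw => ?_
      rw [traceForm_apply_lie_apply, ← lie_skew, ← hApcomm (n + 1) w hw, ← map_neg]
      exact hAskew (n + 1) p _ hp.1)
  rcases hP with hP | hP
  · have : v ∈ LinearMap.ker B ⊓ (oddPart σ).toSubmodule := ⟨by
      change (A ^ (n + 1)) v = 0
      rw [pow_succ, Module.End.mul_apply, show A v = 0 from h, map_zero], hv⟩
    rwa [hP, Submodule.mem_bot] at this
  -- Otherwise `ad ζ` is nilpotent. It commutes with `ad y` for even `y`, so `ζ` is
  -- Killing-orthogonal to `g₀` and hence zero.
  · exfalso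
    have hAnil : A ^ (n + 1) = 0 := by
      ext x
      obtain ⟨a, ha, b, hb, rfl⟩ := exists_even_add_odd hσ x
      rw [map_add, show (A ^ (n + 1)) b = 0 from (hP.1 hb).1, add_zero, pow_succ,
        Module.End.mul_apply, hAu a ha, map_zero]
      rfl
    apply hz
    apply Subtype.ext
    apply Subtype.ext
    refine eq_zero_of_killingForm_even hσ hζ0 fun y hy => ?_
    rw [killingForm_apply_apply]
    have hcomm : Commute A (LieAlgebra.ad k g y) := by
      ext x
      exact hAcomm y hy x
    exact (LinearMap.isNilpotent_trace_of_isNilpotent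
      (hcomm.isNilpotent_mul_right ⟨n + 1, hAnil⟩)).eq_zero

end Involution

/-! ### The center of the even part and its semisimple complement. -/

section Center

open LieModule

attribute [local instance 100] LieRing.ofAssociativeRing

theorem exists_eigenvector_mem {k M : Type*} [Field k] [IsAlgClosed k] [AddCommGroup M] [Module k M]
    [FiniteDimensional k M] (A : Module.End k M) (E : Submodule k M) (hE : E ≠ ⊥)
    (hA : ∀ v ∈ E, A v ∈ E) : ∃ (c : k) (v : M), v ∈ E ∧ v ≠ 0 ∧ A v = c • v := by
  have : Nontrivial E := Submodule.nontrivial_iff_ne_bot.mpr hE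
  obtain ⟨c, hc⟩ := Module.End.exists_eigenvalue (A.restrict hA)
  obtain ⟨v, hv⟩ := hc.exists_hasEigenvector
  exact ⟨c, v, v.2, fun h => hv.2 (Subtype.ext h), congrArg Subtype.val hv.apply_eq_smul⟩

variable {k : Type u} [Field k] [CharZero k] [IsAlgClosed k] {g : Type u} [LieRing g]
  [LieAlgebra k g] [FiniteDimensional k g] [LieAlgebra.IsSimple k g] {σ : g ≃ₗ⁅k⁆ g}

/-- The commuting operators `ad z` and `ad w` have a common eigenvector in `g₁`. The central element
`c w - b z` formed from the eigenvalues kills it, so it is zero by injectivity on `g₁`; the same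
injectivity gives `c ≠ 0`. -/
theorem exists_smul_of_center (hσ : ∀ u : g, σ (σ u) = u) (hσ₁ : ∃ u : g, σ u ≠ u)
    {z : abPart σ} (hz : z ≠ 0) (w : abPart σ) : ∃ c : k, c • z = w := by
  let A : abPart σ → Module.End k g := fun z => LieAlgebra.ad k g ((z : fixedSubalgebra σ) : g)
  have hAodd : ∀ z, ∀ v ∈ (oddPart σ).toSubmodule, A z v ∈ (oddPart σ).toSubmodule :=
    fun z v hv => lie_mem_oddPart (z : fixedSubalgebra σ).2 hv
  have hcomm : ∀ z w v, A w (A z v) = A z (A w v) := fun z w v => by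
    change ⁅_, ⁅_, v⁆⁆ = ⁅_, ⁅_, v⁆⁆
    rw [leibniz_lie, lie_center_eq_zero w (z : fixedSubalgebra σ).2, zero_lie, zero_add]
  obtain ⟨c, v, hv, hv0, hcv⟩ := exists_eigenvector_mem (A z) _ (oddPart_ne_bot hσ hσ₁) (hAodd z)
  obtain ⟨b, v', ⟨hv', hcv'⟩, hv'0, hbv'⟩ := exists_eigenvector_mem (A w)
    ((oddPart σ).toSubmodule ⊓ Module.End.eigenspace (A z) c)
    (fun h => hv0 ((Submodule.mem_bot k).mp (h ▸ ⟨hv, Module.End.mem_eigenspace_iff.mpr hcv⟩)))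
    (fun x hx => ⟨hAodd w x hx.1, by
      have := Module.End.mem_eigenspace_iff.mp hx.2
      refine Module.End.mem_eigenspace_iff.mpr ?_
      rw [← hcomm z w, this, map_smul]⟩)
  replace hcv' := Module.End.mem_eigenspace_iff.mp hcv'
  have hc : c ≠ 0 := by
    rintro rfl
    rw [zero_smul] at hcv
    exact hv0 (eq_zero_of_lie_center_eq_zero hσ z hz hv hcv)
  have h0 : c • w - b • z = 0 := by
    by_contra h
    refine hv'0 (eq_zero_of_lie_center_eq_zero hσ _ h hv' ?_)
    change ⁅c • ((w : fixedSubalgebra σ) : g) - b • ((z : fixedSubalgebra σ) : g), v'⁆ = 0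
    rw [sub_lie, smul_lie, smul_lie]
    change c • A w v' - b • A z v' = 0
    rw [hbv', hcv', smul_comm, sub_self]
  refine ⟨b / c, ?_⟩
  rw [div_eq_inv_mul, mul_smul, ← sub_eq_zero.mp h0, smul_smul, inv_mul_cancel₀ hc, one_smul]

theorem finrank_center_le_one (hσ : ∀ u : g, σ (σ u) = u) (hσ₁ : ∃ u : g, σ u ≠ u) :
    Module.finrank k (abPart σ) ≤ 1 := by
  rcases subsingleton_or_nontrivial (abPart σ) with h | h
  · rw [Module.finrank_zero_of_subsingleton]
    exact zero_le_one
  · obtain ⟨z, hz⟩ := exists_ne (0 : abPart σ)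
    exact finrank_le_one z (exists_smul_of_center hσ hσ₁ hz)

/-- The trace on an eigenspace of `ad z` with eigenvalue `c ≠ 0` is a linear form on `g₀` that kills
commutators, and its value at `z` is `c` times a positive dimension. Since `z` spans the center,
normalising it gives the projection. -/
theorem exists_center_projection (hσ : ∀ u : g, σ (σ u) = u) (hσ₁ : ∃ u : g, σ u ≠ u) :
    ∃ p : fixedSubalgebra σ →ₗ[k] abPart σ,
      (∀ z : abPart σ, p z = z) ∧ ∀ u u' : fixedSubalgebra σ, p ⁅u, u'⁆ = 0 := by
  rcases subsingleton_or_nontrivial (abPart σ) with h | h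
  · exact ⟨0, fun _ => Subsingleton.elim _ _, fun _ _ => rfl⟩
  obtain ⟨z, hz⟩ := exists_ne (0 : abPart σ)
  obtain ⟨c, v, hv, hv0, hcv⟩ := exists_eigenvector_mem
    (LieAlgebra.ad k g ((z : fixedSubalgebra σ) : g)) _ (oddPart_ne_bot hσ hσ₁)
    (fun v hv => lie_mem_oddPart (z : fixedSubalgebra σ).2 hv)
  have hc : c ≠ 0 := by
    rintro rfl
    rw [zero_smul] at hcv
    exact hv0 (eq_zero_of_lie_center_eq_zero hσ z hz hv hcv)
  let E : LieSubmodule k (fixedSubalgebra σ) g :=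
    { Module.End.eigenspace (LieAlgebra.ad k g ((z : fixedSubalgebra σ) : g)) c with
      lie_mem := fun {u x} hx => by
        replace hx : ⁅((z : fixedSubalgebra σ) : g), x⁆ = c • x :=
          Module.End.mem_eigenspace_iff.mp hx
        refine Module.End.mem_eigenspace_iff.mpr ?_
        change ⁅((z : fixedSubalgebra σ) : g), ⁅(u : g), x⁆⁆ = c • ⁅(u : g), x⁆
        rw [leibniz_lie, lie_center_eq_zero z u.2, zero_lie, zero_add, hx, lie_smul] }
  have : Nontrivial E := ⟨⟨⟨v, Module.End.mem_eigenspace_iff.mpr hcv⟩, 0,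
    fun h => hv0 (congrArg Subtype.val h)⟩⟩
  let τ : fixedSubalgebra σ →ₗ[k] k :=
    LinearMap.trace k E ∘ₗ (LieModule.toEnd k (fixedSubalgebra σ) E : _ →ₗ[k] Module.End k E)
  have hτ : ∀ u u' : fixedSubalgebra σ, τ ⁅u, u'⁆ = 0 := fun u u' => by
    change LinearMap.trace k E (LieModule.toEnd k (fixedSubalgebra σ) E ⁅u, u'⁆) = 0
    rw [LieHom.map_lie, LinearMap.trace_lie]
  have hτz : τ z ≠ 0 := by
    have : LieModule.toEnd k (fixedSubalgebra σ) E z = c • LinearMap.id := by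
      ext x
      exact Module.End.mem_eigenspace_iff.mp x.2
    change LinearMap.trace k E (LieModule.toEnd k (fixedSubalgebra σ) E z) ≠ 0
    rw [this, map_smul, LinearMap.trace_id, smul_eq_mul]
    exact mul_ne_zero hc (Nat.cast_ne_zero.mpr Module.finrank_pos.ne')
  refine ⟨(τ z)⁻¹ • τ.smulRight z, fun w => ?_, fun u u' => ?_⟩
  · obtain ⟨a, rfl⟩ := exists_smul_of_center hσ hσ₁ hz w
    change (τ z)⁻¹ • τ (a • (z : fixedSubalgebra σ)) • z = a • z
    rw [map_smul, smul_eq_mul, smul_smul, mul_comm a, inv_mul_cancel_left₀ hτz]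
  · change (τ z)⁻¹ • τ ⁅u, u'⁆ • z = 0
    rw [hτ, zero_smul, smul_zero]

/-- The kernel of a projection of the even part to its center that vanishes on commutators. -/
def kerIdeal (p : fixedSubalgebra σ →ₗ[k] abPart σ)
    (hp : ∀ u u' : fixedSubalgebra σ, p ⁅u, u'⁆ = 0) :
    LieIdeal k (fixedSubalgebra σ) :=
  { LinearMap.ker p with lie_mem := fun {u x} _ => hp u x }

/-- For `x` in an abelian ideal and `y` in the kernel of `p`, `[y, x]` is Killing-orthogonal to this
kernel by `traceForm_lie_eq_zero_of_abelian` and to the center by invariance, so it is zero. Then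
`x` is central in `g₀`, and `p x = 0` gives `x = 0`. -/
theorem hasTrivialRadical_kerIdeal (hσ : ∀ u : g, σ (σ u) = u)
    (p : fixedSubalgebra σ →ₗ[k] abPart σ) (hpz : ∀ z : abPart σ, p z = z)
    (hp : ∀ u u' : fixedSubalgebra σ, p ⁅u, u'⁆ = 0) :
    LieAlgebra.HasTrivialRadical k (kerIdeal p hp) := by
  rw [LieAlgebra.hasTrivialRadical_iff_no_abelian_ideals]
  intro I hI
  rw [eq_bot_iff]
  intro x hx
  have hsplit : ∀ u : fixedSubalgebra σ, u - p u ∈ kerIdeal p hp := fun u => by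
    change p (u - p u) = 0
    rw [map_sub, hpz, sub_self]
  have hlie : ∀ y : kerIdeal p hp, ⁅y, x⁆ = 0 := fun y => by
    apply Subtype.ext
    apply Subtype.ext
    change ⁅((y : fixedSubalgebra σ) : g), ((x : fixedSubalgebra σ) : g)⁆ = 0
    refine eq_zero_of_killingForm_even (k := k) hσ
      ((fixedSubalgebra σ).lie_mem (y : fixedSubalgebra σ).2 (x : fixedSubalgebra σ).2) ?_
    intro w hw
    have h1 : killingForm k g ⁅((y : fixedSubalgebra σ) : g), ((x : fixedSubalgebra σ) : g)⁆
        ((p ⟨w, hw⟩ : fixedSubalgebra σ) : g) = 0 := by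
      rw [traceForm_apply_lie_apply, ← lie_skew, lie_center_eq_zero _ (x : fixedSubalgebra σ).2,
        neg_zero, map_zero]
    have h2 := traceForm_lie_eq_zero_of_abelian (k := k) (M := g) I (fun a ha b hb =>
      congrArg Subtype.val (hI.trivial ⟨a, ha⟩ ⟨b, hb⟩)) (x := x) (y := y)
      (z := ⟨_, hsplit ⟨w, hw⟩⟩) hx
    have h3 : killingForm k g ⁅((y : fixedSubalgebra σ) : g), ((x : fixedSubalgebra σ) : g)⁆
        (w - ((p ⟨w, hw⟩ : fixedSubalgebra σ) : g)) = 0 := h2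
    rw [map_sub, h1, sub_zero] at h3
    exact h3
  have hc : (x : fixedSubalgebra σ) ∈ abPart σ := by
    rw [LieModule.mem_maxTrivSubmodule]
    intro u
    have h1 : ⁅(u - p u : fixedSubalgebra σ), (x : fixedSubalgebra σ)⁆ = 0 :=
      congrArg Subtype.val (hlie ⟨_, hsplit u⟩)
    have h2 : ⁅(p u : fixedSubalgebra σ), (x : fixedSubalgebra σ)⁆ = 0 :=
      Subtype.ext (lie_center_eq_zero _ (x : fixedSubalgebra σ).2)
    rw [sub_lie, h2, sub_zero] at h1
    exact h1
  have h0 : p x = 0 := x.2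
  have := hpz ⟨x, hc⟩
  rw [h0] at this
  rw [LieSubmodule.mem_bot]
  have h4 : (x : fixedSubalgebra σ) = 0 := congrArg Subtype.val this.symm
  exact Subtype.ext h4

section Cohomology

variable {W : Type u} [AddCommGroup W] [Module k W] [FiniteDimensional k W]
  [LieRingModule (fixedSubalgebra σ) W] [LieModule k (fixedSubalgebra σ) W]

/-- Since `[a, z] = 0`, the cocycle identity reads `a · d z = z · d a = c • d a`. -/
theorem exists_inner_of_center_ne_zero (d : fixedSubalgebra σ →ₗ[k] W)
    (hd : ∀ a b, d ⁅a, b⁆ = ⁅a, d b⁆ - ⁅b, d a⁆) (z : abPart σ) {c : k} (hc : c ≠ 0)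
    (hz : ∀ w : W, ⁅(z : fixedSubalgebra σ), w⁆ = c • w) : ∃ w, ∀ a, d a = ⁅a, w⁆ := by
  refine ⟨c⁻¹ • d z, fun a => ?_⟩
  have h := hd a z
  rw [(LieModule.mem_maxTrivSubmodule k (fixedSubalgebra σ) (fixedSubalgebra σ) _).mp z.2 a,
    map_zero, hz] at h
  rw [lie_smul, sub_eq_zero.mp h.symm, smul_smul, inv_mul_cancel₀ hc, one_smul]

/-- Whitehead's lemma on the kernel of `p` gives `w`. For central `z`, `0 = d [u, z] = u · d z - z ·
d u = u · d z`, so `d` maps the center to invariants. -/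
theorem exists_inner_add_of_center_eq_zero (hσ : ∀ u : g, σ (σ u) = u)
    (p : fixedSubalgebra σ →ₗ[k] abPart σ) (hpz : ∀ z : abPart σ, p z = z)
    (hp : ∀ u u' : fixedSubalgebra σ, p ⁅u, u'⁆ = 0)
    (d : fixedSubalgebra σ →ₗ[k] W)
    (hd : ∀ a b, d ⁅a, b⁆ = ⁅a, d b⁆ - ⁅b, d a⁆)
    (hz : ∀ (z : abPart σ) (w : W), ⁅(z : fixedSubalgebra σ), w⁆ = 0) :
    ∃ (w : W) (b : abPart σ →ₗ[k] LieModule.maxTrivSubmodule k (fixedSubalgebra σ) W),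
      ∀ a, d a = ⁅a, w⁆ + b (p a) := by
  have := hasTrivialRadical_kerIdeal hσ p hpz hp
  obtain ⟨w, hw⟩ := exists_inner_of_hasTrivialRadical (k := k) (L := kerIdeal p hp) (W := W)
    (d ∘ₗ (kerIdeal p hp).toSubmodule.subtype) (fun a b => hd a b)
  replace hw : ∀ a ∈ kerIdeal p hp, d a = ⁅a, w⁆ := fun a ha => hw ⟨a, ha⟩
  have hsplit : ∀ u : fixedSubalgebra σ, u - p u ∈ kerIdeal p hp := fun u => by
    change p (u - p u) = 0
    rw [map_sub, hpz, sub_self]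
  have htriv : ∀ z : abPart σ, d z ∈ LieModule.maxTrivSubmodule k (fixedSubalgebra σ) W := by
    intro z
    rw [LieModule.mem_maxTrivSubmodule]
    intro u
    have h := hd u z
    rwa [(LieModule.mem_maxTrivSubmodule k (fixedSubalgebra σ) (fixedSubalgebra σ) _).mp z.2 u,
      map_zero, hz, sub_zero, eq_comm] at h
  refine ⟨w, LinearMap.codRestrict (LieModule.maxTrivSubmodule k (fixedSubalgebra σ) W).toSubmodule
    (d ∘ₗ (abPart σ).toSubmodule.subtype) htriv, fun a => ?_⟩
  change d a = ⁅a, w⁆ + d (p a)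
  have h := hw _ (hsplit a)
  rw [map_sub, sub_lie, hz, sub_zero] at h
  rw [← h, sub_add_cancel]

end Cohomology

end Center

/-! ### Generators of the Onsager algebra. -/

section Generators

open LaurentPolynomial Polynomial

variable {k : Type u} [Field k] {g : Type u} [LieRing g] [LieAlgebra k g]

/-- The invariant Laurent polynomial `t + t⁻¹`. -/
def symT (k : Type u) [Field k] : k[T;T⁻¹] := T 1 + T (-1)

/-- The anti-invariant Laurent polynomial `t - t⁻¹`. -/
def skewT (k : Type u) [Field k] : k[T;T⁻¹] := T 1 - T (-1)

theorem skewT_mul_self : skewT k * skewT k = aeval (symT k) (X ^ 2 - 4 : k[X]) := by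
  have h : (T 1 * T (-1) : k[T;T⁻¹]) = 1 := by rw [← T_add]; simp
  simp only [map_sub, map_pow, aeval_X, map_ofNat, skewT, symT]
  linear_combination (-4) * h

theorem invert_aeval_symT (P : k[X]) : invert (aeval (symT k) P) = aeval (symT k) P := by
  have h : invert (symT k) = symT k := by
    rw [symT, map_add, invert_T, invert_T, neg_neg, add_comm]
  have := Polynomial.map_aeval_eq_aeval_map (p := P) (a := symT k) (φ := RingHom.id k)
    (ψ := (invert : k[T;T⁻¹] ≃ₐ[k] k[T;T⁻¹]).toRingEquiv.toRingHom) (by ext x; simp)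
  rw [Polynomial.map_id] at this
  exact this.trans (congrArg (fun y => aeval y P) h)

theorem invert_skewT : invert (skewT k) = -skewT k := by
  rw [skewT, map_sub, invert_T, invert_T, neg_neg, neg_sub]

theorem diagAction_tmul (σ : g ≃ₗ⁅k⁆ g) (f : k[T;T⁻¹]) (y : g) :
    diagAction σ (f ⊗ₜ[k] y) = invert f ⊗ₜ[k] σ y := rfl

theorem bracket_tmul (f f' : k[T;T⁻¹]) (y y' : g) :
    ⁅f ⊗ₜ[k] y, f' ⊗ₜ[k] y'⁆ = (f * f') ⊗ₜ[k] ⁅y, y'⁆ := rfl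

variable (σ : g ≃ₗ⁅k⁆ g)

/-- The elements `P(t + t⁻¹) ⊗ u`, `u` even, of the Onsager algebra. -/
def evenElt : k[X] →ₗ[k] fixedSubalgebra σ →ₗ[k] onsagerAlgebra σ :=
  LinearMap.mk₂ k (fun P u => ⟨aeval (symT k) P ⊗ₜ[k] (u : g), by
      change diagAction σ _ = _
      rw [diagAction_tmul, invert_aeval_symT, mem_fixedSubalgebra.mp u.2]⟩)
    (fun P Q u => Subtype.ext (by
      change aeval (symT k) (P + Q) ⊗ₜ[k] (u : g) = _ ⊗ₜ[k] (u : g) + _ ⊗ₜ[k] (u : g)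
      rw [map_add, TensorProduct.add_tmul]))
    (fun c P u => Subtype.ext (by
      change aeval (symT k) (c • P) ⊗ₜ[k] (u : g) = c • (_ ⊗ₜ[k] (u : g))
      rw [map_smul, TensorProduct.smul_tmul']))
    (fun P u v => Subtype.ext (TensorProduct.tmul_add _ _ _))
    (fun c P u => Subtype.ext (TensorProduct.tmul_smul _ _ _))

/-- The elements `(t - t⁻¹) P(t + t⁻¹) ⊗ v`, `v` odd, of the Onsager algebra. -/
def oddElt : k[X] →ₗ[k] oddPart σ →ₗ[k] onsagerAlgebra σ :=
  LinearMap.mk₂ k (fun P v => ⟨(skewT k * aeval (symT k) P) ⊗ₜ[k] (v : g), by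
      change diagAction σ _ = _
      rw [diagAction_tmul, map_mul, invert_aeval_symT, invert_skewT, mem_oddPart.mp v.2, neg_mul,
        TensorProduct.neg_tmul, TensorProduct.tmul_neg, neg_neg]⟩)
    (fun P Q u => Subtype.ext (by
      change (skewT k * aeval (symT k) (P + Q)) ⊗ₜ[k] (u : g) =
        _ ⊗ₜ[k] (u : g) + _ ⊗ₜ[k] (u : g)
      rw [map_add, mul_add, TensorProduct.add_tmul]))
    (fun c P u => Subtype.ext (by
      change (skewT k * aeval (symT k) (c • P)) ⊗ₜ[k] (u : g) = c • (_ ⊗ₜ[k] (u : g))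
      rw [map_smul, mul_smul_comm, TensorProduct.smul_tmul']))
    (fun P u v => Subtype.ext (TensorProduct.tmul_add _ _ _))
    (fun c P u => Subtype.ext (TensorProduct.tmul_smul _ _ _))

variable {σ}

/-- The bracket of two odd elements, as an even element. -/
def oddBracket (v v' : oddPart σ) : fixedSubalgebra σ :=
  ⟨⁅(v : g), (v' : g)⁆, lie_mem_fixedSubalgebra_of_odd v.2 v'.2⟩

theorem lie_evenElt_evenElt (P Q : k[X]) (u u' : fixedSubalgebra σ) :
    ⁅evenElt σ P u, evenElt σ Q u'⁆ = evenElt σ (P * Q) ⁅u, u'⁆ := by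
  apply Subtype.ext
  change ⁅aeval (symT k) P ⊗ₜ[k] (u : g), aeval (symT k) Q ⊗ₜ[k] (u' : g)⁆ =
    aeval (symT k) (P * Q) ⊗ₜ[k] ⁅(u : g), (u' : g)⁆
  rw [bracket_tmul, map_mul]

theorem lie_evenElt_oddElt (P Q : k[X]) (u : fixedSubalgebra σ) (v : oddPart σ) :
    ⁅evenElt σ P u, oddElt σ Q v⁆ = oddElt σ (P * Q) ⁅u, v⁆ := by
  apply Subtype.ext
  change ⁅aeval (symT k) P ⊗ₜ[k] (u : g), (skewT k * aeval (symT k) Q) ⊗ₜ[k] (v : g)⁆ =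
    (skewT k * aeval (symT k) (P * Q)) ⊗ₜ[k] ⁅(u : g), (v : g)⁆
  rw [bracket_tmul, map_mul, mul_left_comm]

theorem lie_oddElt_oddElt (P Q : k[X]) (v v' : oddPart σ) :
    ⁅oddElt σ P v, oddElt σ Q v'⁆ = evenElt σ (P * Q * (X ^ 2 - 4)) (oddBracket v v') := by
  apply Subtype.ext
  change ⁅(skewT k * aeval (symT k) P) ⊗ₜ[k] (v : g),
      (skewT k * aeval (symT k) Q) ⊗ₜ[k] (v' : g)⁆ =
    aeval (symT k) (P * Q * (X ^ 2 - 4)) ⊗ₜ[k] ⁅(v : g), (v' : g)⁆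
  rw [bracket_tmul, map_mul, ← skewT_mul_self, map_mul]
  congr 1
  ring

/-- Chebyshev recursion: multiplying `tⁿ⁺¹ ± t⁻ⁿ⁻¹` by `t + t⁻¹` and subtracting `tⁿ ± t⁻ⁿ` gives
the next term. -/
theorem exists_aeval_symT_nat (n : ℕ) : ∃ P Q : k[X],
    aeval (symT k) P = T n + T (-n) ∧ skewT k * aeval (symT k) Q = T n - T (-n) := by
  induction n using Nat.twoStepInduction with
  | zero => exact ⟨2, 0, by rw [map_ofNat]; simp; norm_num, by simp⟩
  | one => exact ⟨X, 1, by simp [symT], by simp [skewT]⟩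
  | more n h1 h2 =>
    obtain ⟨P, Q, hP, hQ⟩ := h1
    obtain ⟨P', Q', hP', hQ'⟩ := h2
    refine ⟨X * P' - P, X * Q' - Q, ?_, ?_⟩
    · rw [map_sub, map_mul, aeval_X, hP, hP', symT]
      simp only [add_mul, mul_add, ← T_add]
      push_cast
      ring_nf
    · rw [map_sub, map_mul, aeval_X, mul_sub, mul_left_comm, hQ, hQ', symT]
      simp only [add_mul, mul_sub, ← T_add]
      push_cast
      ring_nf

theorem exists_aeval_symT (n : ℤ) : ∃ P Q : k[X],
    aeval (symT k) P = T n + T (-n) ∧ skewT k * aeval (symT k) Q = T n - T (-n) := by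
  obtain ⟨n, rfl | rfl⟩ := n.eq_nat_or_neg
  · exact exists_aeval_symT_nat n
  · obtain ⟨P, Q, hP, hQ⟩ := exists_aeval_symT_nat (k := k) n
    exact ⟨P, -Q, by rw [hP, neg_neg, add_comm], by rw [map_neg, mul_neg, hQ, neg_neg, neg_sub]⟩

/-- The Onsager algebra is spanned by the elements `evenElt` and `oddElt`. -/
theorem eq_top_of_evenElt_oddElt [CharZero k] (hσ : ∀ u : g, σ (σ u) = u)
    (N : Submodule k (onsagerAlgebra σ)) (h0 : ∀ P u, evenElt σ P u ∈ N)
    (h1 : ∀ P v, oddElt σ P v ∈ N) : N = ⊤ := by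
  rw [eq_top_iff]
  intro α _
  let N' : Submodule k (k[T;T⁻¹] ⊗[k] g) := N.map (onsagerAlgebra σ).toSubmodule.subtype
  -- Symmetrisations of pure tensors are combinations of the generators, and symmetrising a fixed
  -- element doubles it.
  have key : ∀ β : k[T;T⁻¹] ⊗[k] g, β + diagAction σ β ∈ N' := by
    intro β
    induction β with
    | zero => rw [map_zero, add_zero]; exact zero_mem _
    | add β γ hβ hγ => rw [map_add, add_add_add_comm]; exact add_mem hβ hγ
    | tmul f y =>
      induction f using LaurentPolynomial.induction_on' with
      | add p q hp hq =>
        rw [TensorProduct.add_tmul, map_add, add_add_add_comm]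
        exact add_mem hp hq
      | C_mul_T n c =>
        obtain ⟨a, ha, b, hb, rfl⟩ := exists_even_add_odd hσ y
        obtain ⟨P, Q, hP, hQ⟩ := exists_aeval_symT (k := k) n
        have h : (LaurentPolynomial.C c * T n) ⊗ₜ[k] (a + b) +
            diagAction σ ((LaurentPolynomial.C c * T n) ⊗ₜ[k] (a + b)) =
            ((c • (evenElt σ P ⟨a, ha⟩ + oddElt σ Q ⟨b, hb⟩) : onsagerAlgebra σ) :
              k[T;T⁻¹] ⊗[k] g) := by
          change _ = c • (aeval (symT k) P ⊗ₜ[k] a + (skewT k * aeval (symT k) Q) ⊗ₜ[k] b)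
          rw [diagAction_tmul, map_mul, invert_C, invert_T, map_add, mem_fixedSubalgebra.mp ha,
            mem_oddPart.mp hb, hP, hQ, ← LaurentPolynomial.smul_eq_C_mul,
            ← LaurentPolynomial.smul_eq_C_mul]
          simp only [TensorProduct.tmul_add, TensorProduct.add_tmul, TensorProduct.sub_tmul,
            TensorProduct.tmul_neg, ← TensorProduct.smul_tmul', smul_add, smul_sub]
          abel
        rw [h]
        exact ⟨_, N.smul_mem c (add_mem (h0 P _) (h1 Q _)), rfl⟩
  have h := key α
  rw [show diagAction σ α.1 = α.1 from α.2, ← two_smul k] at h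
  obtain ⟨β, hβ, h⟩ := (N'.smul_mem_iff (two_ne_zero (α := k))).mp h
  rwa [← show β = α from Subtype.ext h]

theorem onsager_hom_ext [CharZero k] (hσ : ∀ u : g, σ (σ u) = u) {W : Type*} [AddCommGroup W]
    [Module k W] {d d' : onsagerAlgebra σ →ₗ[k] W}
    (h0 : ∀ P u, d (evenElt σ P u) = d' (evenElt σ P u))
    (h1 : ∀ P v, d (oddElt σ P v) = d' (oddElt σ P v)) : d = d' := by
  have := eq_top_of_evenElt_oddElt hσ (LinearMap.eqLocus d d') h0 h1
  ext α
  have h : α ∈ LinearMap.eqLocus d d' := by rw [this]; trivial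
  exact h

end Generators

/-! ### Values and first derivatives at a point. -/

section Evaluation

open LaurentPolynomial Polynomial

variable {k : Type u} [Field k] {g : Type u} [LieRing g] [LieAlgebra k g] {σ : g ≃ₗ⁅k⁆ g}

theorem laurentEval_T (x : kˣ) (n : ℤ) : laurentEval x (T n) = ((x ^ n : kˣ) : k) :=
  LaurentPolynomial.eval₂_T (RingHom.id k) x n

theorem laurentEval_aeval_symT (x : kˣ) (P : k[X]) :
    laurentEval x (aeval (symT k) P) = P.eval (x + x⁻¹ : k) := by
  rw [← Polynomial.aeval_algHom_apply, symT, map_add, laurentEval_T, laurentEval_T]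
  simp

theorem laurentEval_skewT (x : kˣ) : laurentEval x (skewT k) = (x - x⁻¹ : k) := by
  rw [skewT, map_sub, laurentEval_T, laurentEval_T]
  simp

theorem ev_evenElt (x : kˣ) (P : k[X]) (u : fixedSubalgebra σ) :
    ev σ x (evenElt σ P u) = P.eval (x + x⁻¹ : k) • (u : g) := by
  change laurentEval x (aeval (symT k) P) • (u : g) = _
  rw [laurentEval_aeval_symT]

theorem ev_oddElt (x : kˣ) (P : k[X]) (v : oddPart σ) :
    ev σ x (oddElt σ P v) = ((x - x⁻¹ : k) * P.eval (x + x⁻¹ : k)) • (v : g) := by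
  change laurentEval x (skewT k * aeval (symT k) P) • (v : g) = _
  rw [map_mul, laurentEval_aeval_symT, laurentEval_skewT]

theorem evFixed_evenElt (x : kˣ) (hx : x = 1 ∨ x = -1) (P : k[X]) (u : fixedSubalgebra σ) :
    evFixed σ x hx (evenElt σ P u) = P.eval (2 * x : k) • u := by
  apply Subtype.ext
  refine (ev_evenElt x P u).trans ?_
  have : (x + x⁻¹ : k) = 2 * x := by rcases hx with rfl | rfl <;> norm_num
  rw [this]
  rfl

theorem evFixed_oddElt (x : kˣ) (hx : x = 1 ∨ x = -1) (P : k[X]) (v : oddPart σ) :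
    evFixed σ x hx (oddElt σ P v) = 0 := by
  apply Subtype.ext
  refine (ev_oddElt x P v).trans ?_
  have : (x - x⁻¹ : k) = 0 := by rcases hx with rfl | rfl <;> norm_num
  rw [this, zero_mul, zero_smul]
  rfl

/-- The point `x + ε` of the dual numbers. -/
def dualPoint (x : kˣ) : (DualNumber k)ˣ where
  val := TrivSqZeroExt.inl (x : k) + DualNumber.eps
  inv := TrivSqZeroExt.inl (x⁻¹ : k) - (x⁻¹ ^ 2 : k) • DualNumber.eps
  val_inv := by
    ext <;> simp
    field_simp
    ring
  inv_val := by
    ext <;> simp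
    field_simp
    ring

/-- First order evaluation of Laurent polynomials at `x`. -/
def laurentJet (x : kˣ) : k[T;T⁻¹] →ₐ[k] DualNumber k :=
  { LaurentPolynomial.eval₂ (algebraMap k (DualNumber k)) (dualPoint x) with
    commutes' := fun r => LaurentPolynomial.eval₂_C _ _ r }

theorem fst_laurentJet (x : kˣ) (f : k[T;T⁻¹]) : (laurentJet x f).fst = laurentEval x f := by
  induction f using LaurentPolynomial.induction_on' with
  | add p q hp hq => rw [map_add, map_add, TrivSqZeroExt.fst_add, hp, hq]
  | C_mul_T n a =>
    have hT : (laurentJet x (T n)).fst = ((x ^ n : kˣ) : k) := by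
      change TrivSqZeroExt.fstHom k k k
        (LaurentPolynomial.eval₂ (algebraMap k (DualNumber k)) (dualPoint x) (T n)) = _
      have h : Units.map (TrivSqZeroExt.fstHom k k k : DualNumber k →* k) (dualPoint x) = x := by
        ext
        simp [dualPoint]
      rw [LaurentPolynomial.eval₂_T]
      nth_rewrite 2 [← h]
      rw [← map_zpow]
      rfl
    have hC : laurentJet x (LaurentPolynomial.C a) = algebraMap k (DualNumber k) a :=
      (laurentJet x).commutes a
    rw [map_mul, map_mul, TrivSqZeroExt.fst_mul, hT, laurentEval_T, hC]
    congr 1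
    exact ((laurentEval x).commutes a).symm

theorem laurentJet_symT (x : kˣ) : laurentJet x (symT k) =
    TrivSqZeroExt.inl (x + x⁻¹ : k) + (1 - x⁻¹ ^ 2 : k) • DualNumber.eps := by
  change LaurentPolynomial.eval₂ (algebraMap k (DualNumber k)) (dualPoint x) (T 1 + T (-1)) = _
  rw [map_add, LaurentPolynomial.eval₂_T, LaurentPolynomial.eval₂_T, zpow_one, zpow_neg_one]
  ext <;> simp [dualPoint, sub_eq_add_neg]

theorem laurentJet_skewT (x : kˣ) : laurentJet x (skewT k) =
    TrivSqZeroExt.inl (x - x⁻¹ : k) + (1 + x⁻¹ ^ 2 : k) • DualNumber.eps := by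
  change LaurentPolynomial.eval₂ (algebraMap k (DualNumber k)) (dualPoint x) (T 1 - T (-1)) = _
  rw [map_sub, LaurentPolynomial.eval₂_T, LaurentPolynomial.eval₂_T, zpow_one, zpow_neg_one]
  ext <;> simp [dualPoint]

/-- Chain rule: `1 - x⁻²` is the derivative of `t + t⁻¹` at `x`. -/
theorem snd_laurentJet_aeval (x : kˣ) (P : k[X]) : (laurentJet x (aeval (symT k) P)).snd =
    (1 - x⁻¹ ^ 2 : k) * P.derivative.eval (x + x⁻¹ : k) := by
  rw [← Polynomial.aeval_algHom_apply, laurentJet_symT, Polynomial.aeval_add_of_sq_eq_zero _ _ _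
    (by ext <;> simp)]
  have h : ∀ Q : k[X], aeval (TrivSqZeroExt.inl (x + x⁻¹ : k) : DualNumber k) Q =
      TrivSqZeroExt.inl (Q.eval (x + x⁻¹ : k)) := fun Q => by
    have := Polynomial.aeval_algebraMap_apply (DualNumber k) (x + x⁻¹ : k) Q
    exact this
  rw [h, h]
  simp [mul_comm]

/-- The derivative at `x` of a `g`-valued Laurent polynomial. -/
def derivMap (x : kˣ) : k[T;T⁻¹] ⊗[k] g →ₗ[k] g :=
  (TensorProduct.lid k g).toLinearMap ∘ₗ TensorProduct.map
    ((TrivSqZeroExt.sndHom k k) ∘ₗ (laurentJet x).toLinearMap) LinearMap.id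

theorem derivMap_tmul (x : kˣ) (f : k[T;T⁻¹]) (y : g) :
    derivMap x (f ⊗ₜ[k] y) = (laurentJet x f).snd • y := rfl

/-- This is the Leibniz rule; it makes the derivative at `x` a cocycle with values in the adjoint
module. -/
theorem derivMap_lie (x : kˣ) (a b : k[T;T⁻¹] ⊗[k] g) :
    derivMap x ⁅a, b⁆ = ⁅evalMap x a, derivMap x b⁆ - ⁅evalMap x b, derivMap x a⁆ := by
  induction a with
  | zero =>
    rw [show ⁅(0 : k[T;T⁻¹] ⊗[k] g), b⁆ = 0 from zero_lie b]
    simp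
  | add a₁ a₂ h₁ h₂ =>
    rw [LieRing.add_lie, map_add, map_add, map_add, h₁, h₂, add_lie, lie_add]
    abel
  | tmul p y =>
    induction b with
    | zero =>
      rw [show ⁅p ⊗ₜ[k] y, (0 : k[T;T⁻¹] ⊗[k] g)⁆ = 0 from lie_zero (p ⊗ₜ[k] y)]
      simp
    | add b₁ b₂ h₁ h₂ =>
      rw [LieRing.lie_add, map_add, map_add, map_add, h₁, h₂, add_lie, lie_add]
      abel
    | tmul q z =>
      rw [bracket_tmul, derivMap_tmul, derivMap_tmul, derivMap_tmul, evalMap_tmul, evalMap_tmul,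
        map_mul, TrivSqZeroExt.snd_mul, fst_laurentJet, fst_laurentJet, ← lie_skew y z]
      simp only [smul_lie, lie_smul, smul_eq_mul, MulOpposite.smul_eq_mul_unop,
        MulOpposite.unop_op, smul_neg, ← lie_skew y z]
      module

variable (σ) in
/-- The derivative at `x` of an element of the Onsager algebra. -/
def derivAt (x : kˣ) : onsagerAlgebra σ →ₗ[k] g :=
  derivMap x ∘ₗ (onsagerAlgebra σ).toSubmodule.subtype

theorem derivAt_lie (x : kˣ) (a b : onsagerAlgebra σ) :
    derivAt σ x ⁅a, b⁆ = ⁅ev σ x a, derivAt σ x b⁆ - ⁅ev σ x b, derivAt σ x a⁆ :=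
  derivMap_lie x a.1 b.1

theorem derivAt_evenElt (x : kˣ) (P : k[X]) (u : fixedSubalgebra σ) :
    derivAt σ x (evenElt σ P u) =
      ((1 - x⁻¹ ^ 2 : k) * P.derivative.eval (x + x⁻¹ : k)) • (u : g) := by
  change (laurentJet x _).snd • (u : g) = _
  rw [snd_laurentJet_aeval]

/-- Product rule: `1 + x⁻²` is the derivative of `t - t⁻¹` at `x`. -/
theorem derivAt_oddElt (x : kˣ) (P : k[X]) (v : oddPart σ) :
    derivAt σ x (oddElt σ P v) = ((1 + x⁻¹ ^ 2 : k) * P.eval (x + x⁻¹ : k) +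
      (x - x⁻¹ : k) * ((1 - x⁻¹ ^ 2 : k) * P.derivative.eval (x + x⁻¹ : k))) • (v : g) := by
  change (laurentJet x _).snd • (v : g) = _
  rw [map_mul, TrivSqZeroExt.snd_mul, snd_laurentJet_aeval, fst_laurentJet, fst_laurentJet,
    laurentEval_aeval_symT, laurentJet_skewT, laurentEval_skewT]
  congr 1
  simp
  ring

end Evaluation

/-! ### Construction of cocycles and representatives of cohomology. -/

section CocycleMaps

variable {k L h : Type*} [Field k] [LieRing L] [LieAlgebra k L] [LieRing h] [LieAlgebra k h]
  {U W Z : Type*} [AddCommGroup U] [Module k U] [LieRingModule h U] [LieModule k h U]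
  [AddCommGroup W] [Module k W] [LieRingModule h W] [LieModule k h W]
  [AddCommGroup Z] [Module k Z]

/-- Composition of a cocycle with a module homomorphism. -/
def compCocycle (π : L →ₗ⁅k⁆ h) (D : L →ₗ[k] U) (hD : D ∈ cocycles π U) :
    (U →ₗ⁅k,h⁆ W) →ₗ[k] cocycles π W where
  toFun φ := ⟨(φ : U →ₗ[k] W) ∘ₗ D, fun a b => by
    change φ (D ⁅a, b⁆) = ⁅π a, φ (D b)⁆ - ⁅π b, φ (D a)⁆
    rw [mem_cocycles.mp hD, map_sub, LieModuleHom.map_lie, LieModuleHom.map_lie]⟩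
  map_add' _ _ := rfl
  map_smul' _ _ := rfl

/-- The cocycles with values in the invariants that factor through a linear map to `Z` that
vanishes on commutators. -/
def invariantCocycle (π : L →ₗ⁅k⁆ h) (q : L →ₗ[k] Z) (hq : ∀ a b : L, q ⁅a, b⁆ = 0) :
    (Z →ₗ[k] LieModule.maxTrivSubmodule k h W) →ₗ[k] cocycles π W where
  toFun β := ⟨(LieModule.maxTrivSubmodule k h W).toSubmodule.subtype ∘ₗ β ∘ₗ q, fun a b => by
    change ((β (q ⁅a, b⁆) : LieModule.maxTrivSubmodule k h W) : W) =
      ⁅π a, (β (q b) : W)⁆ - ⁅π b, (β (q a) : W)⁆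
    rw [hq, (LieModule.mem_maxTrivSubmodule k h W _).mp (β (q b)).2,
      (LieModule.mem_maxTrivSubmodule k h W _).mp (β (q a)).2, map_zero, sub_zero]
    rfl⟩
  map_add' _ _ := rfl
  map_smul' _ _ := rfl

theorem FirstCohomology.nonempty_equiv {π : L →ₗ⁅k⁆ h} {X : Type*} [AddCommGroup X] [Module k X]
    (Φ : X →ₗ[k] cocycles π W)
    (hinj : ∀ x w, (∀ a, (Φ x : L →ₗ[k] W) a = ⁅π a, w⁆) → x = 0)
    (hsurj : ∀ d ∈ cocycles π W, ∃ x w, ∀ a, d a = (Φ x : L →ₗ[k] W) a + ⁅π a, w⁆) :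
    Nonempty (X ≃ₗ[k] FirstCohomology π W) := by
  let N := LinearMap.range (innerCocycle π W)
  refine ⟨LinearEquiv.ofBijective (N.mkQ ∘ₗ Φ : X →ₗ[k] cocycles π W ⧸ N) ⟨?_, ?_⟩⟩
  · rw [injective_iff_map_eq_zero]
    intro x hx
    obtain ⟨w, hw⟩ := (Submodule.Quotient.mk_eq_zero N).mp hx
    exact hinj x w fun a => by rw [← hw]; rfl
  · intro y
    obtain ⟨d, rfl⟩ := N.mkQ_surjective y
    obtain ⟨x, w, hx⟩ := hsurj d.1 d.2
    refine ⟨x, ?_⟩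
    refine ((Submodule.Quotient.eq N).mpr ⟨-w, ?_⟩)
    ext a
    change ⁅π a, -w⁆ = (Φ x : L →ₗ[k] W) a - d.1 a
    rw [hx, lie_neg]
    abel

/-- A cocycle that factors through a surjection gives a cocycle of the quotient. -/
theorem cocycle_of_factor {π : L →ₗ⁅k⁆ h} (hπ : Function.Surjective π) {δ : L →ₗ[k] W}
    (hδ : δ ∈ cocycles π W) {d : h →ₗ[k] W} (hd : ∀ a, δ a = d (π a)) (a b : h) :
    d ⁅a, b⁆ = ⁅a, d b⁆ - ⁅b, d a⁆ := by
  obtain ⟨a, rfl⟩ := hπ a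
  obtain ⟨b, rfl⟩ := hπ b
  rw [← LieHom.map_lie, ← hd, ← hd, ← hd, mem_cocycles.mp hδ]

end CocycleMaps

/-! ### Linear maps determined on the even and odd parts. -/

section Splitting

variable {k : Type u} [Field k] {g : Type u} [LieRing g] [LieAlgebra k g] {σ : g ≃ₗ⁅k⁆ g}
  {W : Type*} [AddCommGroup W] [Module k W]

/-- The projection to the even part. -/
def evenProj [CharZero k] (hσ : ∀ u : g, σ (σ u) = u) : g →ₗ[k] fixedSubalgebra σ :=
  LinearMap.codRestrict (fixedSubalgebra σ).toSubmodule
    ((2⁻¹ : k) • (LinearMap.id + (σ.toLieHom : g →ₗ[k] g))) fun x => by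
      change σ ((2⁻¹ : k) • (x + σ x)) = (2⁻¹ : k) • (x + σ x)
      rw [map_smul, map_add, hσ, add_comm]

/-- The projection to the odd part. -/
def oddProj [CharZero k] (hσ : ∀ u : g, σ (σ u) = u) : g →ₗ[k] oddPart σ :=
  LinearMap.codRestrict (oddPart σ).toSubmodule
    ((2⁻¹ : k) • (LinearMap.id - (σ.toLieHom : g →ₗ[k] g))) fun x => by
      change σ ((2⁻¹ : k) • (x - σ x)) = -((2⁻¹ : k) • (x - σ x))
      rw [map_smul, map_sub, hσ, ← smul_neg, neg_sub]

variable [CharZero k]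

theorem evenProj_coe (hσ : ∀ u : g, σ (σ u) = u) (u : fixedSubalgebra σ) :
    evenProj hσ (u : g) = u := by
  apply Subtype.ext
  change (2⁻¹ : k) • ((u : g) + σ u) = u
  rw [mem_fixedSubalgebra.mp u.2, ← two_smul k, smul_smul, inv_mul_cancel₀ two_ne_zero, one_smul]

theorem evenProj_odd (hσ : ∀ u : g, σ (σ u) = u) (v : oddPart σ) : evenProj hσ (v : g) = 0 := by
  apply Subtype.ext
  change (2⁻¹ : k) • ((v : g) + σ v) = 0
  rw [mem_oddPart.mp v.2, add_neg_cancel, smul_zero]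

theorem oddProj_even (hσ : ∀ u : g, σ (σ u) = u) (u : fixedSubalgebra σ) :
    oddProj hσ (u : g) = 0 := by
  apply Subtype.ext
  change (2⁻¹ : k) • ((u : g) - σ u) = 0
  rw [mem_fixedSubalgebra.mp u.2, sub_self, smul_zero]

theorem oddProj_coe (hσ : ∀ u : g, σ (σ u) = u) (v : oddPart σ) : oddProj hσ (v : g) = v := by
  apply Subtype.ext
  change (2⁻¹ : k) • ((v : g) - σ v) = v
  rw [mem_oddPart.mp v.2, sub_neg_eq_add, ← two_smul k, smul_smul, inv_mul_cancel₀ two_ne_zero,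
    one_smul]

theorem exists_linearMap_of_even_odd (hσ : ∀ u : g, σ (σ u) = u) (f₀ : fixedSubalgebra σ →ₗ[k] W)
    (f₁ : oddPart σ →ₗ[k] W) : ∃ f : g →ₗ[k] W,
      (∀ u : fixedSubalgebra σ, f u = f₀ u) ∧ ∀ v : oddPart σ, f v = f₁ v := by
  refine ⟨f₀ ∘ₗ evenProj hσ + f₁ ∘ₗ oddProj hσ, fun u => ?_, fun v => ?_⟩
  · change f₀ (evenProj hσ (u : g)) + f₁ (oddProj hσ (u : g)) = f₀ u
    rw [evenProj_coe, oddProj_even, map_zero, add_zero]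
  · change f₀ (evenProj hσ (v : g)) + f₁ (oddProj hσ (v : g)) = f₁ v
    rw [evenProj_odd, oddProj_coe, map_zero, zero_add]

/-- There is one condition for each pair of parities; `h01` lets `u` act on the image of `v`, and
`h10` lets `v` act on the image of `u`. -/
theorem exists_lieModuleHom_of_even_odd [LieRingModule g W] [LieModule k g W]
    (hσ : ∀ u : g, σ (σ u) = u) (f₀ : fixedSubalgebra σ →ₗ[k] W) (f₁ : oddPart σ →ₗ[k] W)
    (h00 : ∀ u u' : fixedSubalgebra σ, f₀ ⁅u, u'⁆ = ⁅(u : g), f₀ u'⁆)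
    (h01 : ∀ (u : fixedSubalgebra σ) (v : oddPart σ), f₁ ⁅u, v⁆ = ⁅(u : g), f₁ v⁆)
    (h10 : ∀ (u : fixedSubalgebra σ) (v : oddPart σ), f₁ ⁅u, v⁆ = -⁅(v : g), f₀ u⁆)
    (h11 : ∀ v v' : oddPart σ, f₀ (oddBracket v v') = ⁅(v : g), f₁ v'⁆) :
    ∃ f : g →ₗ⁅k,g⁆ W,
      (∀ u : fixedSubalgebra σ, f u = f₀ u) ∧ ∀ v : oddPart σ, f v = f₁ v := by
  obtain ⟨f, hf0, hf1⟩ := exists_linearMap_of_even_odd hσ f₀ f₁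
  refine ⟨{ f with map_lie' := fun {x y} => ?_ }, hf0, hf1⟩
  change f ⁅x, y⁆ = ⁅x, f y⁆
  obtain ⟨a, ha, b, hb, rfl⟩ := exists_even_add_odd hσ x
  obtain ⟨c, hc, d, hd, rfl⟩ := exists_even_add_odd hσ y
  have e00 : f ⁅a, c⁆ = ⁅a, f c⁆ :=
    (hf0 ⁅⟨a, ha⟩, ⟨c, hc⟩⁆).trans ((h00 _ _).trans (by rw [← hf0]))
  have e01 : f ⁅a, d⁆ = ⁅a, f d⁆ :=
    (hf1 ⁅(⟨a, ha⟩ : fixedSubalgebra σ), (⟨d, hd⟩ : oddPart σ)⁆).trans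
      ((h01 _ _).trans (by rw [← hf1]))
  have e10 : f ⁅b, c⁆ = ⁅b, f c⁆ := by
    rw [← lie_skew, map_neg, neg_eq_iff_eq_neg]
    exact (hf1 ⁅(⟨c, hc⟩ : fixedSubalgebra σ), (⟨b, hb⟩ : oddPart σ)⁆).trans
      ((h10 _ _).trans (by rw [← hf0]))
  have e11 : f ⁅b, d⁆ = ⁅b, f d⁆ :=
    (hf0 (oddBracket ⟨b, hb⟩ ⟨d, hd⟩)).trans ((h11 _ _).trans (by rw [← hf1]))
  simp only [add_lie, lie_add, map_add, e00, e01, e10, e11]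

variable [FiniteDimensional k g]

/-- Because `g₁ = [g₀, g₁]`. -/
theorem odd_hom_ext [LieAlgebra.IsKilling k g] (hσ : ∀ u : g, σ (σ u) = u)
    {f f' : oddPart σ →ₗ[k] W}
    (h : ∀ (u : fixedSubalgebra σ) (v : oddPart σ), f ⁅u, v⁆ = f' ⁅u, v⁆) : f = f' := by
  ext v
  have key : ∀ x ∈ Submodule.span k
      {z : g | ∃ a ∈ fixedSubalgebra σ, ∃ b ∈ oddPart σ, ⁅a, b⁆ = z},
      f (oddProj hσ x) = f' (oddProj hσ x) := by
    intro x hx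
    induction hx using Submodule.span_induction with
    | mem z hz =>
      obtain ⟨a, ha, b, hb, rfl⟩ := hz
      have : oddProj hσ ⁅a, b⁆ = ⁅(⟨a, ha⟩ : fixedSubalgebra σ), (⟨b, hb⟩ : oddPart σ)⁆ :=
        oddProj_coe hσ ⁅(⟨a, ha⟩ : fixedSubalgebra σ), (⟨b, hb⟩ : oddPart σ)⁆
      rw [this, h]
    | zero => simp
    | add x y _ _ hx hy => simp only [map_add, hx, hy]
    | smul r x _ hx => simp only [map_smul, hx]
  have := key v (span_lie_even_odd hσ v.2)
  rwa [oddProj_coe] at this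

/-- Because `g₀ = [g₁, g₁]`. -/
theorem even_hom_ext [LieAlgebra.IsSimple k g] (hσ : ∀ u : g, σ (σ u) = u)
    (hσ₁ : ∃ u : g, σ u ≠ u) {f f' : fixedSubalgebra σ →ₗ[k] W}
    (h : ∀ v v' : oddPart σ, f (oddBracket v v') = f' (oddBracket v v')) : f = f' := by
  ext u
  have key : ∀ x ∈ Submodule.span k
      {z : g | ∃ a ∈ oddPart σ, ∃ b ∈ oddPart σ, ⁅a, b⁆ = z},
      f (evenProj hσ x) = f' (evenProj hσ x) := by
    intro x hx
    induction hx using Submodule.span_induction with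
    | mem z hz =>
      obtain ⟨a, ha, b, hb, rfl⟩ := hz
      have : evenProj hσ ⁅a, b⁆ = oddBracket ⟨a, ha⟩ ⟨b, hb⟩ :=
        evenProj_coe hσ (oddBracket ⟨a, ha⟩ ⟨b, hb⟩)
      rw [this, h]
    | zero => simp
    | add x y _ _ hx hy => simp only [map_add, hx, hy]
    | smul r x _ hx => simp only [map_smul, hx]
  have := key u (span_lie_odd_odd hσ hσ₁ u.2)
  rwa [evenProj_coe] at this

/-- A linear map on the even part that vanishes on commutators of elements of the kernel of the
projection to the center factors through this projection. -/
theorem apply_eq_apply_center [LieAlgebra.IsSimple k g] [IsAlgClosed k]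
    (hσ : ∀ u : g, σ (σ u) = u)
    {p : fixedSubalgebra σ →ₗ[k] abPart σ} (hpz : ∀ z : abPart σ, p z = z)
    (hp : ∀ u u' : fixedSubalgebra σ, p ⁅u, u'⁆ = 0) (f : fixedSubalgebra σ →ₗ[k] W)
    (hf : ∀ u u', u ∈ kerIdeal p hp → u' ∈ kerIdeal p hp → f ⁅u, u'⁆ = 0)
    (u : fixedSubalgebra σ) : f u = f (p u) := by
  have := hasTrivialRadical_kerIdeal hσ p hpz hp
  -- The kernel of `p` is semisimple, hence perfect.
  have key : ∀ s : kerIdeal p hp, f s = 0 := by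
    intro s
    have hs : s ∈ Submodule.span k {z : kerIdeal p hp | ∃ x y : kerIdeal p hp, ⁅x, y⁆ = z} := by
      rw [span_lie_eq_top_of_hasTrivialRadical]
      trivial
    induction hs using Submodule.span_induction with
    | mem z hz =>
      obtain ⟨x, y, rfl⟩ := hz
      exact hf x y x.2 y.2
    | zero => exact map_zero f
    | add x y _ _ hx hy =>
      change f ((x : fixedSubalgebra σ) + y) = 0
      rw [map_add, hx, hy, add_zero]
    | smul r x _ hx =>
      change f (r • (x : fixedSubalgebra σ)) = 0
      rw [map_smul, hx, smul_zero]
  have hu : u - p u ∈ kerIdeal p hp := by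
    change p (u - p u) = 0
    rw [map_sub, hpz, sub_self]
  have := key ⟨_, hu⟩
  rwa [map_sub, sub_eq_zero] at this

end Splitting

/-! ### Values at the points `±1` and interpolation there. -/

section CenterEvaluation

open Polynomial

variable {k : Type u} [Field k] {g : Type u} [LieRing g] [LieAlgebra k g] {σ : g ≃ₗ⁅k⁆ g}

/-- The evaluation at a point `y = ±1` followed by a projection of the even part to its center. -/
def centerEval (p : fixedSubalgebra σ →ₗ[k] abPart σ) (y : kˣ) (hy : y = 1 ∨ y = -1) :
    onsagerAlgebra σ →ₗ[k] abPart σ :=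
  p ∘ₗ (evFixed σ y hy : onsagerAlgebra σ →ₗ[k] fixedSubalgebra σ)

theorem centerEval_lie {p : fixedSubalgebra σ →ₗ[k] abPart σ}
    (hp : ∀ u u' : fixedSubalgebra σ, p ⁅u, u'⁆ = 0) (y : kˣ) (hy : y = 1 ∨ y = -1)
    (a b : onsagerAlgebra σ) : centerEval p y hy ⁅a, b⁆ = 0 := by
  change p (evFixed σ y hy ⁅a, b⁆) = 0
  rw [LieHom.map_lie, hp]

theorem centerEval_evenElt (p : fixedSubalgebra σ →ₗ[k] abPart σ) (y : kˣ) (hy : y = 1 ∨ y = -1)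
    (P : k[X]) (u : fixedSubalgebra σ) :
    centerEval p y hy (evenElt σ P u) = P.eval (2 * y : k) • p u := by
  change p (evFixed σ y hy _) = _
  rw [evFixed_evenElt, map_smul]

theorem centerEval_oddElt (p : fixedSubalgebra σ →ₗ[k] abPart σ) (y : kˣ) (hy : y = 1 ∨ y = -1)
    (P : k[X]) (v : oddPart σ) : centerEval p y hy (oddElt σ P v) = 0 := by
  change p (evFixed σ y hy _) = _
  rw [evFixed_oddElt, map_zero]

theorem exists_eq_C_eval_add (s : k) (P : k[X]) : ∃ R, P = C (P.eval s) + (X - C s) * R := by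
  obtain ⟨R, hR⟩ := X_sub_C_dvd_sub_C_eval (a := s) (p := P)
  exact ⟨R, by rw [← hR, add_sub_cancel]⟩

theorem exists_eq_interpolation [CharZero k] (P : k[X]) :
    ∃ (b c : k) (R : k[X]), P = C b * (X + 2) + C c * (X - 2) + (X ^ 2 - 4) * R := by
  obtain ⟨Q, hQ⟩ := exists_eq_C_eval_add 2 P
  obtain ⟨R, hR⟩ := exists_eq_C_eval_add (-2) Q
  set a := P.eval 2
  set b := Q.eval (-2)
  have h2 : (C (2 : k) : k[X]) = 2 := rfl
  have h4 : (C a : k[X]) = C (a / 4) * 4 := by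
    rw [show (4 : k[X]) = C 4 from rfl, ← C_mul, div_mul_cancel₀ _ (by norm_num : (4 : k) ≠ 0)]
  -- Use `4 = (X + 2) - (X - 2)` in `P = a + (X - 2) (b + (X + 2) R)`.
  refine ⟨a / 4, b - a / 4, R, ?_⟩
  rw [hQ, hR, h4, C_neg, h2, C_sub]
  ring

end CenterEvaluation

/-! ### Cocycles at a point `x ≠ ±1`. -/

section Generic

open Polynomial

variable {k : Type u} [Field k] {g : Type u} [LieRing g] [LieAlgebra k g] {σ : g ≃ₗ⁅k⁆ g}
  {W : Type u} [AddCommGroup W] [Module k W] [LieRingModule g W] [LieModule k g W]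
  {x : kˣ} {δ : onsagerAlgebra σ →ₗ[k] W}

theorem cocycle_even_even (hδ : δ ∈ cocycles (ev σ x) W) (P Q : k[X]) (u u' : fixedSubalgebra σ) :
    δ (evenElt σ (P * Q) ⁅u, u'⁆) = P.eval (x + x⁻¹ : k) • ⁅(u : g), δ (evenElt σ Q u')⁆ -
      Q.eval (x + x⁻¹ : k) • ⁅(u' : g), δ (evenElt σ P u)⁆ := by
  rw [← lie_evenElt_evenElt, mem_cocycles.mp hδ, ev_evenElt, ev_evenElt, smul_lie, smul_lie]

theorem cocycle_even_odd (hδ : δ ∈ cocycles (ev σ x) W) (P Q : k[X]) (u : fixedSubalgebra σ)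
    (v : oddPart σ) :
    δ (oddElt σ (P * Q) ⁅u, v⁆) = P.eval (x + x⁻¹ : k) • ⁅(u : g), δ (oddElt σ Q v)⁆ -
      ((x - x⁻¹ : k) * Q.eval (x + x⁻¹ : k)) • ⁅(v : g), δ (evenElt σ P u)⁆ := by
  rw [← lie_evenElt_oddElt, mem_cocycles.mp hδ, ev_evenElt, ev_oddElt, smul_lie, smul_lie]

theorem cocycle_odd_odd (hδ : δ ∈ cocycles (ev σ x) W) (P Q : k[X]) (v v' : oddPart σ) :
    δ (evenElt σ (P * Q * (X ^ 2 - 4)) (oddBracket v v')) =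
      ((x - x⁻¹ : k) * P.eval (x + x⁻¹ : k)) • ⁅(v : g), δ (oddElt σ Q v')⁆ -
      ((x - x⁻¹ : k) * Q.eval (x + x⁻¹ : k)) • ⁅(v' : g), δ (oddElt σ P v)⁆ := by
  rw [← lie_oddElt_oddElt, mem_cocycles.mp hδ, ev_oddElt, ev_oddElt, smul_lie, smul_lie]

theorem sub_inv_ne_zero {x : kˣ} (h1 : x ≠ 1) (h2 : x ≠ -1) : (x - x⁻¹ : k) ≠ 0 := by
  intro h
  have h' : ((x : k) - 1) * (x + 1) = 0 := by
    have : (x : k) * x⁻¹ = 1 := by simp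
    linear_combination (x : k) * h + this
  rcases mul_eq_zero.mp h' with h' | h'
  · exact h1 (Units.ext (sub_eq_zero.mp h'))
  · exact h2 (Units.ext (by rw [eq_neg_of_add_eq_zero_left h']; rfl))

variable [CharZero k]

theorem ev_surjective (hσ : ∀ u : g, σ (σ u) = u) {x : kˣ} (h1 : x ≠ 1) (h2 : x ≠ -1) :
    Function.Surjective (ev σ x) := by
  intro y
  obtain ⟨a, ha, b, hb, rfl⟩ := exists_even_add_odd hσ y
  refine ⟨evenElt σ 1 ⟨a, ha⟩ + (x - x⁻¹ : k)⁻¹ • oddElt σ 1 ⟨b, hb⟩, ?_⟩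
  rw [map_add, map_smul, ev_evenElt, ev_oddElt, eval_one, mul_one, one_smul, smul_smul,
    inv_mul_cancel₀ (sub_inv_ne_zero h1 h2), one_smul]

variable [FiniteDimensional k g] [LieAlgebra.IsSimple k g]

/-- Split the polynomial into two factors that vanish at `x + x⁻¹`: both terms of the cocycle
identity drop out, and brackets of even with odd elements span `g₁`. -/
theorem cocycle_odd_sq_eq_zero (hσ : ∀ u : g, σ (σ u) = u) (hδ : δ ∈ cocycles (ev σ x) W)
    (P : k[X]) (v : oddPart σ) :
    δ (oddElt σ ((X - C (x + x⁻¹ : k)) * ((X - C (x + x⁻¹ : k)) * P)) v) = 0 := by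
  refine DFunLike.congr_fun (odd_hom_ext (k := k) (W := W) (f' := 0) hσ (f := δ ∘ₗ oddElt σ
    ((X - C (x + x⁻¹ : k)) * ((X - C (x + x⁻¹ : k)) * P))) fun u v => ?_) v
  refine (cocycle_even_odd hδ _ _ u v).trans ?_
  simp

/-- The same argument with brackets of two odd elements, which span `g₀` but bring in the factor `X
^ 2 - 4`. -/
theorem cocycle_even_sq_mul_eq_zero (hσ : ∀ u : g, σ (σ u) = u) (hσ₁ : ∃ u : g, σ u ≠ u)
    (hδ : δ ∈ cocycles (ev σ x) W) (P : k[X]) (u : fixedSubalgebra σ) :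
    δ (evenElt σ ((X - C (x + x⁻¹ : k)) * ((X - C (x + x⁻¹ : k)) * P) * (X ^ 2 - 4)) u) = 0 := by
  refine DFunLike.congr_fun (even_hom_ext (k := k) (W := W) (f' := 0) hσ hσ₁ (f := δ ∘ₗ evenElt σ
    ((X - C (x + x⁻¹ : k)) * ((X - C (x + x⁻¹ : k)) * P) * (X ^ 2 - 4))) fun v v' => ?_) u
  refine (cocycle_odd_odd hδ _ _ v v').trans ?_
  simp

/-- Without the factor `X ^ 2 - 4` only brackets of even elements are available, and these miss the
center. -/
theorem cocycle_even_sq_eq_center [IsAlgClosed k] (hσ : ∀ u : g, σ (σ u) = u)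
    {p : fixedSubalgebra σ →ₗ[k] abPart σ} (hpz : ∀ z : abPart σ, p z = z)
    (hp : ∀ u u' : fixedSubalgebra σ, p ⁅u, u'⁆ = 0)
    (hδ : δ ∈ cocycles (ev σ x) W) (P : k[X]) (u : fixedSubalgebra σ) :
    δ (evenElt σ ((X - C (x + x⁻¹ : k)) * ((X - C (x + x⁻¹ : k)) * P)) u) =
      δ (evenElt σ ((X - C (x + x⁻¹ : k)) * ((X - C (x + x⁻¹ : k)) * P)) (p u)) := by
  refine apply_eq_apply_center hσ hpz hp (δ ∘ₗ evenElt σ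
    ((X - C (x + x⁻¹ : k)) * ((X - C (x + x⁻¹ : k)) * P))) (fun u u' _ _ => ?_) u
  refine (cocycle_even_even hδ _ _ u u').trans ?_
  simp

/-- With the vanishing already proved, the four hypotheses cover all polynomials that are zero at `x
+ x⁻¹`. So `δ` factors through the evaluation, and Whitehead's lemma for `g` applies. -/
theorem exists_inner_of_generic [FiniteDimensional k W] [IsAlgClosed k] (hσ : ∀ u : g, σ (σ u) = u)
    (hσ₁ : ∃ u : g, σ u ≠ u) (h1 : x ≠ 1) (h2 : x ≠ -1) (hδ : δ ∈ cocycles (ev σ x) W)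
    (hodd : ∀ v, δ (oddElt σ (X - C (x + x⁻¹ : k)) v) = 0)
    (heven : ∀ u, δ (evenElt σ ((X - C (x + x⁻¹ : k)) * (X ^ 2 - 4)) u) = 0)
    (heven₁ : ∀ u,
      δ (evenElt σ ((X - C (x + x⁻¹ : k)) * ((X - C (x + x⁻¹ : k)) * (X + 2))) u) = 0)
    (heven₂ : ∀ u,
      δ (evenElt σ ((X - C (x + x⁻¹ : k)) * ((X - C (x + x⁻¹ : k)) * (X - 2))) u) = 0) :
    ∃ w, ∀ a, δ a = ⁅ev σ x a, w⁆ := by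
  have hθ := sub_inv_ne_zero h1 h2
  have hc : (x + x⁻¹ : k) ^ 2 - 4 = (x - x⁻¹ : k) ^ 2 := by
    have : (x : k) * x⁻¹ = 1 := by simp
    linear_combination 4 * this
  have hCsmul : ∀ (a : k) (P : k[X]), C a * P = a • P := fun a P => (smul_eq_C_mul a).symm
  have hC1 : ∀ a : k, C a = a • (1 : k[X]) := fun a => by rw [← hCsmul, mul_one]
  set s : k := (x + x⁻¹ : k) with hs
  have hodd' : ∀ P v, δ (oddElt σ P v) = P.eval s • δ (oddElt σ 1 v) := by
    intro P v
    obtain ⟨R, hR⟩ := exists_eq_C_eval_add s P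
    obtain ⟨R', hR'⟩ := exists_eq_C_eval_add s R
    have : (X - C s) * R = R.eval s • (X - C s) + (X - C s) * ((X - C s) * R') := by
      nth_rewrite 1 [hR']
      rw [← hCsmul]
      ring
    have hq : δ (oddElt σ ((X - C s) * R) v) = 0 := by
      rw [this, map_add, LinearMap.add_apply, map_add, cocycle_odd_sq_eq_zero hσ hδ, map_smul,
        LinearMap.smul_apply, map_smul, hodd, smul_zero, add_zero]
    rw [← map_smul, ← LinearMap.smul_apply, ← map_smul, ← hC1]
    nth_rewrite 1 [hR]
    rw [map_add, LinearMap.add_apply, map_add, hq, add_zero]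
  have heven' : ∀ P u, δ (evenElt σ P u) = P.eval s • δ (evenElt σ 1 u) := by
    intro P v
    obtain ⟨R, hR⟩ := exists_eq_C_eval_add s P
    -- Subtracting the multiple of `X ^ 2 - 4` with the same value at `s` leaves a multiple of `X -
    -- s`, whose cofactor is then interpolated at `±2`.
    obtain ⟨R', hR'⟩ := exists_eq_C_eval_add s (R - C (R.eval s / (s ^ 2 - 4)) * (X ^ 2 - 4))
    obtain ⟨b, c, R'', hR''⟩ := exists_eq_interpolation R'
    have h0 : (R - C (R.eval s / (s ^ 2 - 4)) * (X ^ 2 - 4)).eval s = 0 := by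
      have : s ^ 2 - 4 ≠ 0 := by
        rw [hc]
        exact pow_ne_zero 2 hθ
      rw [eval_sub, eval_mul, eval_C, eval_sub, eval_pow, eval_X, eval_ofNat,
        div_mul_cancel₀ _ this, sub_self]
    have : (X - C s) * R = (R.eval s / (s ^ 2 - 4)) • ((X - C s) * (X ^ 2 - 4)) +
        b • ((X - C s) * ((X - C s) * (X + 2))) + c • ((X - C s) * ((X - C s) * (X - 2))) +
        (X - C s) * ((X - C s) * R'') * (X ^ 2 - 4) := by
      rw [h0, C_0, zero_add, hR''] at hR'
      simp only [← hCsmul]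
      linear_combination (X - C s) * hR'
    have hq : δ (evenElt σ ((X - C s) * R) v) = 0 := by
      rw [this]
      simp only [map_add, LinearMap.add_apply, map_smul, LinearMap.smul_apply]
      rw [heven, heven₁, heven₂, cocycle_even_sq_mul_eq_zero hσ hσ₁ hδ]
      simp
    rw [← map_smul, ← LinearMap.smul_apply, ← map_smul, ← hC1]
    nth_rewrite 1 [hR]
    rw [map_add, LinearMap.add_apply, map_add, hq, add_zero]
  obtain ⟨d, hd0, hd1⟩ := exists_linearMap_of_even_odd hσ (δ ∘ₗ evenElt σ 1)
    ((x - x⁻¹ : k)⁻¹ • (δ ∘ₗ oddElt σ 1))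
  have hfac : δ = d ∘ₗ (ev σ x : onsagerAlgebra σ →ₗ[k] g) := by
    refine onsager_hom_ext hσ (fun P u => ?_) fun P v => ?_
    · change _ = d (ev σ x _)
      rw [ev_evenElt, map_smul, hd0, heven', ← hs]
      rfl
    · change _ = d (ev σ x _)
      rw [ev_oddElt, map_smul, hd1, hodd', ← hs]
      change _ = _ • (x - x⁻¹ : k)⁻¹ • δ _
      rw [smul_smul, mul_comm, inv_mul_cancel_left₀ hθ]
  have hcoc := cocycle_of_factor (ev_surjective hσ h1 h2) hδ (d := d)
    (fun a => DFunLike.congr_fun hfac a)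
  obtain ⟨w, hw⟩ := exists_inner_of_hasTrivialRadical (k := k) d hcoc
  exact ⟨w, fun a => (DFunLike.congr_fun hfac a).trans (hw _)⟩

end Generic

/-! ### First cohomology at a point `x ≠ ±1`. -/

section Generic

open Polynomial

variable {k : Type u} [Field k] {g : Type u} [LieRing g] [LieAlgebra k g] {σ : g ≃ₗ⁅k⁆ g}
  {W : Type u} [AddCommGroup W] [Module k W] [LieRingModule g W] [LieModule k g W]

/-- The cocycles on the Onsager algebra along the evaluation at a generic point that are given by
the derivative at this point and the values at the points `±1`. -/
def genericCocycle (p : fixedSubalgebra σ →ₗ[k] abPart σ)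
    (hp : ∀ u u' : fixedSubalgebra σ, p ⁅u, u'⁆ = 0) (x : kˣ) :
    ((g →ₗ⁅k,g⁆ W) × (abPart σ →ₗ[k] LieModule.maxTrivSubmodule k g W) ×
      (abPart σ →ₗ[k] LieModule.maxTrivSubmodule k g W)) →ₗ[k] cocycles (ev σ x) W :=
  (compCocycle (ev σ x) (derivAt σ x) (derivAt_lie x)).coprod
    ((invariantCocycle (ev σ x) (centerEval p 1 (Or.inl rfl)) (centerEval_lie hp _ _)).coprod
      (invariantCocycle (ev σ x) (centerEval p (-1) (Or.inr rfl)) (centerEval_lie hp _ _)))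

theorem genericCocycle_apply (p : fixedSubalgebra σ →ₗ[k] abPart σ)
    (hp : ∀ u u' : fixedSubalgebra σ, p ⁅u, u'⁆ = 0) (x : kˣ) (φ : g →ₗ⁅k,g⁆ W)
    (β γ : abPart σ →ₗ[k] LieModule.maxTrivSubmodule k g W) (a : onsagerAlgebra σ) :
    (genericCocycle p hp x (φ, β, γ) : onsagerAlgebra σ →ₗ[k] W) a =
      φ (derivAt σ x a) + ((β (centerEval p 1 (Or.inl rfl) a) : W) +
        (γ (centerEval p (-1) (Or.inr rfl) a) : W)) := rfl

theorem genericCocycle_evenElt (p : fixedSubalgebra σ →ₗ[k] abPart σ)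
    (hp : ∀ u u' : fixedSubalgebra σ, p ⁅u, u'⁆ = 0) (x : kˣ) (φ : g →ₗ⁅k,g⁆ W)
    (β γ : abPart σ →ₗ[k] LieModule.maxTrivSubmodule k g W) (P : k[X]) (u : fixedSubalgebra σ) :
    (genericCocycle p hp x (φ, β, γ) : onsagerAlgebra σ →ₗ[k] W) (evenElt σ P u) =
      ((1 - x⁻¹ ^ 2 : k) * P.derivative.eval (x + x⁻¹ : k)) • φ u +
        (P.eval 2 • (β (p u) : W) + P.eval (-2) • (γ (p u) : W)) := by
  rw [genericCocycle_apply, derivAt_evenElt, centerEval_evenElt, centerEval_evenElt, map_smul,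
    map_smul, map_smul]
  simp

theorem genericCocycle_oddElt (p : fixedSubalgebra σ →ₗ[k] abPart σ)
    (hp : ∀ u u' : fixedSubalgebra σ, p ⁅u, u'⁆ = 0) (x : kˣ) (φ : g →ₗ⁅k,g⁆ W)
    (β γ : abPart σ →ₗ[k] LieModule.maxTrivSubmodule k g W) (P : k[X]) (v : oddPart σ) :
    (genericCocycle p hp x (φ, β, γ) : onsagerAlgebra σ →ₗ[k] W) (oddElt σ P v) =
      ((1 + x⁻¹ ^ 2 : k) * P.eval (x + x⁻¹ : k) +
      (x - x⁻¹ : k) * ((1 - x⁻¹ ^ 2 : k) * P.derivative.eval (x + x⁻¹ : k))) • φ v := by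
  rw [genericCocycle_apply, derivAt_oddElt, centerEval_oddElt, centerEval_oddElt, map_smul]
  simp

theorem one_sub_inv_sq_ne_zero {x : kˣ} (h1 : x ≠ 1) (h2 : x ≠ -1) : (1 - x⁻¹ ^ 2 : k) ≠ 0 := by
  have : (1 - x⁻¹ ^ 2 : k) = (x - x⁻¹ : k) * x⁻¹ := by
    have : (x : k) * x⁻¹ = 1 := by simp
    rw [sub_mul, this]
    simp [sq]
  rw [this]
  exact mul_ne_zero (sub_inv_ne_zero h1 h2) (by simp)

theorem add_inv_sq_sub_four (x : kˣ) : (x + x⁻¹ : k) ^ 2 - 4 = (x - x⁻¹ : k) ^ 2 := by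
  have : (x : k) * x⁻¹ = 1 := by simp
  linear_combination 4 * this

theorem two_sub_add_inv_ne_zero {x : kˣ} (h1 : x ≠ 1) (h2 : x ≠ -1) :
    (2 - (x + x⁻¹) : k) ≠ 0 ∧ (-2 - (x + x⁻¹) : k) ≠ 0 := by
  have h := pow_ne_zero 2 (sub_inv_ne_zero h1 h2)
  rw [← add_inv_sq_sub_four,
    show (x + x⁻¹ : k) ^ 2 - 4 = (2 - (x + x⁻¹) : k) * (-2 - (x + x⁻¹) : k) by ring] at h
  exact ⟨left_ne_zero_of_mul h, right_ne_zero_of_mul h⟩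

variable [CharZero k]

/-- Every test polynomial vanishes at `s = x + x⁻¹`, so the inner cocycle disappears. On odd
elements `X - s`, and on even ones `(X - s)(X² - 4)`, detect only `φ`; `(X - s)²(X + 2)` detects
only `β`, and `(X - s)²(X - 2)` only `γ`. -/
theorem genericCocycle_injective (hσ : ∀ u : g, σ (σ u) = u)
    {p : fixedSubalgebra σ →ₗ[k] abPart σ} (hpz : ∀ z : abPart σ, p z = z)
    (hp : ∀ u u' : fixedSubalgebra σ, p ⁅u, u'⁆ = 0) {x : kˣ} (h1 : x ≠ 1) (h2 : x ≠ -1)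
    (y : (g →ₗ⁅k,g⁆ W) × (abPart σ →ₗ[k] LieModule.maxTrivSubmodule k g W) ×
      (abPart σ →ₗ[k] LieModule.maxTrivSubmodule k g W)) (w : W)
    (hw : ∀ a, (genericCocycle p hp x y : onsagerAlgebra σ →ₗ[k] W) a = ⁅ev σ x a, w⁆) : y = 0 := by
  obtain ⟨φ, β, γ⟩ := y
  have hθ := sub_inv_ne_zero h1 h2
  have hκ := one_sub_inv_sq_ne_zero h1 h2
  obtain ⟨h2s, h2s'⟩ := two_sub_add_inv_ne_zero h1 h2
  have hc : (x + x⁻¹ : k) ^ 2 - 4 ≠ 0 := by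
    rw [add_inv_sq_sub_four]
    exact pow_ne_zero 2 hθ
  have hodd : ∀ v : oddPart σ, φ v = 0 := fun v => by
    have h := hw (oddElt σ (X - C (x + x⁻¹ : k)) v)
    rw [genericCocycle_oddElt, ev_oddElt] at h
    simp only [eval_sub, eval_X, eval_C, sub_self, mul_zero, zero_smul, zero_lie, derivative_sub,
      derivative_X, derivative_C, sub_zero, eval_one, mul_one, zero_add] at h
    exact (smul_eq_zero.mp h).resolve_left (mul_ne_zero hθ hκ)
  have heven : ∀ u : fixedSubalgebra σ, φ u = 0 := fun u => by
    have h := hw (evenElt σ ((X - C (x + x⁻¹ : k)) * (X ^ 2 - 4)) u)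
    rw [genericCocycle_evenElt, ev_evenElt,
      show ((X - C (x + x⁻¹ : k)) * (X ^ 2 - 4) : k[X]).eval 2 = 0 by simp; norm_num,
      show ((X - C (x + x⁻¹ : k)) * (X ^ 2 - 4) : k[X]).eval (-2) = 0 by simp; norm_num] at h
    simp only [eval_mul, eval_sub, eval_X, eval_C, sub_self, zero_mul, zero_smul, zero_lie,
      derivative_mul, derivative_sub, derivative_X, derivative_C, sub_zero, one_mul,
      eval_add, eval_pow, eval_ofNat, add_zero] at h
    exact (smul_eq_zero.mp h).resolve_left (mul_ne_zero hκ hc)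
  have hφ : φ = 0 := by
    ext y
    obtain ⟨a, ha, b, hb, rfl⟩ := exists_even_add_odd hσ y
    rw [map_add]
    exact (congrArg₂ (· + ·) (heven ⟨a, ha⟩) (hodd ⟨b, hb⟩)).trans (add_zero 0)
  clear hodd heven
  subst hφ
  have hβ : β = 0 := by
    ext z
    have h := hw (evenElt σ ((X - C (x + x⁻¹ : k)) ^ 2 * (X + 2)) z)
    rw [genericCocycle_evenElt, ev_evenElt, hpz] at h
    simp only [eval_mul, eval_pow, eval_sub, eval_X, eval_C, sub_self, ne_eq, OfNat.ofNat_ne_zero,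
      not_false_eq_true, zero_pow, zero_mul, zero_smul, zero_lie, eval_add, eval_ofNat,
      neg_add_cancel, mul_zero, LieModuleHom.zero_apply, smul_zero, zero_add, add_zero] at h
    exact (smul_eq_zero.mp h).resolve_left (mul_ne_zero (pow_ne_zero 2 h2s) (by norm_num))
  have hγ : γ = 0 := by
    ext z
    have h := hw (evenElt σ ((X - C (x + x⁻¹ : k)) ^ 2 * (X - 2)) z)
    rw [genericCocycle_evenElt, ev_evenElt, hpz] at h
    simp only [eval_mul, eval_pow, eval_sub, eval_X, eval_C, sub_self, ne_eq, OfNat.ofNat_ne_zero,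
      not_false_eq_true, zero_pow, zero_mul, zero_smul, zero_lie, eval_ofNat,
      mul_zero, LieModuleHom.zero_apply, smul_zero, zero_add] at h
    exact (smul_eq_zero.mp h).resolve_left (mul_ne_zero (pow_ne_zero 2 h2s') (by norm_num))
  rw [hβ, hγ]
  rfl

variable [FiniteDimensional k g] [LieAlgebra.IsSimple k g] {δ : onsagerAlgebra σ →ₗ[k] W}

/-- The two scalars are what the derivative at `x` gives on these test elements. Dividing them out
defines `φ`, and the cocycle identity makes it equivariant. -/
theorem exists_lieModuleHom_of_generic (hσ : ∀ u : g, σ (σ u) = u) {x : kˣ} (h1 : x ≠ 1)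
    (h2 : x ≠ -1) (hδ : δ ∈ cocycles (ev σ x) W) : ∃ φ : g →ₗ⁅k,g⁆ W,
      (∀ u : fixedSubalgebra σ, δ (evenElt σ ((X - C (x + x⁻¹ : k)) * (X ^ 2 - 4)) u) =
        ((1 - x⁻¹ ^ 2 : k) * ((x + x⁻¹ : k) ^ 2 - 4)) • φ u) ∧
      ∀ v : oddPart σ, δ (oddElt σ (X - C (x + x⁻¹ : k)) v) =
        ((x - x⁻¹ : k) * (1 - x⁻¹ ^ 2 : k)) • φ v := by
  have hθ := sub_inv_ne_zero h1 h2
  have hκ := one_sub_inv_sq_ne_zero h1 h2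
  rw [add_inv_sq_sub_four]
  set s : k := (x + x⁻¹ : k) with hs
  set θ : k := (x - x⁻¹ : k) with hθ'
  set κ : k := (1 - x⁻¹ ^ 2 : k)
  have hcs : s ^ 2 - 4 = θ ^ 2 := add_inv_sq_sub_four x
  have hq : (X - C s).eval s = 0 := by simp
  have hE : ((X - C s) * (X ^ 2 - 4) : k[X]).eval s = 0 := by simp
  obtain ⟨φ, hφ0, hφ1⟩ := exists_lieModuleHom_of_even_odd (k := k) hσ
    ((κ * θ ^ 2)⁻¹ • (δ ∘ₗ evenElt σ ((X - C s) * (X ^ 2 - 4))))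
    ((θ * κ)⁻¹ • (δ ∘ₗ oddElt σ (X - C s)))
    (fun u u' => by
      change (κ * θ ^ 2)⁻¹ • δ _ = ⁅(u : g), (κ * θ ^ 2)⁻¹ • δ _⁆
      have h := cocycle_even_even hδ 1 ((X - C s) * (X ^ 2 - 4)) u u'
      rw [one_mul, ← hs, hE, zero_smul, sub_zero, eval_one, one_smul] at h
      rw [h, lie_smul])
    (fun u v => by
      change (θ * κ)⁻¹ • δ _ = ⁅(u : g), (θ * κ)⁻¹ • δ _⁆
      have h := cocycle_even_odd hδ 1 (X - C s) u v
      rw [one_mul, ← hs, hq, mul_zero, zero_smul, sub_zero, eval_one, one_smul] at h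
      rw [h, lie_smul])
    (fun u v => by
      change (θ * κ)⁻¹ • δ _ = -⁅(v : g), (κ * θ ^ 2)⁻¹ • δ _⁆
      -- On odd elements `δ` kills multiples of `(X - s)²`, modulo which `(X - s)(X² - 4)` is `θ²(X
      -- - s)`. The second `show` restores the polynomial in the even element on the right.
      have h := cocycle_even_odd hδ ((X - C s) * (X ^ 2 - 4)) 1 u v
      rw [mul_one, ← hs, ← hθ', hE, zero_smul, zero_sub, eval_one, mul_one,
        show (X - C s) * (X ^ 2 - 4) = (θ ^ 2) • (X - C s) + (X - C s) * ((X - C s) * (X + C s)) by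
          rw [← hcs, smul_eq_C_mul, C_sub, C_pow, show (C 4 : k[X]) = 4 from rfl]
          ring, map_add, LinearMap.add_apply, map_add, cocycle_odd_sq_eq_zero hσ hδ, add_zero,
        map_smul, LinearMap.smul_apply, map_smul,
        show (θ ^ 2) • (X - C s) + (X - C s) * ((X - C s) * (X + C s)) =
          (X - C s) * (X ^ 2 - 4) by
          rw [← hcs, smul_eq_C_mul, C_sub, C_pow, show (C 4 : k[X]) = 4 from rfl]
          ring] at h
      have h' : δ (oddElt σ (X - C s) ⁅u, v⁆) =
          (θ ^ 2)⁻¹ • -(θ • ⁅(v : g), δ (evenElt σ ((X - C s) * (X ^ 2 - 4)) u)⁆) := by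
        rw [← h, smul_smul, inv_mul_cancel₀ (pow_ne_zero 2 hθ), one_smul]
      rw [h', lie_smul, smul_neg, smul_neg, smul_smul, smul_smul]
      congr 2
      field_simp)
    (fun v v' => by
      change (κ * θ ^ 2)⁻¹ • δ _ = ⁅(v : g), (θ * κ)⁻¹ • δ _⁆
      have h := cocycle_odd_odd hδ 1 (X - C s) v v'
      rw [one_mul, ← hs, ← hθ', hq, mul_zero, zero_smul, sub_zero, eval_one, mul_one] at h
      rw [h, lie_smul, smul_smul]
      congr 1
      field_simp)
  refine ⟨φ, fun u => ?_, fun v => ?_⟩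
  · rw [hφ0]
    change _ = (κ * θ ^ 2) • (κ * θ ^ 2)⁻¹ • δ _
    rw [smul_smul, mul_inv_cancel₀ (mul_ne_zero hκ (pow_ne_zero 2 hθ)), one_smul]
  · rw [hφ1]
    change _ = (θ * κ) • (θ * κ)⁻¹ • δ _
    rw [smul_smul, mul_inv_cancel₀ (mul_ne_zero hθ hκ), one_smul]

/-- A central `z` commutes with `g₀`, and bracketing with an odd `v` gives an odd element divisible
by `(X - s)²`, with `s = x + x⁻¹`, which `δ` kills. So both `g₀` and `g₁` annihilate the value. -/
theorem exists_invariant_of_generic (hσ : ∀ u : g, σ (σ u) = u) {x : kˣ} (h1 : x ≠ 1)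
    (h2 : x ≠ -1) (hδ : δ ∈ cocycles (ev σ x) W) (P : k[X]) {c : k} (hc : c ≠ 0) :
    ∃ β : abPart σ →ₗ[k] LieModule.maxTrivSubmodule k g W, ∀ z : abPart σ,
      δ (evenElt σ ((X - C (x + x⁻¹ : k)) * ((X - C (x + x⁻¹ : k)) * P)) z) = c • (β z : W) := by
  refine ⟨LinearMap.codRestrict (LieModule.maxTrivSubmodule k g W).toSubmodule
    (c⁻¹ • (δ ∘ₗ evenElt σ ((X - C (x + x⁻¹ : k)) * ((X - C (x + x⁻¹ : k)) * P)) ∘ₗ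
      (abPart σ).toSubmodule.subtype)) fun z => ?_, fun z => ?_⟩
  · refine (LieModule.maxTrivSubmodule k g W).smul_mem _ ?_
    change δ (evenElt σ _ (z : fixedSubalgebra σ)) ∈ LieModule.maxTrivSubmodule k g W
    rw [LieModule.mem_maxTrivSubmodule]
    intro y
    obtain ⟨a, ha, b, hb, rfl⟩ := exists_even_add_odd hσ y
    have ha' := cocycle_even_even hδ 1 ((X - C (x + x⁻¹ : k)) * ((X - C (x + x⁻¹ : k)) * P))
      ⟨a, ha⟩ z
    rw [(LieModule.mem_maxTrivSubmodule k (fixedSubalgebra σ) (fixedSubalgebra σ) _).mp z.2,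
      map_zero, map_zero, eval_mul, eval_sub, eval_X, eval_C, sub_self, zero_mul, zero_smul,
      sub_zero, eval_one, one_smul] at ha'
    have hb' := cocycle_even_odd hδ ((X - C (x + x⁻¹ : k)) * ((X - C (x + x⁻¹ : k)) * P)) 1
      z ⟨b, hb⟩
    rw [mul_one, cocycle_odd_sq_eq_zero hσ hδ, eval_mul, eval_sub, eval_X, eval_C, sub_self,
      zero_mul, zero_smul, zero_sub, eval_one, mul_one, eq_comm, neg_eq_zero] at hb'
    rw [add_lie, ← ha', zero_add]
    exact (smul_eq_zero.mp hb').resolve_left (sub_inv_ne_zero h1 h2)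
  · change _ = c • c⁻¹ • δ _
    rw [smul_smul, mul_inv_cancel₀ hc, one_smul]
    rfl

theorem genericCocycle_surjective [FiniteDimensional k W] [IsAlgClosed k]
    (hσ : ∀ u : g, σ (σ u) = u) (hσ₁ : ∃ u : g, σ u ≠ u)
    {p : fixedSubalgebra σ →ₗ[k] abPart σ} (hpz : ∀ z : abPart σ, p z = z)
    (hp : ∀ u u' : fixedSubalgebra σ, p ⁅u, u'⁆ = 0) {x : kˣ} (h1 : x ≠ 1) (h2 : x ≠ -1)
    (hδ : δ ∈ cocycles (ev σ x) W) : ∃ (y : (g →ₗ⁅k,g⁆ W) ×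
      (abPart σ →ₗ[k] LieModule.maxTrivSubmodule k g W) ×
      (abPart σ →ₗ[k] LieModule.maxTrivSubmodule k g W)) (w : W), ∀ a,
      δ a = (genericCocycle p hp x y : onsagerAlgebra σ →ₗ[k] W) a + ⁅ev σ x a, w⁆ := by
  obtain ⟨h2s, h2s'⟩ := two_sub_add_inv_ne_zero h1 h2
  obtain ⟨φ, hφ0, hφ1⟩ := exists_lieModuleHom_of_generic hσ h1 h2 hδ
  -- The constants are the values of `(X - s)²(X + 2)` at `2` and of `(X - s)²(X - 2)` at `-2`,
  -- where `s = x + x⁻¹`.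
  obtain ⟨β, hβ⟩ := exists_invariant_of_generic hσ h1 h2 hδ (X + 2)
    (mul_ne_zero (pow_ne_zero 2 h2s) (by norm_num : (4 : k) ≠ 0))
  obtain ⟨γ, hγ⟩ := exists_invariant_of_generic hσ h1 h2 hδ (X - 2)
    (mul_ne_zero (pow_ne_zero 2 h2s') (neg_ne_zero.mpr (by norm_num : (4 : k) ≠ 0)))
  have hδ' := sub_mem hδ (genericCocycle p hp x (φ, β, γ)).2
  obtain ⟨w, hw⟩ := exists_inner_of_generic hσ hσ₁ h1 h2 hδ'
    (fun v => by
      rw [LinearMap.sub_apply, genericCocycle_oddElt, hφ1, sub_eq_zero]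
      simp)
    (fun u => by
      rw [LinearMap.sub_apply, genericCocycle_evenElt, hφ0, sub_eq_zero,
        show ((X - C (x + x⁻¹ : k)) * (X ^ 2 - 4) : k[X]).eval 2 = 0 by simp; norm_num,
        show ((X - C (x + x⁻¹ : k)) * (X ^ 2 - 4) : k[X]).eval (-2) = 0 by simp; norm_num]
      simp)
    (fun u => by
      rw [LinearMap.sub_apply, genericCocycle_evenElt, cocycle_even_sq_eq_center hσ hpz hp hδ, hβ,
        sub_eq_zero]
      simp only [eval_mul, eval_sub, eval_X, eval_C, sub_self, zero_mul, zero_smul, eval_add,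
        eval_ofNat, neg_add_cancel, mul_zero, zero_add, add_zero, derivative_mul]
      congr 1
      ring)
    (fun u => by
      rw [LinearMap.sub_apply, genericCocycle_evenElt, cocycle_even_sq_eq_center hσ hpz hp hδ, hγ,
        sub_eq_zero]
      simp only [eval_mul, eval_sub, eval_X, eval_C, sub_self, zero_mul, zero_smul, eval_add,
        eval_ofNat, mul_zero, zero_add, add_zero, derivative_mul]
      congr 1
      ring)
  exact ⟨(φ, β, γ), w, fun a => by rw [← hw, LinearMap.sub_apply, add_sub_cancel]⟩

theorem nonempty_generic_equiv [FiniteDimensional k W] [IsAlgClosed k]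
    (hσ : ∀ u : g, σ (σ u) = u) (hσ₁ : ∃ u : g, σ u ≠ u) {x : kˣ} (h1 : x ≠ 1) (h2 : x ≠ -1) :
    Nonempty (((g →ₗ⁅k,g⁆ W) × (abPart σ →ₗ[k] LieModule.maxTrivSubmodule k g W) ×
      (abPart σ →ₗ[k] LieModule.maxTrivSubmodule k g W)) ≃ₗ[k] FirstCohomology (ev σ x) W) := by
  obtain ⟨p, hpz, hp⟩ := exists_center_projection hσ hσ₁
  exact FirstCohomology.nonempty_equiv (genericCocycle p hp x)
    (genericCocycle_injective hσ hpz hp h1 h2)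
    (fun _ hδ => genericCocycle_surjective hσ hσ₁ hpz hp h1 h2 hδ)

end Generic

/-! ### First cohomology at the points `±1`. -/

section Fixed

open Polynomial

variable {k : Type u} [Field k] {g : Type u} [LieRing g] [LieAlgebra k g] {σ : g ≃ₗ⁅k⁆ g}

theorem inv_eq_self_of_fixed {x : kˣ} (hx : x = 1 ∨ x = -1) : ((x⁻¹ : kˣ) : k) = x := by
  rcases hx with rfl | rfl <;> norm_num

theorem sq_eq_one_of_fixed {x : kˣ} (hx : x = 1 ∨ x = -1) : (x ^ 2 : k) = 1 := by
  rcases hx with rfl | rfl <;> norm_num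

theorem neg_fixed {x : kˣ} (hx : x = 1 ∨ x = -1) : -x = 1 ∨ -x = -1 := by
  rcases hx with rfl | rfl <;> simp

variable [CharZero k]

/-- The derivative of `t + t⁻¹` is zero at `±1`, so the even generators contribute nothing. -/
theorem derivAt_mem_oddPart (hσ : ∀ u : g, σ (σ u) = u) {x : kˣ} (hx : x = 1 ∨ x = -1)
    (a : onsagerAlgebra σ) : derivAt σ x a ∈ oddPart σ := by
  have h : a ∈ (oddPart σ).toSubmodule.comap (derivAt σ x) := by
    rw [eq_top_of_evenElt_oddElt hσ ((oddPart σ).toSubmodule.comap (derivAt σ x)) (fun P u => ?_)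
      (fun P v => ?_)]
    · trivial
    · rw [Submodule.mem_comap, derivAt_evenElt, inv_eq_self_of_fixed hx, sq_eq_one_of_fixed hx,
        sub_self, zero_mul, zero_smul]
      exact zero_mem _
    · rw [Submodule.mem_comap, derivAt_oddElt]
      exact Submodule.smul_mem _ _ v.2
  exact h

/-- The derivative at a point `±1`, as a map to the odd part. -/
def oddDerivAt (hσ : ∀ u : g, σ (σ u) = u) {x : kˣ} (hx : x = 1 ∨ x = -1) :
    onsagerAlgebra σ →ₗ[k] oddPart σ :=
  LinearMap.codRestrict (oddPart σ).toSubmodule (derivAt σ x) (derivAt_mem_oddPart hσ hx)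

theorem oddDerivAt_mem_cocycles (hσ : ∀ u : g, σ (σ u) = u) {x : kˣ} (hx : x = 1 ∨ x = -1) :
    oddDerivAt hσ hx ∈ cocycles (evFixed σ x hx) (oddPart σ) :=
  fun a b => Subtype.ext (derivAt_lie x a b)

theorem oddDerivAt_evenElt (hσ : ∀ u : g, σ (σ u) = u) {x : kˣ} (hx : x = 1 ∨ x = -1) (P : k[X])
    (u : fixedSubalgebra σ) : oddDerivAt hσ hx (evenElt σ P u) = 0 := by
  apply Subtype.ext
  change derivAt σ x (evenElt σ P u) = 0
  rw [derivAt_evenElt, inv_eq_self_of_fixed hx, sq_eq_one_of_fixed hx, sub_self, zero_mul,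
    zero_smul]

theorem oddDerivAt_oddElt (hσ : ∀ u : g, σ (σ u) = u) {x : kˣ} (hx : x = 1 ∨ x = -1) (P : k[X])
    (v : oddPart σ) : oddDerivAt hσ hx (oddElt σ P v) = (2 * P.eval (2 * x : k)) • v := by
  apply Subtype.ext
  change derivAt σ x (oddElt σ P v) = (2 * P.eval (2 * x : k)) • (v : g)
  rw [derivAt_oddElt, inv_eq_self_of_fixed hx, sq_eq_one_of_fixed hx, sub_self, zero_mul, add_zero,
    one_add_one_eq_two, two_mul (x : k)]

variable {W : Type u} [AddCommGroup W] [Module k W] [LieRingModule (fixedSubalgebra σ) W]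
  [LieModule k (fixedSubalgebra σ) W]

/-- The cocycles on the Onsager algebra along the evaluation at a fixed point `x = ±1` that are
given by the derivative at this point and the values at the points `±1`. -/
def fixedCocycle (hσ : ∀ u : g, σ (σ u) = u) (p : fixedSubalgebra σ →ₗ[k] abPart σ)
    (hp : ∀ u u' : fixedSubalgebra σ, p ⁅u, u'⁆ = 0) {x : kˣ} (hx : x = 1 ∨ x = -1) :
    ((oddPart σ →ₗ⁅k,fixedSubalgebra σ⁆ W) ×
      (abPart σ →ₗ[k] LieModule.maxTrivSubmodule k (fixedSubalgebra σ) W) ×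
      (abPart σ →ₗ[k] LieModule.maxTrivSubmodule k (fixedSubalgebra σ) W)) →ₗ[k]
      cocycles (evFixed σ x hx) W :=
  (compCocycle (evFixed σ x hx) (oddDerivAt hσ hx) (oddDerivAt_mem_cocycles hσ hx)).coprod
    ((invariantCocycle (evFixed σ x hx) (centerEval p x hx) (centerEval_lie hp _ _)).coprod
      (invariantCocycle (evFixed σ x hx) (centerEval p (-x) (neg_fixed hx))
        (centerEval_lie hp _ _)))

theorem fixedCocycle_apply (hσ : ∀ u : g, σ (σ u) = u) (p : fixedSubalgebra σ →ₗ[k] abPart σ)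
    (hp : ∀ u u' : fixedSubalgebra σ, p ⁅u, u'⁆ = 0) {x : kˣ} (hx : x = 1 ∨ x = -1)
    (φ : oddPart σ →ₗ⁅k,fixedSubalgebra σ⁆ W)
    (β γ : abPart σ →ₗ[k] LieModule.maxTrivSubmodule k (fixedSubalgebra σ) W)
    (a : onsagerAlgebra σ) :
    (fixedCocycle hσ p hp hx (φ, β, γ) : onsagerAlgebra σ →ₗ[k] W) a =
      φ (oddDerivAt hσ hx a) + ((β (p (evFixed σ x hx a)) : W) +
        (γ (centerEval p (-x) (neg_fixed hx) a) : W)) := rfl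

theorem fixedCocycle_evenElt (hσ : ∀ u : g, σ (σ u) = u) (p : fixedSubalgebra σ →ₗ[k] abPart σ)
    (hp : ∀ u u' : fixedSubalgebra σ, p ⁅u, u'⁆ = 0) {x : kˣ} (hx : x = 1 ∨ x = -1)
    (φ : oddPart σ →ₗ⁅k,fixedSubalgebra σ⁆ W)
    (β γ : abPart σ →ₗ[k] LieModule.maxTrivSubmodule k (fixedSubalgebra σ) W)
    (P : k[X]) (u : fixedSubalgebra σ) :
    (fixedCocycle hσ p hp hx (φ, β, γ) : onsagerAlgebra σ →ₗ[k] W) (evenElt σ P u) =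
      P.eval (2 * x : k) • (β (p u) : W) + P.eval (-(2 * x) : k) • (γ (p u) : W) := by
  rw [fixedCocycle_apply, oddDerivAt_evenElt, evFixed_evenElt, centerEval_evenElt, map_smul,
    map_smul, map_smul]
  simp

theorem fixedCocycle_oddElt (hσ : ∀ u : g, σ (σ u) = u) (p : fixedSubalgebra σ →ₗ[k] abPart σ)
    (hp : ∀ u u' : fixedSubalgebra σ, p ⁅u, u'⁆ = 0) {x : kˣ} (hx : x = 1 ∨ x = -1)
    (φ : oddPart σ →ₗ⁅k,fixedSubalgebra σ⁆ W)
    (β γ : abPart σ →ₗ[k] LieModule.maxTrivSubmodule k (fixedSubalgebra σ) W)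
    (P : k[X]) (v : oddPart σ) :
    (fixedCocycle hσ p hp hx (φ, β, γ) : onsagerAlgebra σ →ₗ[k] W) (oddElt σ P v) =
      (2 * P.eval (2 * x : k)) • φ v := by
  rw [fixedCocycle_apply, oddDerivAt_oddElt, evFixed_oddElt, centerEval_oddElt, map_smul]
  simp

theorem four_mul_ne_zero (x : kˣ) : (-(2 * x) - 2 * x : k) ≠ 0 := by
  rw [show (-(2 * x) - 2 * x : k) = (-4) * x by ring]
  exact mul_ne_zero (by norm_num) x.ne_zero

/-- Evaluation at `x` kills odd elements, which isolates `φ`; `X - 2x` vanishes at `x` but not at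
`-x`, which isolates `γ`. If `μ z = 0`, the inner term vanishes on `1 ⊗ z` and leaves `β z`; if `μ z
≠ 0`, there are no nonzero invariants. -/
theorem fixedCocycle_injective (hσ : ∀ u : g, σ (σ u) = u)
    {p : fixedSubalgebra σ →ₗ[k] abPart σ} (hpz : ∀ z : abPart σ, p z = z)
    (hp : ∀ u u' : fixedSubalgebra σ, p ⁅u, u'⁆ = 0) {x : kˣ} (hx : x = 1 ∨ x = -1)
    {μ : abPart σ → k} (hμ : ∀ (z : abPart σ) (w : W), ⁅(z : fixedSubalgebra σ), w⁆ = μ z • w)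
    (y : (oddPart σ →ₗ⁅k,fixedSubalgebra σ⁆ W) ×
      (abPart σ →ₗ[k] LieModule.maxTrivSubmodule k (fixedSubalgebra σ) W) ×
      (abPart σ →ₗ[k] LieModule.maxTrivSubmodule k (fixedSubalgebra σ) W)) (w : W)
    (hw : ∀ a, (fixedCocycle hσ p hp hx y : onsagerAlgebra σ →ₗ[k] W) a =
      ⁅evFixed σ x hx a, w⁆) : y = 0 := by
  obtain ⟨φ, β, γ⟩ := y
  have hφ : φ = 0 := by
    ext v
    have h := hw (oddElt σ 1 v)
    rw [fixedCocycle_oddElt, evFixed_oddElt, zero_lie, eval_one, mul_one] at h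
    exact (smul_eq_zero.mp h).resolve_left two_ne_zero
  have hγ : γ = 0 := by
    ext z
    have h := hw (evenElt σ (X - C (2 * x : k)) z)
    rw [fixedCocycle_evenElt, evFixed_evenElt, hpz] at h
    simp only [eval_sub, eval_X, eval_C, sub_self, zero_smul, zero_lie, zero_add] at h
    exact (smul_eq_zero.mp h).resolve_left (four_mul_ne_zero x)
  have hβ : β = 0 := by
    ext z
    by_cases h0 : μ z = 0
    · have h := hw (evenElt σ 1 z)
      rw [fixedCocycle_evenElt, evFixed_evenElt, hpz, eval_one, eval_one, one_smul, one_smul,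
        one_smul, hγ, hμ, h0, zero_smul] at h
      simpa using h
    · have h := (LieModule.mem_maxTrivSubmodule k (fixedSubalgebra σ) W _).mp (β z).2 z
      rw [hμ] at h
      exact (smul_eq_zero.mp h).resolve_left h0
  rw [hφ, hβ, hγ]
  rfl

theorem evFixed_surjective {x : kˣ} (hx : x = 1 ∨ x = -1) :
    Function.Surjective (evFixed σ x hx) :=
  fun u => ⟨evenElt σ 1 u, by rw [evFixed_evenElt, eval_one, one_smul]⟩

theorem X_sq_sub_four_eq {x : kˣ} (hx : x = 1 ∨ x = -1) :
    (X ^ 2 - 4 : k[X]) = (X - C (2 * x : k)) * (X + C (2 * x : k)) := by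
  have h : (C (2 * x : k)) ^ 2 = 4 := by
    rw [← C_pow, mul_pow, sq_eq_one_of_fixed hx, mul_one,
      show (2 ^ 2 : k) = 4 by norm_num]
    rfl
  linear_combination h

variable [FiniteDimensional k g] [LieAlgebra.IsSimple k g] {δ : onsagerAlgebra σ →ₗ[k] W}

/-- The bracket of an even element with an odd one gives `P(2x) • u · δ(v)`, as the odd one
evaluates to zero, and such brackets span `g₁`. -/
theorem fixed_cocycle_odd (hσ : ∀ u : g, σ (σ u) = u) {x : kˣ} (hx : x = 1 ∨ x = -1)
    (hδ : δ ∈ cocycles (evFixed σ x hx) W) (P : k[X]) (v : oddPart σ) :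
    δ (oddElt σ P v) = P.eval (2 * x : k) • δ (oddElt σ 1 v) := by
  have h := fun (P : k[X]) (u : fixedSubalgebra σ) (v : oddPart σ) =>
    mem_cocycles.mp hδ (evenElt σ P u) (oddElt σ 1 v)
  simp only [lie_evenElt_oddElt, evFixed_evenElt, evFixed_oddElt, zero_lie, sub_zero, mul_one,
    smul_lie] at h
  refine DFunLike.congr_fun (odd_hom_ext (k := k) (W := W) hσ (f := δ ∘ₗ oddElt σ P)
    (f' := P.eval (2 * x : k) • (δ ∘ₗ oddElt σ 1)) fun u v => ?_) v
  change δ (oddElt σ P ⁅u, v⁆) = P.eval (2 * x : k) • δ (oddElt σ 1 ⁅u, v⁆)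
  rw [h, h 1, eval_one, one_smul]

theorem fixed_cocycle_even_mul (hσ : ∀ u : g, σ (σ u) = u) (hσ₁ : ∃ u : g, σ u ≠ u) {x : kˣ}
    (hx : x = 1 ∨ x = -1) (hδ : δ ∈ cocycles (evFixed σ x hx) W) (P : k[X])
    (u : fixedSubalgebra σ) : δ (evenElt σ (P * (X ^ 2 - 4)) u) = 0 := by
  refine DFunLike.congr_fun (even_hom_ext (k := k) (W := W) hσ hσ₁
    (f := δ ∘ₗ evenElt σ (P * (X ^ 2 - 4))) (f' := 0) fun v v' => ?_) u
  have h := mem_cocycles.mp hδ (oddElt σ P v) (oddElt σ 1 v')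
  rw [lie_oddElt_oddElt, evFixed_oddElt, evFixed_oddElt, zero_lie, zero_lie, sub_zero,
    mul_one] at h
  exact h

/-- Two even elements with polynomial `X - 2x` evaluate to zero, so `δ` kills their bracket, which
carries `(X - 2x)²`. Modulo `X² - 4` this is `-4x (X - 2x)`. -/
theorem fixed_cocycle_even_eq_center [IsAlgClosed k] (hσ : ∀ u : g, σ (σ u) = u)
    (hσ₁ : ∃ u : g, σ u ≠ u)
    {p : fixedSubalgebra σ →ₗ[k] abPart σ} (hpz : ∀ z : abPart σ, p z = z)
    (hp : ∀ u u' : fixedSubalgebra σ, p ⁅u, u'⁆ = 0) {x : kˣ}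
    (hx : x = 1 ∨ x = -1) (hδ : δ ∈ cocycles (evFixed σ x hx) W) (u : fixedSubalgebra σ) :
    δ (evenElt σ (X - C (2 * x : k)) u) = δ (evenElt σ (X - C (2 * x : k)) (p u)) := by
  refine apply_eq_apply_center hσ hpz hp (δ ∘ₗ evenElt σ (X - C (2 * x : k)))
    (fun u u' _ _ => ?_) u
  have h := mem_cocycles.mp hδ (evenElt σ (X - C (2 * x : k)) u)
    (evenElt σ (X - C (2 * x : k)) u')
  have hq : (X - C (2 * x : k)) * (X - C (2 * x : k)) =
      1 * (X ^ 2 - 4) + (-(2 * x) - 2 * x : k) • (X - C (2 * x : k)) := by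
    rw [X_sq_sub_four_eq hx, smul_eq_C_mul, C_sub, C_neg]
    ring
  rw [lie_evenElt_evenElt, evFixed_evenElt, evFixed_evenElt, eval_sub, eval_X, eval_C, sub_self,
    zero_smul, zero_smul, zero_lie, zero_lie, sub_zero, hq, map_add, LinearMap.add_apply, map_add,
    fixed_cocycle_even_mul hσ hσ₁ hx hδ, zero_add, map_smul, LinearMap.smul_apply, map_smul] at h
  exact (smul_eq_zero.mp h).resolve_left (four_mul_ne_zero x)

theorem fixed_cocycle_even (hσ : ∀ u : g, σ (σ u) = u) (hσ₁ : ∃ u : g, σ u ≠ u) {x : kˣ}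
    (hx : x = 1 ∨ x = -1) (hδ : δ ∈ cocycles (evFixed σ x hx) W)
    (h0 : ∀ u, δ (evenElt σ (X - C (2 * x : k)) u) = 0) (P : k[X]) (u : fixedSubalgebra σ) :
    δ (evenElt σ P u) = P.eval (2 * x : k) • δ (evenElt σ 1 u) := by
  have hC : ∀ a : k, C a = a • (1 : k[X]) := fun a => by rw [smul_eq_C_mul, mul_one]
  obtain ⟨R, hR⟩ := exists_eq_C_eval_add (2 * x : k) P
  obtain ⟨R', hR'⟩ := exists_eq_C_eval_add (-(2 * x) : k) R
  have : (X - C (2 * x : k)) * R = R.eval (-(2 * x) : k) • (X - C (2 * x : k)) +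
      R' * (X ^ 2 - 4) := by
    nth_rewrite 1 [hR']
    rw [X_sq_sub_four_eq hx, smul_eq_C_mul, C_neg]
    ring
  have hq : δ (evenElt σ ((X - C (2 * x : k)) * R) u) = 0 := by
    rw [this, map_add, LinearMap.add_apply, map_add, fixed_cocycle_even_mul hσ hσ₁ hx hδ, map_smul,
      LinearMap.smul_apply, map_smul, h0, smul_zero, add_zero]
  rw [← map_smul, ← LinearMap.smul_apply, ← map_smul, ← hC]
  nth_rewrite 1 [hR]
  rw [map_add, LinearMap.add_apply, map_add, hq, add_zero]

theorem exists_invariant_of_fixed {x : kˣ}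
    (hx : x = 1 ∨ x = -1) (hδ : δ ∈ cocycles (evFixed σ x hx) W) {c : k} (hc : c ≠ 0) :
    ∃ γ : abPart σ →ₗ[k] LieModule.maxTrivSubmodule k (fixedSubalgebra σ) W, ∀ z : abPart σ,
      δ (evenElt σ (X - C (2 * x : k)) z) = c • (γ z : W) := by
  refine ⟨LinearMap.codRestrict (LieModule.maxTrivSubmodule k (fixedSubalgebra σ) W).toSubmodule
    (c⁻¹ • (δ ∘ₗ evenElt σ (X - C (2 * x : k)) ∘ₗ
      (abPart σ).toSubmodule.subtype)) fun z => ?_, fun z => ?_⟩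
  · refine (LieModule.maxTrivSubmodule k (fixedSubalgebra σ) W).smul_mem _ ?_
    change δ (evenElt σ _ (z : fixedSubalgebra σ)) ∈
      LieModule.maxTrivSubmodule k (fixedSubalgebra σ) W
    rw [LieModule.mem_maxTrivSubmodule]
    intro u
    have h := mem_cocycles.mp hδ (evenElt σ 1 u) (evenElt σ (X - C (2 * x : k)) z)
    rw [lie_evenElt_evenElt,
      (LieModule.mem_maxTrivSubmodule k (fixedSubalgebra σ) (fixedSubalgebra σ) _).mp z.2,
      map_zero, map_zero, evFixed_evenElt, evFixed_evenElt, eval_sub, eval_X, eval_C, sub_self,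
      zero_smul, zero_lie, sub_zero, eval_one, one_smul] at h
    exact h.symm
  · change _ = c • c⁻¹ • δ _
    rw [smul_smul, mul_inv_cancel₀ hc, one_smul]
    rfl

theorem fixedCocycle_surjective [FiniteDimensional k W] [IsAlgClosed k]
    (hσ : ∀ u : g, σ (σ u) = u) (hσ₁ : ∃ u : g, σ u ≠ u)
    {p : fixedSubalgebra σ →ₗ[k] abPart σ} (hpz : ∀ z : abPart σ, p z = z)
    (hp : ∀ u u' : fixedSubalgebra σ, p ⁅u, u'⁆ = 0) {x : kˣ} (hx : x = 1 ∨ x = -1)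
    {μ : abPart σ → k} (hμ : ∀ (z : abPart σ) (w : W), ⁅(z : fixedSubalgebra σ), w⁆ = μ z • w)
    (hδ : δ ∈ cocycles (evFixed σ x hx) W) :
    ∃ (y : (oddPart σ →ₗ⁅k,fixedSubalgebra σ⁆ W) ×
      (abPart σ →ₗ[k] LieModule.maxTrivSubmodule k (fixedSubalgebra σ) W) ×
      (abPart σ →ₗ[k] LieModule.maxTrivSubmodule k (fixedSubalgebra σ) W)) (w : W), ∀ a,
      δ a = (fixedCocycle hσ p hp hx y : onsagerAlgebra σ →ₗ[k] W) a +
        ⁅evFixed σ x hx a, w⁆ := by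
  obtain ⟨γ, hγ⟩ := exists_invariant_of_fixed hx hδ (four_mul_ne_zero x)
  let φ : oddPart σ →ₗ⁅k,fixedSubalgebra σ⁆ W :=
    { (2⁻¹ : k) • (δ ∘ₗ oddElt σ 1) with
      map_lie' := fun {u v} => by
        change (2⁻¹ : k) • δ (oddElt σ 1 ⁅u, v⁆) = ⁅u, (2⁻¹ : k) • δ (oddElt σ 1 v)⁆
        have h := mem_cocycles.mp hδ (evenElt σ 1 u) (oddElt σ 1 v)
        rw [lie_evenElt_oddElt, evFixed_evenElt, evFixed_oddElt, zero_lie, sub_zero, mul_one,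
          eval_one, one_smul] at h
        rw [h, lie_smul] }
  have hφ : ∀ v, φ v = (2⁻¹ : k) • δ (oddElt σ 1 v) := fun _ => rfl
  -- The component `β` is left out at first: it factors through the evaluation and is recovered from
  -- the cocycle on `g₀`.
  have hδ' := sub_mem hδ (fixedCocycle hσ p hp hx (φ, 0, γ)).2
  set δ' := δ - (fixedCocycle hσ p hp hx (φ, 0, γ) : onsagerAlgebra σ →ₗ[k] W)
  have hodd : ∀ P v, δ' (oddElt σ P v) = 0 := fun P v => by
    rw [LinearMap.sub_apply, fixedCocycle_oddElt, fixed_cocycle_odd hσ hx hδ, hφ, smul_smul,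
      mul_right_comm, mul_inv_cancel₀ two_ne_zero, one_mul, sub_self]
  have heven := fixed_cocycle_even hσ hσ₁ hx hδ' fun u => by
    rw [LinearMap.sub_apply, fixedCocycle_evenElt, fixed_cocycle_even_eq_center hσ hσ₁ hpz hp hx hδ,
      hγ]
    simp
  have hfac : δ' = (δ' ∘ₗ evenElt σ 1) ∘ₗ
      (evFixed σ x hx : onsagerAlgebra σ →ₗ[k] fixedSubalgebra σ) := by
    refine onsager_hom_ext hσ (fun P u => ?_) fun P v => ?_
    · change _ = δ' (evenElt σ 1 (evFixed σ x hx _))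
      rw [evFixed_evenElt, map_smul, map_smul, heven]
    · change _ = δ' (evenElt σ 1 (evFixed σ x hx _))
      rw [evFixed_oddElt, map_zero, map_zero, hodd]
  have hcoc := cocycle_of_factor (evFixed_surjective hx) hδ' (d := δ' ∘ₗ evenElt σ 1)
    (fun a => DFunLike.congr_fun hfac a)
  obtain ⟨w, β, hw⟩ : ∃ (w : W)
      (β : abPart σ →ₗ[k] LieModule.maxTrivSubmodule k (fixedSubalgebra σ) W),
      ∀ u, δ' (evenElt σ 1 u) = ⁅u, w⁆ + β (p u) := by
    -- A central element acting by a nonzero scalar makes the cocycle inner; otherwise the center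
    -- acts trivially, and an invariant-valued map on it may remain.
    by_cases h : ∃ z, μ z ≠ 0
    · obtain ⟨z, hz⟩ := h
      obtain ⟨w, hw⟩ := exists_inner_of_center_ne_zero _ hcoc z hz (hμ z)
      exact ⟨w, 0, fun u => (hw u).trans (add_zero _).symm⟩
    · push Not at h
      exact exists_inner_add_of_center_eq_zero hσ p hpz hp _ hcoc
        (fun z w => by rw [hμ, h, zero_smul])
  refine ⟨(φ, β, γ), w, fun a => ?_⟩
  have h1 : δ a - (fixedCocycle hσ p hp hx (φ, 0, γ) : onsagerAlgebra σ →ₗ[k] W) a =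
      ⁅evFixed σ x hx a, w⁆ + (β (p (evFixed σ x hx a)) : W) :=
    (DFunLike.congr_fun hfac a).trans (hw _)
  rw [sub_eq_iff_eq_add.mp h1, fixedCocycle_apply, fixedCocycle_apply, LinearMap.zero_apply]
  change _ + (β (p (evFixed σ x hx a)) : W) + _ = _
  rw [ZeroMemClass.coe_zero]
  abel

theorem nonempty_fixed_equiv [FiniteDimensional k W] [IsAlgClosed k]
    (hσ : ∀ u : g, σ (σ u) = u) (hσ₁ : ∃ u : g, σ u ≠ u) {x : kˣ} (hx : x = 1 ∨ x = -1)
    {μ : abPart σ → k}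
    (hμ : ∀ (z : abPart σ) (w : W), ⁅(z : fixedSubalgebra σ), w⁆ = μ z • w) :
    Nonempty (((oddPart σ →ₗ⁅k,fixedSubalgebra σ⁆ W) ×
      (abPart σ →ₗ[k] LieModule.maxTrivSubmodule k (fixedSubalgebra σ) W) ×
      (abPart σ →ₗ[k] LieModule.maxTrivSubmodule k (fixedSubalgebra σ) W)) ≃ₗ[k]
      FirstCohomology (evFixed σ x hx) W) := by
  obtain ⟨p, hpz, hp⟩ := exists_center_projection hσ hσ₁
  exact FirstCohomology.nonempty_equiv (fixedCocycle hσ p hp hx)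
    (fixedCocycle_injective hσ hpz hp hx hμ)
    (fun _ hδ => fixedCocycle_surjective hσ hσ₁ hpz hp hx hμ hδ)

end Fixed

/-! ### Schur's lemma and invariants of spaces of linear maps. -/

section Schur

variable {k h : Type*} [Field k] [LieRing h] [LieAlgebra k h]
  {V V' : Type*} [AddCommGroup V] [Module k V] [LieRingModule h V] [LieModule k h V]
  [AddCommGroup V'] [Module k V'] [LieRingModule h V'] [LieModule k h V']

theorem bijective_of_isIrreducible [LieModule.IsIrreducible k h V] [LieModule.IsIrreducible k h V']
    {f : V →ₗ⁅k,h⁆ V'} (hf : f ≠ 0) : Function.Bijective f := by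
  constructor
  · rw [← LieModuleHom.ker_eq_bot]
    refine (eq_bot_or_eq_top f.ker).resolve_right fun h0 => hf ?_
    ext v
    have hv : v ∈ f.ker := by
      rw [h0]
      trivial
    exact LieModuleHom.mem_ker.mp hv
  · rw [← LieModuleHom.range_eq_top]
    refine (eq_bot_or_eq_top f.range).resolve_left fun h0 => hf ?_
    ext v
    have hv : f v ∈ f.range := (LieModuleHom.mem_range f _).mpr ⟨v, rfl⟩
    rw [h0, LieSubmodule.mem_bot] at hv
    exact hv

theorem subsingleton_invariants [LieModule.IsIrreducible k h V] [LieModule.IsIrreducible k h V']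
    (hV : ¬ ∃ e : V ≃ₗ[k] V', ∀ (a : h) (v : V), e ⁅a, v⁆ = ⁅a, e v⁆) :
    Subsingleton (LieModule.maxTrivSubmodule k h (V →ₗ[k] V')) := by
  have : Subsingleton (V →ₗ⁅k,h⁆ V') := by
    refine subsingleton_of_forall_eq 0 fun f => ?_
    by_contra hf
    exact hV ⟨LinearEquiv.ofBijective (f : V →ₗ[k] V') (bijective_of_isIrreducible hf),
      fun a v => f.map_lie a v⟩
  exact LieModule.maxTrivLinearMapEquivLieModuleHom.toEquiv.subsingleton

/-- Invariants of `Hom(V, V')` are module homomorphisms `f`, and `e⁻¹ ∘ f` is a scalar by Schur's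
lemma. -/
theorem finrank_invariants [IsAlgClosed k] [FiniteDimensional k V] [LieModule.IsIrreducible k h V]
    (hV : ∃ e : V ≃ₗ[k] V', ∀ (a : h) (v : V), e ⁅a, v⁆ = ⁅a, e v⁆) :
    Module.finrank k (LieModule.maxTrivSubmodule k h (V →ₗ[k] V')) = 1 := by
  obtain ⟨e, he⟩ := hV
  have := LieModule.nontrivial_of_isIrreducible k h V
  rw [LinearEquiv.finrank_eq (LieModule.maxTrivLinearMapEquivLieModuleHom (R := k) (L := h)
    (M := V) (N := V'))]
  let E : V →ₗ⁅k,h⁆ V' := { (e : V →ₗ[k] V') with map_lie' := fun {a v} => he a v }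
  refine finrank_eq_one E (fun h0 => ?_) fun f => ?_
  · obtain ⟨v, hv⟩ := exists_ne (0 : V)
    exact hv (e.map_eq_zero_iff.mp (LieModuleHom.congr_fun h0 v))
  · obtain ⟨c, hc⟩ := exists_eq_smul_of_forall_lie_apply (k := k) (L := h)
      (e.symm.toLinearMap ∘ₗ (f : V →ₗ[k] V')) (fun a v => by
        change e.symm (f ⁅a, v⁆) = ⁅a, e.symm (f v)⁆
        rw [LieModuleHom.map_lie, LinearEquiv.symm_apply_eq, he, LinearEquiv.apply_symm_apply])
    refine ⟨c, ?_⟩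
    ext v
    have h1 : e.symm (f v) = c • v := hc v
    rw [LinearEquiv.symm_apply_eq, map_smul] at h1
    exact h1.symm

/-- Central elements act by scalars by Schur's lemma; linearity is tested on one nonzero vector. -/
theorem exists_smul_of_center_lie [IsAlgClosed k] [FiniteDimensional k V]
    [LieModule.IsIrreducible k h V] : ∃ χ : Module.Dual k (LieAlgebra.center k h),
      ∀ (z : LieAlgebra.center k h) (v : V), ⁅(z : h), v⁆ = χ z • v := by
  have := LieModule.nontrivial_of_isIrreducible k h V
  obtain ⟨v₀, hv₀⟩ := exists_ne (0 : V)
  have key : ∀ z : LieAlgebra.center k h, ∃ c : k, ∀ v : V, ⁅(z : h), v⁆ = c • v := fun z =>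
    exists_eq_smul_of_forall_lie_apply (k := k) (L := h) (LieModule.toEnd k h V z) fun a v => by
      change ⁅(z : h), ⁅a, v⁆⁆ = ⁅a, ⁅(z : h), v⁆⁆
      rw [leibniz_lie, ← lie_skew, (LieModule.mem_maxTrivSubmodule k h h _).mp z.2 a, neg_zero,
        zero_lie, zero_add]
  choose c hc using key
  refine ⟨{ toFun := c, map_add' := fun z z' => ?_, map_smul' := fun r z => ?_ }, hc⟩
  · refine smul_left_injective k hv₀ ?_
    change c (z + z') • v₀ = (c z + c z') • v₀
    rw [add_smul, ← hc, ← hc, ← hc, ← add_lie]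
    rfl
  · refine smul_left_injective k hv₀ ?_
    change c (r • z) • v₀ = (r • c z) • v₀
    rw [smul_assoc, ← hc, ← hc, ← smul_lie]
    rfl

theorem dualTensorHom_lie (a : h) (t : Module.Dual k V ⊗[k] V') :
    dualTensorHom k V V' ⁅a, t⁆ = ⁅a, dualTensorHom k V V' t⁆ := by
  induction t with
  | zero => rw [show ⁅a, (0 : Module.Dual k V ⊗[k] V')⁆ = 0 from
      lie_zero (M := Module.Dual k V ⊗[k] V') a, map_zero, lie_zero]
  | add t t' ht ht' =>
    rw [show ⁅a, t + t'⁆ = ⁅a, t⁆ + ⁅a, t'⁆ from lie_add a t t', map_add, ht, ht', map_add, lie_add]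
  | tmul f w =>
    ext v
    rw [TensorProduct.LieModule.lie_tmul_right, map_add, LinearMap.add_apply, dualTensorHom_apply,
      dualTensorHom_apply, LieHom.lie_apply, dualTensorHom_apply, dualTensorHom_apply,
      Module.Dual.lie_apply, lie_smul, neg_smul]
    abel

/-- Homomorphisms to `V^* ⊗ V'` are homomorphisms to the space of linear maps `V → V'`. -/
def homDualTensorEquiv [FiniteDimensional k V] (T : Type*) [AddCommGroup T] [Module k T]
    [LieRingModule h T] [LieModule k h T] :
    (T →ₗ⁅k,h⁆ Module.Dual k V ⊗[k] V') ≃ₗ[k] (T →ₗ⁅k,h⁆ (V →ₗ[k] V')) where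
  toFun f := { (dualTensorHomEquiv k V V').toLinearMap ∘ₗ (f : T →ₗ[k] Module.Dual k V ⊗[k] V') with
    map_lie' := fun {a t} => by
      change dualTensorHomEquiv k V V' (f ⁅a, t⁆) = ⁅a, dualTensorHomEquiv k V V' (f t)⁆
      rw [LieModuleHom.map_lie]
      exact dualTensorHom_lie a (f t) }
  invFun f := { (dualTensorHomEquiv k V V').symm.toLinearMap ∘ₗ (f : T →ₗ[k] V →ₗ[k] V') with
    map_lie' := fun {a t} => by
      change (dualTensorHomEquiv k V V').symm (f ⁅a, t⁆) =
        ⁅a, (dualTensorHomEquiv k V V').symm (f t)⁆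
      rw [LinearEquiv.symm_apply_eq, LieModuleHom.map_lie]
      refine Eq.trans ?_ (dualTensorHom_lie a _).symm
      exact congrArg _ (LinearEquiv.apply_symm_apply (dualTensorHomEquiv k V V') (f t)).symm }
  left_inv f := by
    ext t
    exact (dualTensorHomEquiv k V V').symm_apply_apply (f t)
  right_inv f := by
    apply LieModuleHom.ext
    intro t
    exact (dualTensorHomEquiv k V V').apply_symm_apply (f t)
  map_add' f f' := by
    apply LieModuleHom.ext
    intro t
    exact map_add (dualTensorHomEquiv k V V') (f t) (f' t)
  map_smul' r f := by
    apply LieModuleHom.ext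
    intro t
    exact map_smul (dualTensorHomEquiv k V V') r (f t)

end Schur

section RepIso

variable {k : Type u} [Field k] {L : Type u} [LieRing L] [LieAlgebra k L]
  {h : Type*} [LieRing h] [LieAlgebra k h]
  {V V' : Type u} [AddCommGroup V] [Module k V] [LieRingModule h V] [LieModule k h V]
  [AddCommGroup V'] [Module k V'] [LieRingModule h V'] [LieModule k h V']

theorem repIso_pullbackRep_iff {π : L →ₗ⁅k⁆ h} (hπ : Function.Surjective π) :
    RepIso (pullbackRep π V) (pullbackRep π V') ↔
      ∃ e : V ≃ₗ[k] V', ∀ (a : h) (v : V), e ⁅a, v⁆ = ⁅a, e v⁆ :=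
  exists_congr fun e =>
    (hπ.forall (p := fun a => ∀ v : V, e ⁅a, v⁆ = ⁅a, e v⁆)).symm

end RepIso

/-! ### Dimension counts and vanishing of odd homomorphisms. -/

section Dimension

variable {k : Type*} [Field k] {A Z I : Type*} [AddCommGroup A] [Module k A] [AddCommGroup Z]
  [Module k Z] [AddCommGroup I] [Module k I]

theorem nonempty_prod_equiv_of_subsingleton {B : Type*} [AddCommGroup B] [Module k B]
    [Subsingleton B] : Nonempty ((A × B × B) ≃ₗ[k] A) :=
  letI : Unique (B × B) := uniqueOfSubsingleton 0
  ⟨LinearEquiv.prodUnique⟩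

theorem nonempty_prod_equiv_of_finrank [FiniteDimensional k Z] (hI : Module.finrank k I = 1)
    {n : ℕ} (hn : n = 2 * Module.finrank k Z) :
    Nonempty (((Z →ₗ[k] I) × (Z →ₗ[k] I)) ≃ₗ[k] (Fin n → k)) := by
  have : FiniteDimensional k I := Module.finite_of_finrank_eq_succ hI
  refine ⟨LinearEquiv.ofFinrankEq _ _ ?_⟩
  rw [Module.finrank_prod, Module.finrank_linearMap, hI, Module.finrank_fin_fun, hn]
  ring

end Dimension

section OddHom

variable {k : Type u} [Field k] [CharZero k] {g : Type u} [LieRing g] [LieAlgebra k g]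
  [FiniteDimensional k g] [LieAlgebra.IsSimple k g] {σ : g ≃ₗ⁅k⁆ g}
  {W : Type*} [AddCommGroup W] [Module k W] [LieRingModule (fixedSubalgebra σ) W]
  [LieModule k (fixedSubalgebra σ) W]

/-- A nonzero central element acts bijectively on `g₁`, by injectivity and finite dimension, and by
zero on `W`. -/
theorem subsingleton_odd_hom (hσ : ∀ u : g, σ (σ u) = u) (hZ : abPart σ ≠ ⊥)
    (hW : ∀ (z : abPart σ) (w : W), ⁅(z : fixedSubalgebra σ), w⁆ = 0) :
    Subsingleton (oddPart σ →ₗ⁅k,fixedSubalgebra σ⁆ W) := by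
  obtain ⟨z, hz, hz0⟩ : ∃ z ∈ abPart σ, z ≠ 0 := by
    by_contra! h
    exact hZ ((LieSubmodule.eq_bot_iff _).mpr h)
  refine subsingleton_of_forall_eq 0 fun φ => ?_
  let A : Module.End k (oddPart σ) := LieModule.toEnd k (fixedSubalgebra σ) (oddPart σ) z
  have hA : Function.Injective A := by
    rw [injective_iff_map_eq_zero]
    intro v hv
    exact Subtype.ext (eq_zero_of_lie_center_eq_zero hσ (⟨z, hz⟩ : abPart σ)
      (fun h => hz0 (congrArg Subtype.val h)) v.2 (congrArg Subtype.val hv))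
  ext v
  obtain ⟨v, rfl⟩ := LinearMap.surjective_of_injective hA v
  change φ ⁅z, v⁆ = 0
  rw [LieModuleHom.map_lie]
  exact hW ⟨z, hz⟩ _

end OddHom

/-! ### Extensions of evaluation representations and the theorem. -/

section Main

variable {k : Type u} [Field k] [IsAlgClosed k] [CharZero k]
  {g : Type u} [LieRing g] [LieAlgebra k g] [FiniteDimensional k g] [LieAlgebra.IsSimple k g]
  {σ : g ≃ₗ⁅k⁆ g} {V V' : Type u} [AddCommGroup V] [Module k V] [FiniteDimensional k V]
  [AddCommGroup V'] [Module k V'] [FiniteDimensional k V']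

section GenericPoint

variable [LieRingModule g V] [LieModule k g V] [LieModule.IsIrreducible k g V]
  [LieRingModule g V'] [LieModule k g V'] [LieModule.IsIrreducible k g V']

theorem nonempty_ext1_evalRep_equiv (hσ : ∀ u : g, σ (σ u) = u) (hσ₁ : ∃ u : g, σ u ≠ u) {x : kˣ}
    (h1 : x ≠ 1) (h2 : x ≠ -1) :
    Nonempty (Ext1 (evalRep σ x V) (evalRep σ x V') ≃ₗ[k]
      (g →ₗ⁅k, g⁆ Module.Dual k V ⊗[k] V') ×
        (abPart σ →ₗ[k] LieModule.maxTrivSubmodule k g (V →ₗ[k] V')) ×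
        (abPart σ →ₗ[k] LieModule.maxTrivSubmodule k g (V →ₗ[k] V'))) := by
  obtain ⟨e₁⟩ := nonempty_ext1_equiv (V := V) (V' := V') (ev σ x)
  obtain ⟨e₂⟩ := nonempty_generic_equiv (W := V →ₗ[k] V') hσ hσ₁ h1 h2
  exact ⟨e₁.trans (e₂.symm.trans ((homDualTensorEquiv g).symm.prodCongr (LinearEquiv.refl k _)))⟩

theorem nonempty_ext1_evalRep_of_not_repIso (hσ : ∀ u : g, σ (σ u) = u) (hσ₁ : ∃ u : g, σ u ≠ u)
    {x : kˣ} (h1 : x ≠ 1) (h2 : x ≠ -1) (hV : ¬ RepIso (evalRep σ x V) (evalRep σ x V')) :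
    Nonempty (Ext1 (evalRep σ x V) (evalRep σ x V') ≃ₗ[k]
      (g →ₗ⁅k, g⁆ Module.Dual k V ⊗[k] V')) := by
  have := subsingleton_invariants
    (fun h => hV ((repIso_pullbackRep_iff (ev_surjective hσ h1 h2)).mpr h))
  obtain ⟨e₁⟩ := nonempty_ext1_evalRep_equiv (V := V) (V' := V') hσ hσ₁ h1 h2
  obtain ⟨e₂⟩ := nonempty_prod_equiv_of_subsingleton (k := k)
    (A := g →ₗ⁅k, g⁆ Module.Dual k V ⊗[k] V')
    (B := abPart σ →ₗ[k] LieModule.maxTrivSubmodule k g (V →ₗ[k] V'))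
  exact ⟨e₁.trans e₂⟩

theorem nonempty_ext1_evalRep_of_repIso (hσ : ∀ u : g, σ (σ u) = u) (hσ₁ : ∃ u : g, σ u ≠ u)
    {x : kˣ} (h1 : x ≠ 1) (h2 : x ≠ -1) (hV : RepIso (evalRep σ x V) (evalRep σ x V'))
    {n : ℕ} (hn : n = 2 * Module.finrank k (abPart σ)) :
    Nonempty (Ext1 (evalRep σ x V) (evalRep σ x V') ≃ₗ[k]
      (g →ₗ⁅k, g⁆ Module.Dual k V ⊗[k] V') × (Fin n → k)) := by
  obtain ⟨e₁⟩ := nonempty_ext1_evalRep_equiv (V := V) (V' := V') hσ hσ₁ h1 h2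
  obtain ⟨e₂⟩ := nonempty_prod_equiv_of_finrank
    (finrank_invariants ((repIso_pullbackRep_iff (ev_surjective hσ h1 h2)).mp hV)) hn
  exact ⟨e₁.trans ((LinearEquiv.refl k _).prodCongr e₂)⟩

end GenericPoint

theorem finrank_center_eq_one (hσ : ∀ u : g, σ (σ u) = u) (hσ₁ : ∃ u : g, σ u ≠ u)
    (hZ : abPart σ ≠ ⊥) : Module.finrank k (abPart σ) = 1 := by
  refine le_antisymm (finrank_center_le_one hσ hσ₁) (Nat.one_le_iff_ne_zero.mpr fun h => hZ ?_)
  have := Submodule.finrank_eq_zero.mp h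
  rwa [LieSubmodule.toSubmodule_eq_bot] at this

section FixedPoint

variable [LieRingModule (fixedSubalgebra σ) V] [LieModule k (fixedSubalgebra σ) V]
  [LieRingModule (fixedSubalgebra σ) V'] [LieModule k (fixedSubalgebra σ) V']

theorem lie_center_linearMap {χ χ' : Module.Dual k (abPart σ)} (hχ : ActsBy σ V χ)
    (hχ' : ActsBy σ V' χ') (z : abPart σ) (f : V →ₗ[k] V') :
    ⁅(z : fixedSubalgebra σ), f⁆ = (χ' z - χ z) • f := by
  ext v
  rw [LieHom.lie_apply, hχ z, hχ' z, map_smul, ← sub_smul]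
  rfl

variable [LieModule.IsIrreducible k (fixedSubalgebra σ) V]
  [LieModule.IsIrreducible k (fixedSubalgebra σ) V']

/-- Evaluation is onto `g₀`, so an isomorphism is `g₀`-equivariant and preserves the central
character. -/
theorem eq_of_repIso {x : kˣ} {hx : x = 1 ∨ x = -1}
    (hV : RepIso (evalRepFixed σ x hx V) (evalRepFixed σ x hx V'))
    {χ χ' : Module.Dual k (abPart σ)} (hχ : ActsBy σ V χ) (hχ' : ActsBy σ V' χ') : χ = χ' := by
  obtain ⟨e, he⟩ := (repIso_pullbackRep_iff (evFixed_surjective hx)).mp hV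
  have := LieModule.nontrivial_of_isIrreducible k (fixedSubalgebra σ) V
  obtain ⟨v, hv⟩ := exists_ne (0 : V)
  ext z
  have h := he z v
  rw [hχ z, hχ' z, map_smul] at h
  exact smul_left_injective k (mt e.map_eq_zero_iff.mp hv) h

theorem nonempty_ext1_evalRepFixed_equiv (hσ : ∀ u : g, σ (σ u) = u) (hσ₁ : ∃ u : g, σ u ≠ u)
    {x : kˣ} (hx : x = 1 ∨ x = -1) :
    Nonempty (Ext1 (evalRepFixed σ x hx V) (evalRepFixed σ x hx V') ≃ₗ[k]
      (oddPart σ →ₗ⁅k, fixedSubalgebra σ⁆ Module.Dual k V ⊗[k] V') ×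
        (abPart σ →ₗ[k] LieModule.maxTrivSubmodule k (fixedSubalgebra σ) (V →ₗ[k] V')) ×
        (abPart σ →ₗ[k] LieModule.maxTrivSubmodule k (fixedSubalgebra σ) (V →ₗ[k] V'))) := by
  obtain ⟨χ, hχ⟩ := exists_smul_of_center_lie (k := k) (h := fixedSubalgebra σ) (V := V)
  obtain ⟨χ', hχ'⟩ := exists_smul_of_center_lie (k := k) (h := fixedSubalgebra σ) (V := V')
  obtain ⟨e₁⟩ := nonempty_ext1_equiv (V := V) (V' := V') (evFixed σ x hx)
  obtain ⟨e₂⟩ := nonempty_fixed_equiv (W := V →ₗ[k] V') hσ hσ₁ hx (lie_center_linearMap hχ hχ')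
  exact ⟨e₁.trans (e₂.symm.trans
    ((homDualTensorEquiv (oddPart σ)).symm.prodCongr (LinearEquiv.refl k _)))⟩

theorem nonempty_ext1_evalRepFixed_of_subsingleton (hσ : ∀ u : g, σ (σ u) = u)
    (hσ₁ : ∃ u : g, σ u ≠ u) {x : kˣ} (hx : x = 1 ∨ x = -1)
    [Subsingleton
      (abPart σ →ₗ[k] LieModule.maxTrivSubmodule k (fixedSubalgebra σ) (V →ₗ[k] V'))] :
    Nonempty (Ext1 (evalRepFixed σ x hx V) (evalRepFixed σ x hx V') ≃ₗ[k]
      (oddPart σ →ₗ⁅k, fixedSubalgebra σ⁆ Module.Dual k V ⊗[k] V')) := by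
  obtain ⟨e₁⟩ := nonempty_ext1_evalRepFixed_equiv (V := V) (V' := V') hσ hσ₁ hx
  obtain ⟨e₂⟩ := nonempty_prod_equiv_of_subsingleton (k := k)
    (A := oddPart σ →ₗ⁅k, fixedSubalgebra σ⁆ Module.Dual k V ⊗[k] V')
    (B := abPart σ →ₗ[k] LieModule.maxTrivSubmodule k (fixedSubalgebra σ) (V →ₗ[k] V'))
  exact ⟨e₁.trans e₂⟩

theorem nonempty_ext1_evalRepFixed_of_not_repIso (hσ : ∀ u : g, σ (σ u) = u)
    (hσ₁ : ∃ u : g, σ u ≠ u) {x : kˣ} (hx : x = 1 ∨ x = -1)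
    (hV : ¬ RepIso (evalRepFixed σ x hx V) (evalRepFixed σ x hx V')) :
    Nonempty (Ext1 (evalRepFixed σ x hx V) (evalRepFixed σ x hx V') ≃ₗ[k]
      (oddPart σ →ₗ⁅k, fixedSubalgebra σ⁆ Module.Dual k V ⊗[k] V')) := by
  have := subsingleton_invariants
    (fun h => hV ((repIso_pullbackRep_iff (evFixed_surjective hx)).mpr h))
  exact nonempty_ext1_evalRepFixed_of_subsingleton hσ hσ₁ hx

theorem nonempty_ext1_evalRepFixed_of_repIso (hσ : ∀ u : g, σ (σ u) = u)
    (hσ₁ : ∃ u : g, σ u ≠ u) {x : kˣ} (hx : x = 1 ∨ x = -1)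
    (hV : RepIso (evalRepFixed σ x hx V) (evalRepFixed σ x hx V'))
    {n : ℕ} (hn : n = 2 * Module.finrank k (abPart σ)) :
    Nonempty (Ext1 (evalRepFixed σ x hx V) (evalRepFixed σ x hx V') ≃ₗ[k]
      (oddPart σ →ₗ⁅k, fixedSubalgebra σ⁆ Module.Dual k V ⊗[k] V') × (Fin n → k)) := by
  obtain ⟨e₁⟩ := nonempty_ext1_evalRepFixed_equiv (V := V) (V' := V') hσ hσ₁ hx
  obtain ⟨e₂⟩ := nonempty_prod_equiv_of_finrank
    (finrank_invariants ((repIso_pullbackRep_iff (evFixed_surjective hx)).mp hV)) hn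
  exact ⟨e₁.trans ((LinearEquiv.refl k _).prodCongr e₂)⟩

theorem subsingleton_odd_hom_dualTensor (hσ : ∀ u : g, σ (σ u) = u) (hZ : abPart σ ≠ ⊥)
    {χ : Module.Dual k (abPart σ)} (hχ : ActsBy σ V χ) (hχ' : ActsBy σ V' χ) :
    Subsingleton (oddPart σ →ₗ⁅k, fixedSubalgebra σ⁆ Module.Dual k V ⊗[k] V') := by
  have := subsingleton_odd_hom (W := V →ₗ[k] V') hσ hZ fun z f => by
    rw [lie_center_linearMap hχ hχ', sub_self, zero_smul]
  exact (homDualTensorEquiv (oddPart σ)).toEquiv.subsingleton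

end FixedPoint

end Main

end Onsager

end

open Onsager in
theorem proposition6p15 {k : Type u} [Field k] [IsAlgClosed k] [CharZero k]
    {g : Type u} [LieRing g] [LieAlgebra k g] [FiniteDimensional k g] [LieAlgebra.IsSimple k g]
    (σ : g ≃ₗ⁅k⁆ g) (hσ₂ : ∀ u : g, σ (σ u) = u) (hσ₁ : ∃ u : g, σ u ≠ u) :
    -- points `x ≠ ±1`
    (∀ x : kˣ, x ≠ 1 → x ≠ -1 →
      ∀ (V V' : Type u) [AddCommGroup V] [Module k V] [FiniteDimensional k V]
        [LieRingModule g V] [LieModule k g V] [LieModule.IsIrreducible k g V]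
        [AddCommGroup V'] [Module k V'] [FiniteDimensional k V']
        [LieRingModule g V'] [LieModule k g V'] [LieModule.IsIrreducible k g V'],
        (¬ RepIso (evalRep σ x V) (evalRep σ x V') →
          Nonempty (Ext1 (evalRep σ x V) (evalRep σ x V') ≃ₗ[k]
            (g →ₗ⁅k, g⁆ Module.Dual k V ⊗[k] V'))) ∧
        (RepIso (evalRep σ x V) (evalRep σ x V') →
          Nonempty (Ext1 (evalRep σ x V) (evalRep σ x V') ≃ₗ[k]
            (g →ₗ⁅k, g⁆ Module.Dual k V ⊗[k] V') ×
              (Fin (2 * Module.finrank k (abPart σ)) → k))) ∧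
        (abPart σ ≠ ⊥ → RepIso (evalRep σ x V) (evalRep σ x V') →
          Nonempty (Ext1 (evalRep σ x V) (evalRep σ x V') ≃ₗ[k]
            (g →ₗ⁅k, g⁆ Module.Dual k V ⊗[k] V') × (Fin 2 → k)))) ∧
    -- points `x = ±1`
    (∀ (x : kˣ) (hx : x = 1 ∨ x = -1),
      ∀ (V V' : Type u) [AddCommGroup V] [Module k V] [FiniteDimensional k V]
        [LieRingModule (fixedSubalgebra σ) V] [LieModule k (fixedSubalgebra σ) V]
        [LieModule.IsIrreducible k (fixedSubalgebra σ) V]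
        [AddCommGroup V'] [Module k V'] [FiniteDimensional k V']
        [LieRingModule (fixedSubalgebra σ) V'] [LieModule k (fixedSubalgebra σ) V']
        [LieModule.IsIrreducible k (fixedSubalgebra σ) V'],
        (¬ RepIso (evalRepFixed σ x hx V) (evalRepFixed σ x hx V') →
          Nonempty (Ext1 (evalRepFixed σ x hx V) (evalRepFixed σ x hx V') ≃ₗ[k]
            (oddPart σ →ₗ⁅k, fixedSubalgebra σ⁆ Module.Dual k V ⊗[k] V'))) ∧
        (RepIso (evalRepFixed σ x hx V) (evalRepFixed σ x hx V') →
          Nonempty (Ext1 (evalRepFixed σ x hx V) (evalRepFixed σ x hx V') ≃ₗ[k]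
            (oddPart σ →ₗ⁅k, fixedSubalgebra σ⁆ Module.Dual k V ⊗[k] V') ×
              (Fin (2 * Module.finrank k (abPart σ)) → k))) ∧
        -- the explicit values, in terms of the characters of `g_{0,ab}`
        (∃ χ : Module.Dual k (abPart σ), ActsBy σ V χ) ∧
        (∃ χ' : Module.Dual k (abPart σ), ActsBy σ V' χ') ∧
        (∀ χ χ' : Module.Dual k (abPart σ), ActsBy σ V χ → ActsBy σ V' χ' →
          ((χ ≠ χ' ∨ (χ = χ' ∧ abPart σ = ⊥)) →
            Nonempty (Ext1 (evalRepFixed σ x hx V) (evalRepFixed σ x hx V') ≃ₗ[k]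
              (oddPart σ →ₗ⁅k, fixedSubalgebra σ⁆ Module.Dual k V ⊗[k] V'))) ∧
          ((χ = χ' ∧ abPart σ ≠ ⊥ ∧
              ¬ RepIso (evalRepFixed σ x hx V) (evalRepFixed σ x hx V')) →
            Subsingleton (Ext1 (evalRepFixed σ x hx V) (evalRepFixed σ x hx V'))) ∧
          ((abPart σ ≠ ⊥ ∧ RepIso (evalRepFixed σ x hx V) (evalRepFixed σ x hx V')) →
            Nonempty (Ext1 (evalRepFixed σ x hx V) (evalRepFixed σ x hx V') ≃ₗ[k]
              (Fin 2 → k))))) := by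
  refine ⟨fun x h1 h2 V V' => ?_, fun x hx V V' => ?_⟩
  · intros
    refine ⟨nonempty_ext1_evalRep_of_not_repIso hσ₂ hσ₁ h1 h2,
      fun hV => nonempty_ext1_evalRep_of_repIso hσ₂ hσ₁ h1 h2 hV rfl,
      fun hZ hV => nonempty_ext1_evalRep_of_repIso hσ₂ hσ₁ h1 h2 hV ?_⟩
    rw [finrank_center_eq_one hσ₂ hσ₁ hZ]
  · intros
    refine ⟨nonempty_ext1_evalRepFixed_of_not_repIso hσ₂ hσ₁ hx,
      fun hV => nonempty_ext1_evalRepFixed_of_repIso hσ₂ hσ₁ hx hV rfl,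
      exists_smul_of_center_lie, exists_smul_of_center_lie, fun χ χ' hχ hχ' => ⟨?_, ?_, ?_⟩⟩
    · rintro (h | ⟨-, hZ⟩)
      · exact nonempty_ext1_evalRepFixed_of_not_repIso hσ₂ hσ₁ hx
          fun hV => h (eq_of_repIso hV hχ hχ')
      -- With zero center the summands of maps out of it vanish, whether or not `V ≅ V'`.
      · have : Subsingleton (abPart σ) := by
          rw [hZ]
          infer_instance
        exact nonempty_ext1_evalRepFixed_of_subsingleton hσ₂ hσ₁ hx
    -- Equal characters make the nonzero center act trivially on `Hom(V, V')`, so there are no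
    -- homomorphisms from `g₁`.
    · rintro ⟨rfl, hZ, hV⟩
      have := subsingleton_odd_hom_dualTensor hσ₂ hZ hχ hχ'
      obtain ⟨e⟩ := nonempty_ext1_evalRepFixed_of_not_repIso hσ₂ hσ₁ hx hV
      exact e.toEquiv.subsingleton
    -- Again the homomorphisms from `g₁` vanish; only the values at `±1` on a one-dimensional center
    -- remain.
    · rintro ⟨hZ, hV⟩
      obtain rfl := eq_of_repIso hV hχ hχ'
      have := subsingleton_odd_hom_dualTensor hσ₂ hZ hχ hχ'
      obtain ⟨e⟩ := nonempty_ext1_evalRepFixed_of_repIso hσ₂ hσ₁ hx hV (n := 2)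
        (by rw [finrank_center_eq_one hσ₂ hσ₁ hZ])
      let _ := @uniqueOfSubsingleton _ this 0
      exact ⟨e.trans LinearEquiv.uniqueProd⟩
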